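/- Let $m\ge 1$, let $\mathcal S(\mathbb R^m)$ be the space of complex-valued rapidly decreasing functions, and let $\Delta$, $|x|^2$ and $\mathbb E=\sum_i x_i\partial_{x_i}$ act on it as the Laplace operator, multiplication by $|x|^2$ and the Euler operator. Put $$h=-\tfrac{\Delta}{2}+\tfrac{|x|^2}{2},\quad e=-\tfrac{\Delta}{4}-\tfrac{|x|^2}{4}+\tfrac12\mathbb E+\tfrac m4,\quad f=\tfrac{\Delta}{4}+\tfrac{|x|^2}{4}+\tfrac12\mathbb E+\tfrac m4,\qquad \Omega=1+h^2+2ef+2fe .$$ For each $k\ge 0$ let $\{H_k^{(\ell)}\}_\ell$ be a basis of the space $\mathcal H_k$ of complex homogeneous polynomials of degree $k$ on $\mathbb R^m$ annihilated by $\Delta$, and let $$\phi_{j,k,\ell}=2^j j!\,L_j^{\frac m2+k-1}(|x|^2)\,H_k^{(\ell)}\,e^{-|x|^2/2}\qquad (j,k\ge 0)$$ be the Hermite functions, where $L_j^\alpha$ is the generalized Laguerre polynomial. For a linear operator $T:\mathcal S(\mathbb R^m)\to\mathcal S(\mathbb R^m)$ consider the properties (i) $T\circ\Delta=-|y|^2\circ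 T$ and $T\circ|x|^2=-\Delta\circ T$ (the Helmholtz relations); (ii) there are $\mu_{j,k}\in\mathbb C$, independent of $\ell$, with $T\phi_{j,k,\ell}=\mu_{j,k}\phi_{j,k,\ell}$ for all $j,k,\ell$; (iii) $T^4=\mathrm{id}$. Let $$E_n(x)=\prod_{l=0}^{n-1}\frac{x^2-l^2}{n^2-l^2},\qquad D_n(x)=\prod_{l=0}^{n-1}\frac{x^2-(l+\frac12)^2}{(n+\frac12)^2-(l+\frac12)^2}.$$ For a sequence $a=(a_n)_{n\ge0}$ with $a_n\in\{0,1,2,3\}$ let $F(\sqrt\Omega)$ be the series $\sum_n a_nE_n$ if $m$ is even, and $\sum_n a_nD_n$ if $m$ is odd, with $\Omega$ substituted for $x^2$. We say that a continuous linear operator $T$ on $\mathcal S(\mathbb R^m)$ is of the form $$T=e^{i\frac\pi2F(\sqrt\Omega)}\,e^{i\frac\pi2(h-\frac m2)}\qquad(\ast)$$ if, on the linear span of all Hermite functions, the series for $F(\sqrt\Omega)$ and the two exponential series converge pointwise in the topology of $\mathcal S(\mathbb R^m)$ to linear maps of this span into itself, and $T$ coincides there with the composition of the two exponentials. 1. For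 every sequence $a$ with $a_n\in\{0,1,2,3\}$ there is exactly one continuous linear operator $T:\mathcal S(\mathbb R^m)\to\mathcal S(\mathbb R^m)$ of the form $(\ast)$, and it satisfies (i), (ii) and (iii). 2. Conversely, let $m\ge2$. Every linear operator $T:\mathcal S(\mathbb R^m)\to\mathcal S(\mathbb R^m)$ that satisfies (i)–(iii) is equivalent to an operator of the form $(\ast)$: there are a sequence $a$ with $a_n\in\{0,1,2,3\}$ and a continuous linear operator $S$ on $\mathcal S(\mathbb R^m)$ of the form $(\ast)$ with $T\phi_{j,k,\ell}=S\phi_{j,k,\ell}$ for all $j,k,\ell$; if $T$ is continuous, then $T=S$. -/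

import Mathlib

open scoped SchwartzMap Nat ContDiff

noncomputable section

namespace HelmholtzFourier

/-! ### The Schwartz space and the differential operators -/

/-- Euclidean space of dimension `m`. -/
abbrev Space (m : ℕ) : Type := EuclideanSpace ℝ (Fin m)

/-- The space of rapidly decreasing complex-valued functions on Euclidean space. -/
abbrev Sch (m : ℕ) : Type := 𝓢(Space m, ℂ)

/-- The Laplace operator on the Schwartz space. -/
def laplaceOp (m : ℕ) : Sch m →L[ℂ] Sch m :=
  LineDeriv.laplacianCLM ℂ (Space m) (Sch m)

/-- Multiplication by `|x|²` on the Schwartz space. -/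
def normSqOp (m : ℕ) : Sch m →L[ℂ] Sch m :=
  SchwartzMap.smulLeftCLM ℂ (fun x : Space m ↦ ((‖x‖ ^ 2 : ℝ) : ℂ))

/-- The partial derivative in the `i`-th coordinate. -/
def partialOp (m : ℕ) (i : Fin m) : Sch m →L[ℂ] Sch m :=
  LineDeriv.lineDerivOpCLM ℂ (Sch m) (EuclideanSpace.single i (1 : ℝ) : Space m)

lemma laplaceOp_apply (m : ℕ) (f : Sch m) (x : Space m) :
    laplaceOp m f x = Laplacian.laplacian (f : Space m → ℂ) x := by
  rw [laplaceOp, SchwartzMap.laplacianCLM_eq]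
  exact SchwartzMap.laplacian_apply f x

/-- Multiplication by the `i`-th coordinate. -/
def coordOp (m : ℕ) (i : Fin m) : Sch m →L[ℂ] Sch m :=
  SchwartzMap.smulLeftCLM ℂ (fun x : Space m ↦ ((x i : ℝ) : ℂ))

/-- The Euler operator `∑ xᵢ ∂ᵢ`. -/
def eulerOp (m : ℕ) : Sch m →L[ℂ] Sch m :=
  ∑ i : Fin m, coordOp m i * partialOp m i

/-- `h = -Δ/2 + |x|²/2`. -/
def hOp (m : ℕ) : Sch m →L[ℂ] Sch m :=
  -((1 / 2 : ℂ) • laplaceOp m) + (1 / 2 : ℂ) • normSqOp m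

/-- `e = -Δ/4 - |x|²/4 + 𝔼/2 + m/4`. -/
def eOp (m : ℕ) : Sch m →L[ℂ] Sch m :=
  -((1 / 4 : ℂ) • laplaceOp m) - (1 / 4 : ℂ) • normSqOp m + (1 / 2 : ℂ) • eulerOp m
    + ((m : ℂ) / 4) • (1 : Sch m →L[ℂ] Sch m)

/-- `f = Δ/4 + |x|²/4 + 𝔼/2 + m/4`. -/
def fOp (m : ℕ) : Sch m →L[ℂ] Sch m :=
  (1 / 4 : ℂ) • laplaceOp m + (1 / 4 : ℂ) • normSqOp m + (1 / 2 : ℂ) • eulerOp m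
    + ((m : ℂ) / 4) • (1 : Sch m →L[ℂ] Sch m)

/-- The Casimir operator `Ω = 1 + h² + 2ef + 2fe`; products are compositions. -/
def casimir (m : ℕ) : Sch m →L[ℂ] Sch m :=
  1 + hOp m ^ 2 + (2 : ℂ) • (eOp m * fOp m) + (2 : ℂ) • (fOp m * eOp m)

lemma hasTemperateGrowth_coord (m : ℕ) (i : Fin m) :
    Function.HasTemperateGrowth (fun x : Space m ↦ ((x i : ℝ) : ℂ)) := by
  have h : Function.HasTemperateGrowth
      (fun x : Space m ↦ inner ℝ (EuclideanSpace.single i (1 : ℝ) : Space m) x) :=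
    Function.hasTemperateGrowth_inner_right _
  have h2 : (fun x : Space m ↦ ((x i : ℝ) : ℂ)) = fun x : Space m ↦
      ((inner ℝ (EuclideanSpace.single i (1 : ℝ) : Space m) x : ℝ) : ℂ) := by
    ext x
    simp [EuclideanSpace.inner_single_left]
  rw [h2]
  exact Function.Complex.hasTemperateGrowth_ofReal.comp h

lemma hasTemperateGrowth_normSq (m : ℕ) :
    Function.HasTemperateGrowth (fun x : Space m ↦ ((‖x‖ ^ 2 : ℝ) : ℂ)) :=
  Function.Complex.hasTemperateGrowth_ofReal.comp (Function.hasTemperateGrowth_norm_sq _)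

lemma normSqOp_apply (m : ℕ) (f : Sch m) (x : Space m) :
    normSqOp m f x = ((‖x‖ ^ 2 : ℝ) : ℂ) * f x := by
  rw [normSqOp, SchwartzMap.smulLeftCLM_apply_apply (hasTemperateGrowth_normSq m), smul_eq_mul]

lemma eulerOp_apply (m : ℕ) (f : Sch m) (x : Space m) :
    eulerOp m f x =
      ∑ i : Fin m, ((x i : ℝ) : ℂ) * fderiv ℝ f x (EuclideanSpace.single i (1 : ℝ)) := by
  simp [eulerOp, coordOp, partialOp, 
    SchwartzMap.smulLeftCLM_apply_apply (hasTemperateGrowth_coord m _),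
    SchwartzMap.lineDerivOp_apply_eq_fderiv]

/-! ### The Hermite functions -/

/-- `ℋ_k`: complex homogeneous polynomials of degree `k` in `m` variables that are annihilated by
the Laplace operator. -/
def sphericalHarmonics (m k : ℕ) : Submodule ℂ (MvPolynomial (Fin m) ℂ) :=
  MvPolynomial.homogeneousSubmodule (Fin m) ℂ k ⊓
    LinearMap.ker (∑ i : Fin m,
      ((MvPolynomial.pderiv i : Derivation ℂ (MvPolynomial (Fin m) ℂ) _) :
          MvPolynomial (Fin m) ℂ →ₗ[ℂ] MvPolynomial (Fin m) ℂ) ∘ₗ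
        ((MvPolynomial.pderiv i : Derivation ℂ (MvPolynomial (Fin m) ℂ) _) :
          MvPolynomial (Fin m) ℂ →ₗ[ℂ] MvPolynomial (Fin m) ℂ))

lemma mem_sphericalHarmonics (m k : ℕ) (H : MvPolynomial (Fin m) ℂ) :
    H ∈ sphericalHarmonics m k ↔
      H.IsHomogeneous k ∧ ∑ i : Fin m, MvPolynomial.pderiv i (MvPolynomial.pderiv i H) = 0 := by
  simp [sphericalHarmonics, MvPolynomial.mem_homogeneousSubmodule]

/-- The generalized Laguerre polynomial
`L_j^α(t) = ∑_{i ≤ j} (-1)^i binom(j + α, j - i) t^i / i!`, where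
`binom(j + α, r) = (j + α)(j + α - 1) ⋯ (j + α - r + 1) / r!`. -/
def laguerre (α : ℝ) (j : ℕ) (t : ℝ) : ℝ :=
  ∑ i ∈ Finset.range (j + 1),
    (-1) ^ i * ((∏ s ∈ Finset.range (j - i), ((j : ℝ) + α - s)) / ((j - i)! : ℝ)) *
      (t ^ i / (i ! : ℝ))

lemma hasTemperateGrowth_mvPoly (m : ℕ) (P : MvPolynomial (Fin m) ℂ) :
    Function.HasTemperateGrowth
      (fun x : Space m ↦ MvPolynomial.eval (fun i ↦ ((x i : ℝ) : ℂ)) P) := by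
  induction P using MvPolynomial.induction_on with
  | C a => simp [Function.HasTemperateGrowth.const]
  | add p q hp hq => simpa only [map_add] using! hp.add hq
  | mul_X p i hp => simpa only [map_mul, MvPolynomial.eval_X] using! hp.mul (hasTemperateGrowth_coord m i)

lemma hasTemperateGrowth_laguerre (m : ℕ) (α : ℝ) (j : ℕ) :
    Function.HasTemperateGrowth (fun x : Space m ↦ ((laguerre α j (‖x‖ ^ 2) : ℝ) : ℂ)) := by
  have hn : Function.HasTemperateGrowth (fun x : Space m ↦ ‖x‖ ^ 2) := (Function.hasTemperateGrowth_norm_sq _)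
  refine Function.Complex.hasTemperateGrowth_ofReal.comp (f := fun x : Space m ↦ laguerre α j (‖x‖ ^ 2)) ?_
  unfold laguerre
  refine Function.HasTemperateGrowth.sum fun i _ ↦ ?_
  refine (Function.HasTemperateGrowth.const _).mul ?_
  simp only [div_eq_mul_inv]
  exact (hn.pow i).mul (Function.HasTemperateGrowth.const _)

/-- The Gaussian `e^{-|x|²/2}` as a rapidly decreasing function. -/
def gaussian (m : ℕ) : Sch m where
  toFun x := ((Real.exp (-(‖x‖ ^ 2) / 2) : ℝ) : ℂ)
  smooth' := by
    have h : ContDiff ℝ ∞ (fun x : Space m ↦ ‖x‖ ^ 2) := contDiff_norm_sq ℝ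
    exact Complex.ofRealCLM.contDiff.comp (Real.contDiff_exp.comp (h.neg.div_const 2))
  decay' := by
    intro k n
    have ht : Function.HasTemperateGrowth (fun x : Space m ↦ -(‖x‖ ^ 2) / 2) := by
      have hn : Function.HasTemperateGrowth (fun x : Space m ↦ ‖x‖ ^ 2) :=
        (Function.hasTemperateGrowth_norm_sq _)
      simpa only [div_eq_mul_inv, neg_mul] using!
        (hn.mul (Function.HasTemperateGrowth.const (2⁻¹ : ℝ))).neg
    obtain ⟨p, C, hC0, hC⟩ := ht.norm_iteratedFDeriv_le_uniform n
    have hsm : ContDiff ℝ ∞ (fun x : Space m ↦ Real.exp (-(‖x‖ ^ 2) / 2)) :=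
      Real.contDiff_exp.comp ht.1
    refine ⟨(n ! : ℝ) * (C + 1) ^ n * (Real.exp (3 / 2) * ((p * n + k)! : ℝ)), fun x ↦ ?_⟩
    have hiso : ‖iteratedFDeriv ℝ n
        (fun x : Space m ↦ ((Real.exp (-(‖x‖ ^ 2) / 2) : ℝ) : ℂ)) x‖ =
        ‖iteratedFDeriv ℝ n (fun x : Space m ↦ Real.exp (-(‖x‖ ^ 2) / 2)) x‖ :=
      Complex.ofRealLI.norm_iteratedFDeriv_comp_left (n := ∞) hsm.contDiffAt
        (by exact_mod_cast le_top)
    rw [hiso]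
    have hx0 : (0 : ℝ) ≤ ‖x‖ := norm_nonneg x
    have hone : (1 : ℝ) ≤ (1 + ‖x‖) ^ p := one_le_pow₀ (by linarith)
    have hD1 : (1 : ℝ) ≤ (C + 1) * (1 + ‖x‖) ^ p := by nlinarith
    have hbd := norm_iteratedFDeriv_comp_le (𝕜 := ℝ) (n := n) (N := ∞) Real.contDiff_exp ht.1
      (by exact_mod_cast le_top) x (C := Real.exp (-(‖x‖ ^ 2) / 2))
      (D := (C + 1) * (1 + ‖x‖) ^ p)
      (fun i _ ↦ by
        rw [norm_iteratedFDeriv_eq_norm_iteratedDeriv, iteratedDeriv_eq_iterate,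
          Real.iter_deriv_exp, Real.norm_of_nonneg (Real.exp_pos _).le])
      (fun i hi hin ↦ by
        refine (hC i hin x).trans (le_trans ?_ (le_self_pow₀ hD1 (by omega)))
        nlinarith)
    have hq := Real.pow_div_factorial_le_exp (1 + ‖x‖) (by linarith) (p * n + k)
    rw [div_le_iff₀ (by positivity)] at hq
    have hexp : Real.exp (-(‖x‖ ^ 2) / 2) * Real.exp (1 + ‖x‖) ≤ Real.exp (3 / 2) := by
      rw [← Real.exp_add]
      apply Real.exp_le_exp.mpr
      nlinarith [sq_nonneg (‖x‖ - 1)]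
    have hk : ‖x‖ ^ k ≤ (1 + ‖x‖) ^ k := by gcongr; linarith
    calc ‖x‖ ^ k * ‖iteratedFDeriv ℝ n (fun x : Space m ↦ Real.exp (-(‖x‖ ^ 2) / 2)) x‖
        ≤ (1 + ‖x‖) ^ k * ((n ! : ℝ) * Real.exp (-(‖x‖ ^ 2) / 2) *
            ((C + 1) * (1 + ‖x‖) ^ p) ^ n) := by
          gcongr
          exact hbd
      _ = (n ! : ℝ) * (C + 1) ^ n *
            (Real.exp (-(‖x‖ ^ 2) / 2) * (1 + ‖x‖) ^ (p * n + k)) := by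
          rw [mul_pow, ← pow_mul, pow_add]; ring
      _ ≤ (n ! : ℝ) * (C + 1) ^ n * (Real.exp (-(‖x‖ ^ 2) / 2) *
            (Real.exp (1 + ‖x‖) * ((p * n + k)! : ℝ))) := by
          gcongr
      _ = (n ! : ℝ) * (C + 1) ^ n * ((Real.exp (-(‖x‖ ^ 2) / 2) *
            Real.exp (1 + ‖x‖)) * ((p * n + k)! : ℝ)) := by ring
      _ ≤ _ := by gcongr

/-- The Hermite function
`φ_{j,k}[H](x) = 2^j j! L_j^{m/2+k-1}(|x|²) H(x) e^{-|x|²/2}` attached to a polynomial `H`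
(of interest for `H` a spherical harmonic of degree `k`). -/
def hermiteFn (m j k : ℕ) (H : MvPolynomial (Fin m) ℂ) : Sch m :=
  SchwartzMap.smulLeftCLM ℂ
    (fun x : Space m ↦ (2 : ℂ) ^ j * (j ! : ℂ) *
      ((laguerre ((m : ℝ) / 2 + k - 1) j (‖x‖ ^ 2) : ℝ) : ℂ) *
      MvPolynomial.eval (fun i ↦ ((x i : ℝ) : ℂ)) H)
    (gaussian m)

lemma hermiteFn_apply (m j k : ℕ) (H : MvPolynomial (Fin m) ℂ) (x : Space m) :
    hermiteFn m j k H x =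
      (2 : ℂ) ^ j * (j ! : ℂ) * ((laguerre ((m : ℝ) / 2 + k - 1) j (‖x‖ ^ 2) : ℝ) : ℂ) *
        MvPolynomial.eval (fun i ↦ ((x i : ℝ) : ℂ)) H *
        ((Real.exp (-(‖x‖ ^ 2) / 2) : ℝ) : ℂ) := by
  have hg : Function.HasTemperateGrowth (fun x : Space m ↦ (2 : ℂ) ^ j * (j ! : ℂ) *
      ((laguerre ((m : ℝ) / 2 + k - 1) j (‖x‖ ^ 2) : ℝ) : ℂ) *
      MvPolynomial.eval (fun i ↦ ((x i : ℝ) : ℂ)) H) :=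
    ((Function.HasTemperateGrowth.const _).mul (hasTemperateGrowth_laguerre m _ j)).mul
      (hasTemperateGrowth_mvPoly m H)
  rw [hermiteFn, SchwartzMap.smulLeftCLM_apply_apply hg, smul_eq_mul]
  rfl

/-- The space of finite linear combinations of Hermite functions `φ_{j,k}[H]`, `H ∈ ℋ_k`. -/
def hermiteSpan (m : ℕ) : Submodule ℂ (Sch m) :=
  Submodule.span ℂ
    {g | ∃ j k : ℕ, ∃ H ∈ sphericalHarmonics m k, g = hermiteFn m j k H}

/-! ### Integer-valued polynomials -/

/-- `E_n` as a polynomial in `t = x²`: `E_n(x) = ∏_{l < n} (x² - l²)/(n² - l²)`. -/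
def polyE (n : ℕ) : Polynomial ℂ :=
  ∏ l ∈ Finset.range n,
    Polynomial.C (((n : ℂ) ^ 2 - (l : ℂ) ^ 2)⁻¹) * (Polynomial.X - Polynomial.C ((l : ℂ) ^ 2))

/-- `D_n` as a polynomial in `t = x²`:
`D_n(x) = ∏_{l < n} (x² - (l+1/2)²)/((n+1/2)² - (l+1/2)²)`. -/
def polyD (n : ℕ) : Polynomial ℂ :=
  ∏ l ∈ Finset.range n,
    Polynomial.C ((((n : ℂ) + 1 / 2) ^ 2 - ((l : ℂ) + 1 / 2) ^ 2)⁻¹) *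
      (Polynomial.X - Polynomial.C (((l : ℂ) + 1 / 2) ^ 2))

/-- `E_n` in even dimension and `D_n` in odd dimension, as a polynomial in `t = x²`. -/
def seriesPoly (m n : ℕ) : Polynomial ℂ :=
  if Even m then polyE n else polyD n

lemma polyE_eval_sq (n : ℕ) (x : ℂ) :
    (polyE n).eval (x ^ 2) =
      ∏ l ∈ Finset.range n, (x ^ 2 - (l : ℂ) ^ 2) / ((n : ℂ) ^ 2 - (l : ℂ) ^ 2) := by
  simp [polyE, Polynomial.eval_prod, div_eq_inv_mul]

lemma polyD_eval_sq (n : ℕ) (x : ℂ) :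
    (polyD n).eval (x ^ 2) =
      ∏ l ∈ Finset.range n, (x ^ 2 - ((l : ℂ) + 1 / 2) ^ 2) /
        (((n : ℂ) + 1 / 2) ^ 2 - ((l : ℂ) + 1 / 2) ^ 2) := by
  simp [polyD, Polynomial.eval_prod, div_eq_inv_mul]

/-! ### The operators `exp(iπ/2 F(√Ω)) exp(iπ/2 (h - m/2))` -/

/-- `F = ∑ aₙ Eₙ(√Ω)` (even dimension) or `F = ∑ aₙ Dₙ(√Ω)` (odd dimension) on the span of the
Hermite functions: the series, with `Ω` substituted for `x²`, converges to `F g` in the topology of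
the Schwartz space for every `g` in the span. -/
def IsSeriesInCasimir (m : ℕ) (a : ℕ → ℕ) (F : Module.End ℂ (hermiteSpan m)) : Prop :=
  ∀ g : hermiteSpan m,
    HasSum (fun n ↦ (a n : ℂ) • Polynomial.aeval (casimir m) (seriesPoly m n) (g : Sch m))
      (F g : Sch m)

/-- `U = exp A` on the span of the Hermite functions: the exponential series of `A` converges
pointwise to `U` in the topology of the Schwartz space. -/
def IsExp (m : ℕ) (A U : Module.End ℂ (hermiteSpan m)) : Prop :=
  ∀ g : hermiteSpan m,
    HasSum (fun n : ℕ ↦ ((n ! : ℂ)⁻¹) • (((A ^ n) g : hermiteSpan m) : Sch m)) (U g : Sch m)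

/-- The continuous operator `T` on the Schwartz space is
`exp(iπ/2 F(√Ω)) exp(iπ/2 (h - m/2))` with `F = ∑ aₙ Eₙ` (even `m`) or `F = ∑ aₙ Dₙ` (odd `m`).
The series are evaluated on the span of the Hermite functions (on which they converge), and
`T` is the continuous extension of the resulting operator. -/
def IsOperatorExponential (m : ℕ) (a : ℕ → ℕ) (T : Sch m →L[ℂ] Sch m) : Prop :=
  ∃ F N U V : Module.End ℂ (hermiteSpan m),
    IsSeriesInCasimir m a F ∧
    (∀ g : hermiteSpan m, (N g : Sch m) = hOp m (g : Sch m) - ((m : ℂ) / 2) • (g : Sch m)) ∧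
    IsExp m ((Complex.I * (Real.pi / 2 : ℂ)) • F) U ∧
    IsExp m ((Complex.I * (Real.pi / 2 : ℂ)) • N) V ∧
    ∀ g : hermiteSpan m, T (g : Sch m) = (U (V g) : Sch m)

/-! ### The three properties -/

/-- The Helmholtz relations `T ∘ Δ = -|y|² ∘ T` and `T ∘ |x|² = -Δ ∘ T`. -/
def HelmholtzRelations (m : ℕ) (T : Sch m →ₗ[ℂ] Sch m) : Prop :=
  (∀ g : Sch m, T (laplaceOp m g) = -normSqOp m (T g)) ∧
  (∀ g : Sch m, T (normSqOp m g) = -laplaceOp m (T g))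

/-- `T φ_{j,k,l} = μ_{j,k} φ_{j,k,l}` for the Hermite basis built from bases `b k` of `ℋ_k`, with
eigenvalues that do not depend on `l`. -/
def DiagonalOnHermite (m : ℕ) {ι : ℕ → Type*}
    (b : ∀ k, Module.Basis (ι k) ℂ (sphericalHarmonics m k)) (T : Sch m →ₗ[ℂ] Sch m) : Prop :=
  ∃ μ : ℕ → ℕ → ℂ, ∀ (j k : ℕ) (l : ι k),
    T (hermiteFn m j k (b k l : MvPolynomial (Fin m) ℂ)) =
      μ j k • hermiteFn m j k (b k l : MvPolynomial (Fin m) ℂ)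

end HelmholtzFourier

end

/-! Everything is decided on the Hermite functions. On `p(|x|²) H e^{-|x|²/2}` with `H ∈ ℋ_k` the
operators `h`, `e`, `f` become ordinary differential operators in `p`. There Ω is the scalar
`(m/2+k-1)²` (`casimir_radialFn`), and the Laguerre equation gives `h` the eigenvalue `2j+k+m/2`
(`hOp_hermiteFn`). So (∗) multiplies `φ_{j,k}` by `i^(F(m/2+k-1)+2j+k)`. At the relevant integers or
half-integers `E_n` and `D_n` take integer values; they vanish at the nodes below the `n`-th and
equal 1 there. Hence the series for `F` is a finite integer sum on each eigenspace, and the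
eigenvalue of (∗) is a fourth root of unity that changes sign when `j` grows by one.

By the three-term recurrence, `Δ` and `|x|²` have the same coefficients towards `φ_{j±1,k}` and
opposite coefficients on `φ_{j,k}`. A diagonal operator whose eigenvalues alternate in `j` therefore
satisfies the Helmholtz relations, and conversely these relations force the alternation
(`eigenvalue_succ_of_helmholtz`).

The continuous extension rests on three facts. Multiplication by phases that depend only on the
eigenvalues of the symmetric operators `h` and Ω preserves the `L²` norm and commutes with `h`. The
Schwartz seminorms are bounded by norms `‖h^N f‖` (`exists_seminorm_le`). The Hermite span is dense
(`dense_hermiteSpan`), which also gives uniqueness.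

For the converse, `T⁴ = id` makes `μ_{0,k}` a power of `i`, and alternation determines the other
eigenvalues from it. The coefficients `a_n` solve a triangular system of congruences modulo 4 with
unit diagonal (`exists_seriesSum_modEq`). This needs different `k` to give different eigenvalues of
Ω, which is true for `m ≥ 2`; for `m = 1` the values `(∓1/2)²` at `k = 0, 1` coincide. -/

noncomputable section
namespace HelmholtzFourier

/-! ### The Weyl algebra on the Schwartz space -/

lemma coordOp_apply (m : ℕ) (i : Fin m) (f : Sch m) (x : Space m) :
    coordOp m i f x = ((x i : ℝ) : ℂ) * f x := by
  rw [coordOp, SchwartzMap.smulLeftCLM_apply_apply (hasTemperateGrowth_coord m i), smul_eq_mul]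

lemma partialOp_apply (m : ℕ) (i : Fin m) (f : Sch m) (x : Space m) :
    partialOp m i f x = fderiv ℝ f x (EuclideanSpace.single i (1 : ℝ)) := by
  simp [partialOp, SchwartzMap.lineDerivOp_apply_eq_fderiv]

lemma mulOp_apply {m : ℕ} (A B : Sch m →L[ℂ] Sch m) (f : Sch m) : (A * B) f = A (B f) := rfl

lemma coordOp_comm (m : ℕ) (i j : Fin m) : coordOp m i * coordOp m j = coordOp m j * coordOp m i := by
  ext f x
  simp only [mulOp_apply, coordOp_apply]
  ring

lemma partialOp_comm (m : ℕ) (i j : Fin m) :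
    partialOp m i * partialOp m j = partialOp m j * partialOp m i := by
  ext f x
  have key : ∀ a b : Fin m, partialOp m a (partialOp m b f) x =
      iteratedFDeriv ℝ 2 f x ![EuclideanSpace.single a (1 : ℝ), EuclideanSpace.single b (1 : ℝ)] := by
    intro a b
    rw [← SchwartzMap.iteratedLineDerivOp_eq_iteratedFDeriv]
    simp [LineDeriv.iteratedLineDerivOp_succ_left, partialOp]
  simp only [mulOp_apply]
  rw [key, key, iteratedFDeriv_two_apply, iteratedFDeriv_two_apply]
  have hs : IsSymmSndFDerivAt ℝ (f : Space m → ℂ) x :=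
    (f.contDiffAt 2).isSymmSndFDerivAt (by simp)
  exact hs.eq _ _

/-- The canonical commutation relation, by the product rule. All later commutators and the lower
bound for `h` are derived from it. -/
lemma partialOp_mul_coordOp (m : ℕ) (i j : Fin m) :
    partialOp m i * coordOp m j =
      coordOp m j * partialOp m i + if i = j then 1 else 0 := by
  ext f x
  have h1 : (coordOp m j f : Space m → ℂ) = fun y ↦ ((y j : ℝ) : ℂ) * f y := by
    ext y; exact coordOp_apply m j f y
  have h2 : HasFDerivAt (fun y : Space m ↦ ((y j : ℝ) : ℂ))
      (Complex.ofRealCLM.comp (EuclideanSpace.proj j : Space m →L[ℝ] ℝ)) x :=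
    (Complex.ofRealCLM.comp (EuclideanSpace.proj j : Space m →L[ℝ] ℝ)).hasFDerivAt
  have h3 := (h2.mul (f.hasFDerivAt x)).fderiv
  have h4 : partialOp m i (coordOp m j f) x =
      fderiv ℝ (fun y : Space m ↦ ((y j : ℝ) : ℂ) * f y) x (EuclideanSpace.single i (1 : ℝ)) := by
    rw [partialOp_apply, h1]
  simp only [mulOp_apply, add_apply,
    coordOp_apply]
  rw [h4, partialOp_apply]
  have h5 := congrArg (fun L ↦ L (EuclideanSpace.single i (1 : ℝ))) h3
  refine h5.trans ?_
  by_cases hij : i = j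
  · subst hij; simp
  · have hji : j ≠ i := fun h ↦ hij h.symm
    simp [hij, hji]

lemma normSqOp_eq_sum (m : ℕ) : normSqOp m = ∑ i, coordOp m i * coordOp m i := by
  ext f x
  simp only [normSqOp_apply, sum_apply,
    mulOp_apply, coordOp_apply, ← mul_assoc, ← Finset.sum_mul]
  congr 1
  rw [EuclideanSpace.real_norm_sq_eq]
  push_cast
  simp [sq]

lemma laplaceOp_eq_sum (m : ℕ) : laplaceOp m = ∑ i, partialOp m i * partialOp m i := by
  ext f x
  rw [laplaceOp, SchwartzMap.laplacianCLM_eq,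
    SchwartzMap.laplacian_eq_sum (EuclideanSpace.basisFun (Fin m) ℝ)]
  simp [partialOp]

/-! ### Polynomials times the Gaussian -/

/-- Multiplication of the Gaussian by the polynomial function of `P`. -/
lemma smulLeft_gaussian_apply (m : ℕ) (P : MvPolynomial (Fin m) ℂ) (x : Space m) :
    SchwartzMap.smulLeftCLM ℂ
      (fun x : Space m ↦ MvPolynomial.eval (fun i ↦ ((x i : ℝ) : ℂ)) P) (gaussian m) x =
    MvPolynomial.eval (fun i ↦ ((x i : ℝ) : ℂ)) P * ((Real.exp (-(‖x‖ ^ 2) / 2) : ℝ) : ℂ) := by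
  rw [SchwartzMap.smulLeftCLM_apply_apply (hasTemperateGrowth_mvPoly m _), smul_eq_mul]
  rfl

/-- The map `P ↦ P e^{-|x|²/2}` from polynomials to rapidly decreasing functions. -/
def polyGauss (m : ℕ) : MvPolynomial (Fin m) ℂ →ₗ[ℂ] Sch m where
  toFun P := SchwartzMap.smulLeftCLM ℂ
    (fun x : Space m ↦ MvPolynomial.eval (fun i ↦ ((x i : ℝ) : ℂ)) P) (gaussian m)
  map_add' P Q := by
    ext x
    rw [add_apply, smulLeft_gaussian_apply, smulLeft_gaussian_apply, smulLeft_gaussian_apply,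
      map_add, add_mul]
  map_smul' c P := by
    ext x
    rw [smul_apply, smulLeft_gaussian_apply, smulLeft_gaussian_apply, MvPolynomial.smul_eval,
      smul_eq_mul, mul_assoc, RingHom.id_apply]

lemma polyGauss_apply (m : ℕ) (P : MvPolynomial (Fin m) ℂ) (x : Space m) :
    polyGauss m P x = MvPolynomial.eval (fun i ↦ ((x i : ℝ) : ℂ)) P *
      ((Real.exp (-(‖x‖ ^ 2) / 2) : ℝ) : ℂ) := by
  exact smulLeft_gaussian_apply m P x

/-- The Gaussian has no zeros, and a complex polynomial that vanishes on the product of infinite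
sets `ℝ^m ⊆ ℂ^m` is zero. -/
lemma polyGauss_injective (m : ℕ) : Function.Injective (polyGauss m) := by
  rw [← LinearMap.ker_eq_bot, LinearMap.ker_eq_bot']
  intro P hP
  have h : ∀ x : Fin m → ℝ, MvPolynomial.eval (fun i ↦ ((x i : ℝ) : ℂ)) P = 0 := by
    intro x
    have h1 := polyGauss_apply m P (WithLp.toLp 2 x)
    rw [hP] at h1
    have h2 := h1.symm
    rw [zero_apply, mul_eq_zero] at h2
    rcases h2 with h2 | h2
    · exact h2
    · exact absurd h2 (by exact_mod_cast (Real.exp_pos _).ne')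
  refine MvPolynomial.funext_set (fun _ ↦ Set.range ((↑) : ℝ → ℂ))
    (fun _ ↦ Set.infinite_range_of_injective Complex.ofReal_injective) ?_
  intro y hy
  have hy' : ∀ i, ∃ r : ℝ, (r : ℂ) = y i := fun i ↦ hy i (Set.mem_univ i)
  choose r hr using hy'
  have : y = fun i ↦ ((r i : ℝ) : ℂ) := by ext i; exact (hr i).symm
  rw [this, h, map_zero]

lemma coordOp_polyGauss (m : ℕ) (i : Fin m) (P : MvPolynomial (Fin m) ℂ) :
    coordOp m i (polyGauss m P) = polyGauss m (MvPolynomial.X i * P) := by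
  ext x
  simp only [coordOp_apply, polyGauss_apply, map_mul, MvPolynomial.eval_X]
  ring

lemma partialOp_polyGauss_one (m : ℕ) (i : Fin m) :
    partialOp m i (polyGauss m 1) = -polyGauss m (MvPolynomial.X i) := by
  ext x
  have h1 : (polyGauss m 1 : Space m → ℂ) = fun y ↦ ((Real.exp (-(‖y‖ ^ 2) / 2) : ℝ) : ℂ) := by
    ext y; simp [polyGauss_apply]
  have h2 : HasFDerivAt (fun y : Space m ↦ ‖y‖ ^ 2) (2 • (innerSL ℝ x)) x :=
    (hasStrictFDerivAt_norm_sq x).hasFDerivAt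
  have h3 := Complex.ofRealCLM.hasFDerivAt.comp x ((h2.neg.mul_const (2⁻¹ : ℝ)).exp)
  have h4 : partialOp m i (polyGauss m 1) x = fderiv ℝ
      (fun y : Space m ↦ ((Real.exp (-(‖y‖ ^ 2) * 2⁻¹) : ℝ) : ℂ)) x
        (EuclideanSpace.single i (1 : ℝ)) := by
    rw [partialOp_apply, h1]; rfl
  refine (h4.trans (congrArg (fun L ↦ L (EuclideanSpace.single i (1 : ℝ))) h3.fderiv)).trans ?_
  simp [polyGauss_apply, EuclideanSpace.inner_single_right, div_eq_mul_inv]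
  ring

/-- Conjugation by the Gaussian turns `∂ᵢ` into `∂ᵢ - xᵢ`. The induction on `P` uses the commutation
relation in place of analytic differentiation. -/
lemma partialOp_polyGauss (m : ℕ) (i : Fin m) (P : MvPolynomial (Fin m) ℂ) :
    partialOp m i (polyGauss m P) =
      polyGauss m (MvPolynomial.pderiv i P - MvPolynomial.X i * P) := by
  induction P using MvPolynomial.induction_on with
  | C a =>
    have h : (MvPolynomial.C a : MvPolynomial (Fin m) ℂ) = a • 1 := by
      rw [MvPolynomial.smul_eq_C_mul, mul_one]
    rw [h]
    simp [partialOp_polyGauss_one]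
  | add p q hp hq =>
    rw [map_add, map_add, hp, hq, ← map_add]
    congr 1
    rw [map_add]; ring
  | mul_X p j hp =>
    have h := congrArg (fun L ↦ L (polyGauss m p)) (partialOp_mul_coordOp m i j)
    simp only [mulOp_apply, add_apply, coordOp_polyGauss,
      hp] at h
    rw [mul_comm p, h]
    by_cases hij : i = j
    · subst hij
      simp only [if_true, one_apply_eq_self, ← map_add]
      congr 1
      simp [Derivation.leibniz]
      ring
    · have hji : j ≠ i := fun h ↦ hij h.symm
      simp only [hij, if_false, zero_apply, add_zero]
      congr 1
      simp [Derivation.leibniz, MvPolynomial.pderiv_X_of_ne hji]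
      ring

end HelmholtzFourier
end

/-! ### Differential operators on radial multiples of harmonic polynomials -/

noncomputable section
namespace HelmholtzFourier

/-- The polynomial `∑ Xᵢ²`. -/
def radSq (m : ℕ) : MvPolynomial (Fin m) ℂ := ∑ i, MvPolynomial.X i * MvPolynomial.X i

lemma normSqOp_polyGauss (m : ℕ) (P : MvPolynomial (Fin m) ℂ) :
    normSqOp m (polyGauss m P) = polyGauss m (radSq m * P) := by
  rw [normSqOp_eq_sum, sum_apply, radSq, Finset.sum_mul, map_sum]
  refine Finset.sum_congr rfl fun i _ ↦ ?_
  rw [mulOp_apply, coordOp_polyGauss, coordOp_polyGauss, mul_assoc]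

lemma eulerOp_polyGauss (m : ℕ) (P : MvPolynomial (Fin m) ℂ) :
    eulerOp m (polyGauss m P) =
      polyGauss m (∑ i, MvPolynomial.X i * MvPolynomial.pderiv i P - radSq m * P) := by
  rw [eulerOp, sum_apply, radSq, Finset.sum_mul, ← Finset.sum_sub_distrib, map_sum]
  refine Finset.sum_congr rfl fun i _ ↦ ?_
  rw [mulOp_apply, partialOp_polyGauss, coordOp_polyGauss]
  congr 1; ring

lemma laplaceOp_polyGauss (m : ℕ) (P : MvPolynomial (Fin m) ℂ) :
    laplaceOp m (polyGauss m P) =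
      polyGauss m (∑ i, MvPolynomial.pderiv i (MvPolynomial.pderiv i P)
        - 2 * ∑ i, MvPolynomial.X i * MvPolynomial.pderiv i P - m * P + radSq m * P) := by
  have hm : (m : MvPolynomial (Fin m) ℂ) = ∑ _i : Fin m, 1 := by simp
  rw [laplaceOp_eq_sum, sum_apply, radSq, hm, Finset.sum_mul, Finset.sum_mul, Finset.mul_sum,
    ← Finset.sum_sub_distrib, ← Finset.sum_sub_distrib, ← Finset.sum_add_distrib, map_sum]
  refine Finset.sum_congr rfl fun i _ ↦ ?_
  rw [mulOp_apply, partialOp_polyGauss, partialOp_polyGauss]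
  congr 1
  simp only [map_sub, Derivation.leibniz, MvPolynomial.pderiv_X_self, smul_eq_mul]
  ring

lemma pderiv_aeval_radSq (m : ℕ) (i : Fin m) (p : Polynomial ℂ) :
    MvPolynomial.pderiv i (Polynomial.aeval (radSq m) p) =
      Polynomial.aeval (radSq m) p.derivative * (2 * MvPolynomial.X i) := by
  have h : MvPolynomial.pderiv i (radSq m) = 2 * MvPolynomial.X i := by
    rw [radSq, map_sum, Finset.sum_eq_single i]
    · simp only [Derivation.leibniz, MvPolynomial.pderiv_X_self, smul_eq_mul]; ring
    · intro j _ hj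
      simp [Derivation.leibniz, MvPolynomial.pderiv_X_of_ne hj]
    · simp
  rw [Derivation.map_aeval, h, smul_eq_mul]

/-- The function `p(|x|²) H(x) e^{-|x|²/2}`. -/
def radialFn (m : ℕ) (H : MvPolynomial (Fin m) ℂ) : Polynomial ℂ →ₗ[ℂ] Sch m :=
  polyGauss m ∘ₗ LinearMap.mulRight ℂ H ∘ₗ (Polynomial.aeval (radSq m)).toLinearMap

lemma radialFn_apply (m : ℕ) (H : MvPolynomial (Fin m) ℂ) (p : Polynomial ℂ) :
    radialFn m H p = polyGauss m (Polynomial.aeval (radSq m) p * H) := rfl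

lemma sum_X_mul_pderiv_radial {m k : ℕ} {H : MvPolynomial (Fin m) ℂ}
    (hH : H ∈ sphericalHarmonics m k) (p : Polynomial ℂ) :
    ∑ i, MvPolynomial.X i * MvPolynomial.pderiv i (Polynomial.aeval (radSq m) p * H) =
      Polynomial.aeval (radSq m) (2 * Polynomial.X * p.derivative + (k : Polynomial ℂ) * p) * H := by
  have h1 := ((mem_sphericalHarmonics m k H).1 hH).1.sum_X_mul_pderiv
  simp only [Derivation.leibniz, pderiv_aeval_radSq, smul_eq_mul]
  have h2 : ∀ i : Fin m, MvPolynomial.X i * (Polynomial.aeval (radSq m) p * MvPolynomial.pderiv i H +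
      H * (Polynomial.aeval (radSq m) p.derivative * (2 * MvPolynomial.X i))) =
      Polynomial.aeval (radSq m) p * (MvPolynomial.X i * MvPolynomial.pderiv i H) +
      2 * Polynomial.aeval (radSq m) p.derivative * H * (MvPolynomial.X i * MvPolynomial.X i) :=
    fun i ↦ by ring
  simp only [h2, Finset.sum_add_distrib, ← Finset.mul_sum, h1]
  rw [← radSq]
  simp only [map_add, map_mul, Polynomial.aeval_X, map_natCast, map_ofNat, nsmul_eq_mul]
  ring

/-- The cross terms form `∑ xᵢ ∂ᵢ H = k H` by Euler's identity, and the terms with second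
derivatives of `H` vanish by harmonicity. Only derivatives of `p` survive. -/
lemma sum_pderiv_pderiv_radial {m k : ℕ} {H : MvPolynomial (Fin m) ℂ}
    (hH : H ∈ sphericalHarmonics m k) (p : Polynomial ℂ) :
    ∑ i, MvPolynomial.pderiv i (MvPolynomial.pderiv i (Polynomial.aeval (radSq m) p * H)) =
      Polynomial.aeval (radSq m) (4 * Polynomial.X * p.derivative.derivative +
        (2 * (m : Polynomial ℂ) + 4 * (k : Polynomial ℂ)) * p.derivative) * H := by
  have h1 := ((mem_sphericalHarmonics m k H).1 hH).1.sum_X_mul_pderiv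
  have h0 := ((mem_sphericalHarmonics m k H).1 hH).2
  have hm : (m : MvPolynomial (Fin m) ℂ) = ∑ _i : Fin m, 1 := by simp
  have h2 : ∀ i : Fin m, MvPolynomial.pderiv i (MvPolynomial.pderiv i
      (Polynomial.aeval (radSq m) p * H)) =
      Polynomial.aeval (radSq m) p * MvPolynomial.pderiv i (MvPolynomial.pderiv i H) +
      4 * Polynomial.aeval (radSq m) p.derivative * (MvPolynomial.X i * MvPolynomial.pderiv i H) +
      2 * Polynomial.aeval (radSq m) p.derivative * H * 1 +
      4 * Polynomial.aeval (radSq m) p.derivative.derivative * H *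
        (MvPolynomial.X i * MvPolynomial.X i) := by
    intro i
    have h3 : MvPolynomial.pderiv i (2 : MvPolynomial (Fin m) ℂ) = 0 :=
      Derivation.map_natCast _ 2
    simp only [Derivation.leibniz, pderiv_aeval_radSq, smul_eq_mul, map_add,
      MvPolynomial.pderiv_X_self, h3]
    ring
  simp only [h2, Finset.sum_add_distrib, ← Finset.mul_sum, h1, h0]
  rw [← radSq, ← hm]
  simp only [map_add, map_mul, Polynomial.aeval_X, map_natCast, map_ofNat, nsmul_eq_mul]
  ring

lemma normSqOp_radialFn (m : ℕ) (H : MvPolynomial (Fin m) ℂ) (p : Polynomial ℂ) :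
    normSqOp m (radialFn m H p) = radialFn m H (Polynomial.X * p) := by
  simp only [radialFn_apply, normSqOp_polyGauss, map_mul, Polynomial.aeval_X, mul_assoc]

lemma eulerOp_radialFn {m k : ℕ} {H : MvPolynomial (Fin m) ℂ}
    (hH : H ∈ sphericalHarmonics m k) (p : Polynomial ℂ) : eulerOp m (radialFn m H p) =
    radialFn m H (2 * Polynomial.X * p.derivative + (k : Polynomial ℂ) * p - Polynomial.X * p) := by
  simp only [radialFn_apply, eulerOp_polyGauss, sum_X_mul_pderiv_radial hH, map_mul,
    Polynomial.aeval_X, map_sub (Polynomial.aeval (R := ℂ) (radSq m)), sub_mul, mul_assoc]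

lemma laplaceOp_radialFn {m k : ℕ} {H : MvPolynomial (Fin m) ℂ}
    (hH : H ∈ sphericalHarmonics m k) (p : Polynomial ℂ) : laplaceOp m (radialFn m H p) =
    radialFn m H (4 * Polynomial.X * p.derivative.derivative + (2 * (m : Polynomial ℂ) + 4 * (k : Polynomial ℂ)) * p.derivative
      - 4 * Polynomial.X * p.derivative - (2 * (k : Polynomial ℂ) + (m : Polynomial ℂ)) * p + Polynomial.X * p) := by
  simp only [radialFn_apply, laplaceOp_polyGauss, sum_X_mul_pderiv_radial hH,
    sum_pderiv_pderiv_radial hH]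
  congr 1
  simp only [map_add, map_sub, map_mul, Polynomial.aeval_X, map_natCast, map_ofNat]
  ring


/-! ### The triple `h`, `e`, `f` and the Casimir operator in the radial variable -/

open Polynomial in
-- The bracket is the Laguerre operator with parameter `m/2+k-1`, so Laguerre polynomials give
-- eigenfunctions of `h`.
lemma hOp_radialFn {m k : ℕ} {H : MvPolynomial (Fin m) ℂ} (hH : H ∈ sphericalHarmonics m k)
    (p : ℂ[X]) : hOp m (radialFn m H p) =
    radialFn m H (-2 * (X * derivative (derivative p) + C ((m : ℂ) / 2 + k) * derivative p
      - X * derivative p) + C ((m : ℂ) / 2 + k) * p) := by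
  simp only [hOp, add_apply, neg_apply, smul_apply, laplaceOp_radialFn hH, normSqOp_radialFn,
    ← map_smul, ← map_neg, ← map_add]
  congr 1
  have h2 : (C (1 / 2 : ℂ) : ℂ[X]) * 2 = 1 := by
    rw [← C_ofNat, ← C_mul]; norm_num
  simp only [smul_eq_C_mul, div_eq_mul_inv, one_mul, C_mul, C_add, C_eq_natCast] at h2 ⊢
  linear_combination (-2 * X * derivative (derivative p) - 2 * k * derivative p +
    2 * X * derivative p + k * p) * h2

open Polynomial in
lemma eOp_radialFn {m k : ℕ} {H : MvPolynomial (Fin m) ℂ} (hH : H ∈ sphericalHarmonics m k)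
    (p : ℂ[X]) : eOp m (radialFn m H p) =
    radialFn m H (-(X * derivative (derivative p)) + (2 * X - C ((m : ℂ) / 2 + k)) * derivative p
      + (C ((m : ℂ) / 2 + k) - X) * p) := by
  simp only [eOp, add_apply, neg_apply, sub_apply, smul_apply, laplaceOp_radialFn hH,
    normSqOp_radialFn, eulerOp_radialFn hH, one_apply_eq_self, ← map_smul, ← map_neg, ← map_add,
    ← map_sub (radialFn m H)]
  congr 1
  have h2 : (C (1 / 4 : ℂ) : ℂ[X]) * 4 = 1 := by
    rw [← C_ofNat, ← C_mul]; norm_num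
  have h3 : (C (1 / 2 : ℂ) : ℂ[X]) = C (1 / 4 : ℂ) * 2 := by
    rw [← C_ofNat, ← C_mul]; norm_num
  have h4 : (C ((m : ℂ) / 2 + k) : ℂ[X]) = C (1 / 4 : ℂ) * 2 * m + k := by
    rw [← C_ofNat, ← C_mul, ← C_eq_natCast, ← C_eq_natCast, ← C_mul, ← C_add]
    congr 1; ring
  have h5 : (C ((m : ℂ) / 4) : ℂ[X]) = C (1 / 4 : ℂ) * m := by
    rw [← C_eq_natCast, ← C_mul]; congr 1; ring
  simp only [smul_eq_C_mul, h3, h4, h5]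
  linear_combination (-X * derivative (derivative p) - k * derivative p +
    2 * X * derivative p + k * p - X * p) * h2

open Polynomial in
lemma fOp_radialFn {m k : ℕ} {H : MvPolynomial (Fin m) ℂ} (hH : H ∈ sphericalHarmonics m k)
    (p : ℂ[X]) : fOp m (radialFn m H p) =
    radialFn m H (X * derivative (derivative p) + C ((m : ℂ) / 2 + k) * derivative p) := by
  simp only [fOp, add_apply, smul_apply, laplaceOp_radialFn hH,
    normSqOp_radialFn, eulerOp_radialFn hH, one_apply_eq_self, ← map_smul, ← map_neg, ← map_add,
    ← map_sub (radialFn m H)]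
  congr 1
  have h2 : (C (1 / 4 : ℂ) : ℂ[X]) * 4 = 1 := by
    rw [← C_ofNat, ← C_mul]; norm_num
  have h3 : (C (1 / 2 : ℂ) : ℂ[X]) = C (1 / 4 : ℂ) * 2 := by
    rw [← C_ofNat, ← C_mul]; norm_num
  have h4 : (C ((m : ℂ) / 2 + k) : ℂ[X]) = C (1 / 4 : ℂ) * 2 * m + k := by
    rw [← C_ofNat, ← C_mul, ← C_eq_natCast, ← C_eq_natCast, ← C_mul, ← C_add]
    congr 1; ring
  have h5 : (C ((m : ℂ) / 4) : ℂ[X]) = C (1 / 4 : ℂ) * m := by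
    rw [← C_eq_natCast, ← C_mul]; congr 1; ring
  simp only [smul_eq_C_mul, h3, h4, h5]
  linear_combination (X * derivative (derivative p) + k * derivative p) * h2

open Polynomial in
/-- The Casimir operator acts on `p(|x|²) H(x) e^{-|x|²/2}`, `H ∈ ℋ_k`, as `(m/2 + k - 1)²`. -/
lemma casimir_radialFn {m k : ℕ} {H : MvPolynomial (Fin m) ℂ} (hH : H ∈ sphericalHarmonics m k)
    (p : ℂ[X]) : casimir m (radialFn m H p) = ((m : ℂ) / 2 + k - 1) ^ 2 • radialFn m H p := by
  simp only [casimir, add_apply, smul_apply, one_apply_eq_self, pow_two (hOp m), mulOp_apply,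
    hOp_radialFn hH, eOp_radialFn hH, fOp_radialFn hH, ← map_smul, ← map_add (radialFn m H)]
  congr 1
  -- The dimension and the degree enter only through `β`. After expansion all terms containing
  -- derivatives of `p` cancel.
  generalize (m : ℂ) / 2 + k = β
  have h2 : derivative (2 : ℂ[X]) = 0 := derivative_ofNat 2
  simp only [smul_eq_C_mul, C_ofNat, C_sub, C_pow, C_1, derivative_add, derivative_sub,
    derivative_mul, derivative_neg, derivative_X, derivative_C, derivative_one, derivative_zero, h2]
  ring

end HelmholtzFourier
end

noncomputable section
namespace HelmholtzFourier

/-! ### Laguerre polynomials -/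

/-- The coefficient of `t^i` in the generalized Laguerre polynomial `L_j^α`. -/
def laguerreCoeff (α : ℂ) (j i : ℕ) : ℂ :=
  if i ≤ j then (-1) ^ i * ((∏ s ∈ Finset.range (j - i), ((j : ℂ) + α - s)) / ((j - i)! : ℂ)) /
    (i ! : ℂ) else 0

/-- The generalized Laguerre polynomial as a complex polynomial. -/
def laguerrePoly (α : ℂ) (j : ℕ) : Polynomial ℂ :=
  ∑ i ∈ Finset.range (j + 1), Polynomial.monomial i (laguerreCoeff α j i)

lemma coeff_laguerrePoly (α : ℂ) (j i : ℕ) :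
    (laguerrePoly α j).coeff i = laguerreCoeff α j i := by
  simp only [laguerrePoly, Polynomial.finsetSum_coeff, Polynomial.coeff_monomial]
  rw [Finset.sum_ite_eq']
  by_cases h : i ≤ j
  · simp [Nat.lt_succ_of_le h]
  · simp [laguerreCoeff, h]

lemma eval_laguerrePoly (α : ℝ) (j : ℕ) (t : ℝ) :
    (laguerrePoly α j).eval (t : ℂ) = ((laguerre α j t : ℝ) : ℂ) := by
  rw [laguerrePoly, laguerre, Polynomial.eval_finsetSum]
  push_cast
  refine Finset.sum_congr rfl fun i hi ↦ ?_
  have h : i ≤ j := Nat.lt_succ_iff.1 (Finset.mem_range.1 hi)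
  rw [Polynomial.eval_monomial, laguerreCoeff, if_pos h]
  ring

/-- The ratio of consecutive coefficients, with denominators cleared so that it holds for every `α`
and also beyond the degree. It is the Laguerre equation read coefficientwise. -/
lemma laguerreCoeff_succ_right (α : ℂ) (j i : ℕ) :
    ((i : ℂ) + 1) * (i + 1 + α) * laguerreCoeff α j (i + 1) = (i - j) * laguerreCoeff α j i := by
  rcases lt_trichotomy i j with h | h | h
  · obtain ⟨d, rfl⟩ : ∃ d, j = i + 1 + d := ⟨j - (i + 1), by omega⟩
    have h1 : i + 1 + d - i = d + 1 := by omega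
    have h2 : i + 1 + d - (i + 1) = d := by omega
    rw [laguerreCoeff, laguerreCoeff, if_pos (by omega), if_pos (by omega), h1, h2,
      Finset.prod_range_succ, Nat.factorial_succ, Nat.factorial_succ]
    have hd : ((d : ℂ) + 1) ≠ 0 := by exact_mod_cast Nat.succ_ne_zero d
    have hi : ((i : ℂ) + 1) ≠ 0 := by exact_mod_cast Nat.succ_ne_zero i
    have hd' : (d ! : ℂ) ≠ 0 := by exact_mod_cast d.factorial_ne_zero
    have hi' : (i ! : ℂ) ≠ 0 := by exact_mod_cast i.factorial_ne_zero
    push_cast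
    field_simp
    ring
  · subst h; simp [laguerreCoeff]
  · simp [laguerreCoeff, show ¬ i ≤ j by omega, show ¬ i + 1 ≤ j by omega]

lemma laguerreCoeff_succ_left (α : ℂ) (j i : ℕ) :
    ((j : ℂ) + 1 - i) * laguerreCoeff α (j + 1) i = (j + 1 + α) * laguerreCoeff α j i := by
  rcases Nat.lt_or_ge j i with h | h
  · rcases Nat.lt_or_ge (j + 1) i with h' | h'
    · simp [laguerreCoeff, show ¬ i ≤ j by omega, show ¬ i ≤ j + 1 by omega]
    · have : i = j + 1 := by omega
      subst this; simp [laguerreCoeff]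
  · obtain ⟨d, rfl⟩ : ∃ d, j = i + d := ⟨j - i, by omega⟩
    have h1 : i + d + 1 - i = d + 1 := by omega
    have h2 : i + d - i = d := by omega
    rw [laguerreCoeff, laguerreCoeff, if_pos (by omega), if_pos (by omega), h1, h2,
      -- Splitting off the factor `s = 0`, which is `j+1+α`, shifts the remaining product to the one
      -- belonging to `j`.
      Finset.prod_range_succ', Nat.factorial_succ]
    have hp : ∏ s ∈ Finset.range d, (((i + d + 1 : ℕ) : ℂ) + α - ((s + 1 : ℕ) : ℂ)) =
        ∏ s ∈ Finset.range d, (((i + d : ℕ) : ℂ) + α - (s : ℂ)) :=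
      Finset.prod_congr rfl fun s _ ↦ by push_cast; ring
    rw [hp]
    have hd : ((d : ℂ) + 1) ≠ 0 := by exact_mod_cast Nat.succ_ne_zero d
    have hd' : (d ! : ℂ) ≠ 0 := by exact_mod_cast d.factorial_ne_zero
    have hi' : (i ! : ℂ) ≠ 0 := by exact_mod_cast i.factorial_ne_zero
    push_cast
    field_simp
    ring

lemma laguerreCoeff_self (α : ℂ) (j : ℕ) : laguerreCoeff α j j = (-1) ^ j / (j ! : ℂ) := by
  simp [laguerreCoeff]

open Polynomial in
/-- The Laguerre differential equation. -/
lemma laguerrePoly_ode (α : ℂ) (j : ℕ) :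
    X * derivative (derivative (laguerrePoly α j)) + C (α + 1) * derivative (laguerrePoly α j)
      - X * derivative (laguerrePoly α j) = -(j : ℂ[X]) * laguerrePoly α j := by
  ext i
  have h := laguerreCoeff_succ_right α j i
  rw [← C_eq_natCast, ← C_neg]
  cases i with
  | zero =>
    simp only [coeff_add, coeff_sub, coeff_C_mul, coeff_derivative, coeff_X_mul_zero,
      coeff_laguerrePoly] at h ⊢
    push_cast at h ⊢
    linear_combination h
  | succ i =>
    simp only [coeff_add, coeff_sub, coeff_C_mul, coeff_derivative, coeff_X_mul,
      coeff_laguerrePoly] at h ⊢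
    push_cast at h ⊢
    linear_combination h

open Polynomial in
-- On the monomial `t^i` the left side multiplies by `j - i`, the factor in
-- `laguerreCoeff_succ_left`. At `j = 0` the truncated index `j - 1` is meaningless, hence the case
-- distinction.
lemma laguerrePoly_lower (α : ℂ) (j : ℕ) :
    (j : ℂ[X]) * laguerrePoly α j - X * derivative (laguerrePoly α j) =
      if j = 0 then 0 else C (j + α) * laguerrePoly α (j - 1) := by
  ext i
  have hc : ((j : ℂ[X]) * laguerrePoly α j - X * derivative (laguerrePoly α j)).coeff i =
      (j - i) * laguerreCoeff α j i := by
    rw [← C_eq_natCast]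
    cases i with
    | zero => simp [coeff_laguerrePoly]
    | succ i =>
      simp only [coeff_sub, coeff_C_mul, coeff_derivative, coeff_X_mul, coeff_laguerrePoly]
      push_cast; ring
  rw [hc]
  cases j with
  | zero =>
    rcases Nat.eq_zero_or_pos i with h | h
    · simp [h]
    · simp [laguerreCoeff, show ¬ i ≤ 0 by omega]
  | succ j =>
    have h := laguerreCoeff_succ_left α j i
    rw [if_neg (Nat.succ_ne_zero j), Nat.add_sub_cancel, coeff_C_mul, coeff_laguerrePoly]
    push_cast
    exact h

open Polynomial in
lemma laguerrePoly_raise (α : ℂ) (j : ℕ) :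
    ((j : ℂ[X]) + 1) * laguerrePoly α (j + 1) =
      (C (j + 1 + α) - X) * laguerrePoly α j + X * derivative (laguerrePoly α j) := by
  ext i
  rw [← C_eq_natCast, ← C_1, ← C_add, sub_mul]
  cases i with
  | zero =>
    have h := laguerreCoeff_succ_left α j 0
    simp only [coeff_add, coeff_sub, coeff_C_mul, coeff_X_mul_zero, coeff_laguerrePoly] at h ⊢
    push_cast at h
    linear_combination h
  | succ i =>
    simp only [coeff_add, coeff_sub, coeff_C_mul, coeff_derivative, coeff_X_mul,
      coeff_laguerrePoly]
    have h1 := laguerreCoeff_succ_left α j (i + 1)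
    have h2 := laguerreCoeff_succ_right α j i
    -- Both recurrences apply after multiplication by `j - i`. This factor vanishes at `i = j`,
    -- where the leading coefficients are compared directly.
    by_cases hij : i = j
    · subst hij
      rw [laguerreCoeff_self, laguerreCoeff_self, laguerreCoeff, if_neg (by omega),
        Nat.factorial_succ]
      have hd : ((i : ℂ) + 1) ≠ 0 := by exact_mod_cast Nat.succ_ne_zero i
      have hd' : (i ! : ℂ) ≠ 0 := by exact_mod_cast i.factorial_ne_zero
      push_cast
      field_simp
      ring
    · have hne : ((j : ℂ) - i) ≠ 0 := by
        rw [sub_ne_zero]; exact_mod_cast Ne.symm hij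
      push_cast at h1 h2 ⊢
      apply mul_left_cancel₀ hne
      linear_combination (j + 1) * h1 + h2

open Polynomial in
/-- The three-term recurrence of the Laguerre polynomials. -/
lemma X_mul_laguerrePoly (α : ℂ) (j : ℕ) :
    X * laguerrePoly α j = -(((j : ℂ[X]) + 1) * laguerrePoly α (j + 1)) +
      C (2 * j + 1 + α) * laguerrePoly α j -
      (if j = 0 then 0 else C (j + α) * laguerrePoly α (j - 1)) := by
  rw [laguerrePoly_raise, ← laguerrePoly_lower, ← C_eq_natCast]
  simp only [C_add, C_mul, C_ofNat, C_1]
  ring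

/-! ### The action of the operators on the Hermite functions -/

lemma aeval_eval_radSq (m : ℕ) (p : Polynomial ℂ) (x : Space m) :
    MvPolynomial.eval (fun i ↦ ((x i : ℝ) : ℂ)) (Polynomial.aeval (radSq m) p) =
      p.eval ((‖x‖ ^ 2 : ℝ) : ℂ) := by
  have h : MvPolynomial.eval (fun i ↦ ((x i : ℝ) : ℂ)) (radSq m) = ((‖x‖ ^ 2 : ℝ) : ℂ) := by
    rw [EuclideanSpace.real_norm_sq_eq, radSq]
    push_cast
    simp [sq]
  rw [← h, Polynomial.aeval_def, Polynomial.hom_eval₂, Polynomial.eval]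
  congr 1
  ext c
  simp

lemma hermiteFn_eq_radialFn (m j k : ℕ) (H : MvPolynomial (Fin m) ℂ) :
    hermiteFn m j k H =
      ((2 : ℂ) ^ j * (j ! : ℂ)) • radialFn m H (laguerrePoly ((m : ℂ) / 2 + k - 1) j) := by
  ext x
  have h := eval_laguerrePoly ((m : ℝ) / 2 + k - 1) j (‖x‖ ^ 2)
  push_cast at h
  rw [hermiteFn_apply, smul_apply, radialFn_apply, polyGauss_apply, map_mul, aeval_eval_radSq]
  push_cast
  rw [h, smul_eq_mul]
  ring

lemma hOp_hermiteFn {m k : ℕ} {H : MvPolynomial (Fin m) ℂ} (hH : H ∈ sphericalHarmonics m k)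
    (j : ℕ) : hOp m (hermiteFn m j k H) = (2 * j + k + m / 2 : ℂ) • hermiteFn m j k H := by
  have h := laguerrePoly_ode ((m : ℂ) / 2 + k - 1) j
  rw [sub_add_cancel] at h
  rw [hermiteFn_eq_radialFn, map_smul, hOp_radialFn hH, h, smul_comm (2 * j + k + m / 2 : ℂ),
    ← map_smul (radialFn m H) (2 * j + k + m / 2 : ℂ)]
  congr 2
  rw [Polynomial.smul_eq_C_mul, ← Polynomial.C_eq_natCast]
  simp only [Polynomial.C_add, Polynomial.C_mul, Polynomial.C_ofNat]
  ring

lemma casimir_hermiteFn {m k : ℕ} {H : MvPolynomial (Fin m) ℂ} (hH : H ∈ sphericalHarmonics m k)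
    (j : ℕ) : casimir m (hermiteFn m j k H) =
      ((m : ℂ) / 2 + k - 1) ^ 2 • hermiteFn m j k H := by
  rw [hermiteFn_eq_radialFn, map_smul, casimir_radialFn hH, smul_comm]

/-- Multiplication by `|x|²` raises and lowers the index of the Hermite functions by one. -/
lemma normSqOp_hermiteFn (m j k : ℕ) (H : MvPolynomial (Fin m) ℂ) :
    normSqOp m (hermiteFn m j k H) = (-(1 / 2) : ℂ) • hermiteFn m (j + 1) k H +
      (2 * j + k + m / 2 : ℂ) • hermiteFn m j k H -
      (2 * j * (j + (m / 2 + k - 1)) : ℂ) • hermiteFn m (j - 1) k H := by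
  simp only [hermiteFn_eq_radialFn, map_smul, normSqOp_radialFn, X_mul_laguerrePoly]
  simp only [← map_smul, ← map_add, ← map_sub (radialFn m H), smul_smul]
  congr 1
  simp only [Polynomial.smul_eq_C_mul, ← Polynomial.C_eq_natCast]
  cases j with
  | zero =>
    simp only [if_true, Polynomial.C_add, Polynomial.C_mul, Polynomial.C_ofNat, Polynomial.C_sub,
      Polynomial.C_neg, Polynomial.C_1, Nat.cast_zero, Polynomial.C_0]
    simp
    have h2 : (Polynomial.C (2⁻¹ : ℂ)) * Polynomial.C 2 = (1 : Polynomial ℂ) := by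
      rw [← Polynomial.C_mul]; norm_num
    linear_combination (laguerrePoly ((m : ℂ) / 2 + k - 1) 1) * h2
  | succ j =>
    -- The normalisation `2^j j!` absorbs the index-dependent factor of the raising term, leaving
    -- `-1/2`, and puts a factor of twice the index into the lowering term.
    have hp : (Polynomial.C (-(1 / 2) * (2 ^ (j + 1 + 1) * ((j + 1 + 1)! : ℂ)))) =
        -(Polynomial.C ((2 : ℂ) ^ (j + 1) * ((j + 1)! : ℂ)) *
          (Polynomial.C ((j + 1 : ℕ) : ℂ) + 1)) := by
      rw [← Polynomial.C_1, ← Polynomial.C_add, ← Polynomial.C_mul, ← Polynomial.C_neg,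
        Nat.factorial_succ (j + 1)]
      congr 1; push_cast; ring
    have hq : (2 * ((j + 1 : ℕ) : ℂ) * (((j + 1 : ℕ) : ℂ) + (m / 2 + k - 1))) *
        (2 ^ j * (j ! : ℂ)) = (2 ^ (j + 1) * ((j + 1)! : ℂ)) *
          (((j + 1 : ℕ) : ℂ) + (m / 2 + k - 1)) := by
      rw [Nat.factorial_succ]; push_cast; ring
    have hr : (2 * ((j + 1 : ℕ) : ℂ) + k + m / 2) = 2 * ((j + 1 : ℕ) : ℂ) + 1 + (m / 2 + k - 1) := by
      ring
    rw [if_neg (Nat.succ_ne_zero j), Nat.add_sub_cancel, hp, hq, hr]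
    simp only [Polynomial.C_mul]
    ring

lemma laplaceOp_eq (m : ℕ) : laplaceOp m = normSqOp m - (2 : ℂ) • hOp m := by
  rw [hOp]; module

/-- Compared with `normSqOp_hermiteFn` only the middle coefficient changes sign. This is why the
Helmholtz relations amount to alternation of the eigenvalues in `j`. -/
lemma laplaceOp_hermiteFn {m k : ℕ} {H : MvPolynomial (Fin m) ℂ}
    (hH : H ∈ sphericalHarmonics m k) (j : ℕ) :
    laplaceOp m (hermiteFn m j k H) = (-(1 / 2) : ℂ) • hermiteFn m (j + 1) k H -
      (2 * j + k + m / 2 : ℂ) • hermiteFn m j k H -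
      (2 * j * (j + (m / 2 + k - 1)) : ℂ) • hermiteFn m (j - 1) k H := by
  rw [laplaceOp_eq, sub_apply, smul_apply, hOp_hermiteFn hH, normSqOp_hermiteFn]
  module

/-- In the product `s ≤ j - 1`, so every factor is at least `1 + α > 0`. -/
lemma laguerreCoeff_zero_ne_zero {α : ℝ} (hα : -1 < α) (j : ℕ) :
    laguerreCoeff (α : ℂ) j 0 ≠ 0 := by
  simp only [laguerreCoeff, Nat.zero_le, if_true, pow_zero, one_mul, Nat.sub_zero,
    Nat.factorial_zero, Nat.cast_one, div_one]
  refine div_ne_zero (Finset.prod_ne_zero_iff.2 fun s hs ↦ ?_)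
    (by exact_mod_cast j.factorial_ne_zero)
  have h : s + 1 ≤ j := Finset.mem_range.1 hs
  have h' : (s : ℝ) + 1 ≤ j := by exact_mod_cast h
  have h2 : (j : ℝ) + α - s ≠ 0 := by linarith
  exact_mod_cast h2

lemma hermiteFn_ne_zero {m : ℕ} (hm : 1 ≤ m) (j k : ℕ) {H : MvPolynomial (Fin m) ℂ} (hH : H ≠ 0) :
    hermiteFn m j k H ≠ 0 := by
  have hm' : (1 : ℝ) ≤ m := by exact_mod_cast hm
  have hα : -1 < (m : ℝ) / 2 + k - 1 := by
    have : (0 : ℝ) ≤ k := Nat.cast_nonneg k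
    linarith
  rw [hermiteFn_eq_radialFn]
  refine smul_ne_zero (mul_ne_zero (by simp) (by exact_mod_cast j.factorial_ne_zero)) ?_
  rw [radialFn_apply, ← map_zero (polyGauss m)]
  -- The polynomial ring is a domain, so it is enough that the radial factor is nonzero. Its value
  -- at the origin is the constant coefficient of the Laguerre polynomial.
  refine fun h ↦ mul_ne_zero (fun h0 ↦ ?_) hH (polyGauss_injective m h)
  have h1 := congrArg (MvPolynomial.eval (fun i ↦ (((0 : Space m) i : ℝ) : ℂ))) h0
  rw [aeval_eval_radSq, map_zero, norm_zero] at h1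
  have h2 := laguerreCoeff_zero_ne_zero hα j
  rw [← coeff_laguerrePoly, Polynomial.coeff_zero_eq_eval_zero] at h2
  push_cast at h1 h2
  norm_num at h1
  exact h2 h1

end HelmholtzFourier
end

noncomputable section
namespace HelmholtzFourier

/-! ### Polynomials are sums of `|x|^{2j}` times harmonic polynomials -/

lemma isHomogeneous_radSq (m : ℕ) : (radSq m).IsHomogeneous 2 :=
  MvPolynomial.IsHomogeneous.sum _ _ _ fun i _ ↦
    (MvPolynomial.isHomogeneous_X ℂ i).mul (MvPolynomial.isHomogeneous_X ℂ i)

/-- The span of the products `|x|^{2j} H` of degree `d` with `H` a harmonic polynomial. -/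
def radialHarmonicSpan (m d : ℕ) : Submodule ℂ (MvPolynomial (Fin m) ℂ) :=
  Submodule.span ℂ {P | ∃ j k : ℕ, 2 * j + k = d ∧ ∃ H ∈ sphericalHarmonics m k,
    P = radSq m ^ j * H}

lemma isHomogeneous_of_mem_radialHarmonicSpan {m d : ℕ} {P : MvPolynomial (Fin m) ℂ}
    (hP : P ∈ radialHarmonicSpan m d) : P.IsHomogeneous d := by
  rw [← MvPolynomial.mem_homogeneousSubmodule]
  refine (Submodule.span_le.2 ?_) hP
  rintro _ ⟨j, k, rfl, H, hH, rfl⟩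
  exact ((isHomogeneous_radSq m).pow j).mul ((mem_sphericalHarmonics m k H).1 hH).1

lemma sum_pderiv_pderiv_radSq_pow {m k : ℕ} {H : MvPolynomial (Fin m) ℂ}
    (hH : H ∈ sphericalHarmonics m k) (j : ℕ) :
    ∑ i, MvPolynomial.pderiv i (MvPolynomial.pderiv i (radSq m ^ (j + 1) * H)) =
      (4 * (j + 1) * j + (2 * m + 4 * k) * (j + 1) : ℂ) • (radSq m ^ j * H) := by
  have h := sum_pderiv_pderiv_radial hH (Polynomial.X ^ (j + 1))
  rw [map_pow, Polynomial.aeval_X] at h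
  rw [h, ← smul_mul_assoc]
  congr 1
  rw [MvPolynomial.smul_eq_C_mul]
  cases j with
  | zero =>
    simp only [Polynomial.derivative_X_pow, map_add, map_mul, map_ofNat,
      map_natCast,
      map_one, Nat.cast_zero, Nat.cast_one, zero_add,
      Nat.sub_self, pow_zero, Polynomial.derivative_one, mul_zero, mul_one]
  | succ j =>
    simp only [Polynomial.derivative_X_pow, map_add, map_mul, Polynomial.aeval_X, map_ofNat,
      map_natCast, map_pow, Polynomial.derivative_mul,
      map_one, Nat.add_sub_cancel, map_zero, Nat.cast_add, Nat.cast_one,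
      Polynomial.derivative_natCast, Polynomial.derivative_one]
    ring

/-- The Laplacian sends `|x|^{2j+2} H` to a positive multiple of `|x|^{2j} H`, so it can be inverted
generator by generator. -/
lemma exists_laplacian_eq {m : ℕ} (hm : 1 ≤ m) {d : ℕ} {q : MvPolynomial (Fin m) ℂ}
    (hq : q ∈ radialHarmonicSpan m d) : ∃ q' ∈ radialHarmonicSpan m (d + 2),
      ∑ i, MvPolynomial.pderiv i (MvPolynomial.pderiv i q') = q := by
  induction hq using Submodule.span_induction with
  | mem q hq =>
    obtain ⟨j, k, hd, H, hH, rfl⟩ := hq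
    have hc : (4 * (j + 1) * j + (2 * m + 4 * k) * (j + 1) : ℂ) ≠ 0 := by
      have : (4 * (j + 1) * j + (2 * m + 4 * k) * (j + 1) : ℕ) ≠ 0 := by positivity
      exact_mod_cast this
    refine ⟨(4 * (j + 1) * j + (2 * m + 4 * k) * (j + 1) : ℂ)⁻¹ • (radSq m ^ (j + 1) * H),
      Submodule.smul_mem _ _ (Submodule.subset_span ⟨j + 1, k, by omega, H, hH, rfl⟩), ?_⟩
    simp only [Derivation.map_smul, ← Finset.smul_sum]
    rw [sum_pderiv_pderiv_radSq_pow hH, inv_smul_smul₀ hc]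
  | zero => exact ⟨0, Submodule.zero_mem _, by simp⟩
  | add p q _ _ hp hq =>
    obtain ⟨p', hp', h1⟩ := hp
    obtain ⟨q', hq', h2⟩ := hq
    exact ⟨p' + q', Submodule.add_mem _ hp' hq', by simp [Finset.sum_add_distrib, h1, h2]⟩
  | smul c p _ hp =>
    obtain ⟨p', hp', h1⟩ := hp
    exact ⟨c • p', Submodule.smul_mem _ _ hp', by
      simp only [Derivation.map_smul, ← Finset.smul_sum, h1]⟩

lemma pderiv_pderiv_eq_zero {m d : ℕ} (hd : d < 2) {P : MvPolynomial (Fin m) ℂ}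
    (hP : P.IsHomogeneous d) (i : Fin m) : MvPolynomial.pderiv i (MvPolynomial.pderiv i P) = 0 := by
  have h : (MvPolynomial.pderiv i P).IsHomogeneous 0 := by
    have := hP.pderiv (i := i)
    rwa [show d - 1 = 0 by omega] at this
  rw [MvPolynomial.totalDegree_eq_zero_iff_eq_C.1 (Nat.le_zero.1 h.totalDegree_le),
    MvPolynomial.pderiv_C]

/-- Every homogeneous polynomial of degree `d` is a sum of products `|x|^{2j} H_k`. -/
lemma mem_radialHarmonicSpan {m : ℕ} (hm : 1 ≤ m) (d : ℕ) :
    ∀ P : MvPolynomial (Fin m) ℂ, P.IsHomogeneous d → P ∈ radialHarmonicSpan m d := by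
  induction d using Nat.strong_induction_on with
  | _ d ih =>
    intro P hP
    have harm : ∀ Q : MvPolynomial (Fin m) ℂ, Q.IsHomogeneous d →
        ∑ i, MvPolynomial.pderiv i (MvPolynomial.pderiv i Q) = 0 → Q ∈ radialHarmonicSpan m d :=
      fun Q hQ h0 ↦ Submodule.subset_span
        ⟨0, d, by omega, Q, (mem_sphericalHarmonics m d Q).2 ⟨hQ, h0⟩, by simp⟩
    by_cases hd : d < 2
    · exact harm P hP (Finset.sum_eq_zero fun i _ ↦ pderiv_pderiv_eq_zero hd hP i)
    · obtain ⟨e, rfl⟩ : ∃ e, d = e + 2 := ⟨d - 2, by omega⟩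
      have h1 : (∑ i, MvPolynomial.pderiv i (MvPolynomial.pderiv i P)).IsHomogeneous e :=
        MvPolynomial.IsHomogeneous.sum _ _ _ fun i _ ↦ by
          simpa using (hP.pderiv (i := i)).pderiv (i := i)
      obtain ⟨q, hq, hq'⟩ := exists_laplacian_eq hm (ih e (by omega) _ h1)
      -- By the induction hypothesis `ΔP` lies in the span of degree `e`, hence has a preimage `q`
      -- in the span of degree `e + 2`. The difference `P - q` is harmonic.
      have h2 := harm (P - q) (hP.sub (isHomogeneous_of_mem_radialHarmonicSpan hq))
        (by simp [Finset.sum_sub_distrib, hq'])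
      simpa using Submodule.add_mem _ h2 hq

/-! ### The span of the Hermite functions -/

/-- The Laguerre polynomials as a sequence of polynomials of increasing degree. -/
def laguerreSequence (α : ℂ) : Polynomial.Sequence ℂ where
  elems' := laguerrePoly α
  degree_eq' j := by
    have hc : laguerreCoeff α j j ≠ 0 := by
      rw [laguerreCoeff_self]
      exact div_ne_zero (pow_ne_zero _ (by norm_num)) (by exact_mod_cast j.factorial_ne_zero)
    refine le_antisymm ?_ (Polynomial.le_degree_of_ne_zero (by rwa [coeff_laguerrePoly]))
    refine (Polynomial.degree_le_iff_coeff_zero _ _).2 fun i hi ↦ ?_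
    have : j < i := by exact_mod_cast hi
    rw [coeff_laguerrePoly, laguerreCoeff, if_neg (by omega)]

lemma span_laguerrePoly (α : ℂ) : Submodule.span ℂ (Set.range (laguerrePoly α)) = ⊤ :=
  (laguerreSequence α).span fun i ↦ by
    rw [isUnit_iff_ne_zero, Polynomial.leadingCoeff_ne_zero]
    exact (laguerreSequence α).ne_zero i

lemma hermiteFn_mem_hermiteSpan {m k : ℕ} {H : MvPolynomial (Fin m) ℂ}
    (hH : H ∈ sphericalHarmonics m k) (j : ℕ) : hermiteFn m j k H ∈ hermiteSpan m :=
  Submodule.subset_span ⟨j, k, H, hH, rfl⟩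

lemma radialFn_mem_hermiteSpan {m k : ℕ} {H : MvPolynomial (Fin m) ℂ}
    (hH : H ∈ sphericalHarmonics m k) (p : Polynomial ℂ) : radialFn m H p ∈ hermiteSpan m := by
  have hp : p ∈ Submodule.span ℂ (Set.range (laguerrePoly ((m : ℂ) / 2 + k - 1))) := by
    rw [span_laguerrePoly]; trivial
  rw [← Submodule.mem_comap]
  refine (Submodule.span_le.2 ?_) hp
  rintro _ ⟨j, rfl⟩
  have hc : ((2 : ℂ) ^ j * (j ! : ℂ)) ≠ 0 :=
    mul_ne_zero (by simp) (by exact_mod_cast j.factorial_ne_zero)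
  have h := Submodule.smul_mem _ ((2 : ℂ) ^ j * (j ! : ℂ))⁻¹ (hermiteFn_mem_hermiteSpan hH j)
  rw [hermiteFn_eq_radialFn, inv_smul_smul₀ hc] at h
  exact h

/-- The span of the Hermite functions consists of the products of polynomials and the Gaussian. -/
lemma polyGauss_mem_hermiteSpan {m : ℕ} (hm : 1 ≤ m) (P : MvPolynomial (Fin m) ℂ) :
    polyGauss m P ∈ hermiteSpan m := by
  rw [← MvPolynomial.sum_homogeneousComponent P, map_sum]
  refine Submodule.sum_mem _ fun d _ ↦ ?_
  have h := mem_radialHarmonicSpan hm d _ (MvPolynomial.homogeneousComponent_isHomogeneous d P)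
  rw [← Submodule.mem_comap]
  refine (Submodule.span_le.2 ?_) h
  rintro _ ⟨j, k, -, H, hH, rfl⟩
  have h2 := radialFn_mem_hermiteSpan hH (Polynomial.X ^ j)
  rwa [radialFn_apply, map_pow, Polynomial.aeval_X] at h2

end HelmholtzFourier
end

noncomputable section
namespace HelmholtzFourier

open MeasureTheory

/-! ### Square integrals -/

/-- The inclusion of the rapidly decreasing functions into the square integrable functions. -/
def toL2 (m : ℕ) : Sch m →L[ℂ] Lp (α := Space m) ℂ 2 :=
  SchwartzMap.toLpCLM ℂ ℂ 2 volume

lemma inner_toL2 (m : ℕ) (f g : Sch m) :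
    inner ℂ (toL2 m f) (toL2 m g) = ∫ x, inner ℂ (f x) (g x) :=
  SchwartzMap.inner_toL2_toL2_eq f g

lemma inner_coordOp (m : ℕ) (i : Fin m) (f g : Sch m) :
    inner ℂ (toL2 m (coordOp m i f)) (toL2 m g) = inner ℂ (toL2 m f) (toL2 m (coordOp m i g)) := by
  rw [inner_toL2, inner_toL2]
  congr 1; ext x
  simp only [coordOp_apply, RCLike.inner_apply, map_mul, Complex.conj_ofReal]
  ring

lemma inner_partialOp (m : ℕ) (i : Fin m) (f g : Sch m) :
    inner ℂ (toL2 m (partialOp m i f)) (toL2 m g) =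
      -inner ℂ (toL2 m f) (toL2 m (partialOp m i g)) := by
  have h := SchwartzMap.integral_bilinear_lineDerivOp_right_eq_neg_left (μ := volume) f g
    ((ContinuousLinearMap.mul ℝ ℂ).comp (Complex.conjCLE : ℂ →L[ℝ] ℂ))
    (EuclideanSpace.single i (1 : ℝ) : Space m)
  rw [inner_toL2, inner_toL2, eq_neg_iff_add_eq_zero, add_comm, ← eq_neg_iff_add_eq_zero]
  simp only [RCLike.inner_apply']
  exact h

/-- `A` has the formal adjoint `B`. -/
def IsFormalAdjoint {m : ℕ} (A B : Sch m →L[ℂ] Sch m) : Prop :=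
  ∀ f g : Sch m, inner ℂ (toL2 m (A f)) (toL2 m g) = inner ℂ (toL2 m f) (toL2 m (B g))

namespace IsFormalAdjoint

variable {m : ℕ} {A B A' B' : Sch m →L[ℂ] Sch m}

lemma add (h : IsFormalAdjoint A B) (h' : IsFormalAdjoint A' B') :
    IsFormalAdjoint (A + A') (B + B') := fun f g ↦ by
  simp only [add_apply, map_add, inner_add_left, inner_add_right, h f g, h' f g]

lemma neg (h : IsFormalAdjoint A B) : IsFormalAdjoint (-A) (-B) := fun f g ↦ by
  simp only [neg_apply, map_neg, inner_neg_left, inner_neg_right, h f g]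

lemma sub (h : IsFormalAdjoint A B) (h' : IsFormalAdjoint A' B') :
    IsFormalAdjoint (A - A') (B - B') := by
  simpa only [sub_eq_add_neg] using h.add h'.neg

lemma smul (h : IsFormalAdjoint A B) {c : ℂ} (hc : c.im = 0) :
    IsFormalAdjoint (c • A) (c • B) := fun f g ↦ by
  simp only [smul_apply, map_smul, inner_smul_left, inner_smul_right, h f g,
    Complex.conj_eq_iff_im.2 hc]

lemma mul (h : IsFormalAdjoint A B) (h' : IsFormalAdjoint A' B') :
    IsFormalAdjoint (A * A') (B' * B) := fun f g ↦ by
  rw [mulOp_apply, mulOp_apply, h, h']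

lemma sum {ι : Type*} {s : Finset ι} {A B : ι → Sch m →L[ℂ] Sch m}
    (h : ∀ i ∈ s, IsFormalAdjoint (A i) (B i)) : IsFormalAdjoint (∑ i ∈ s, A i) (∑ i ∈ s, B i) :=
  fun f g ↦ by
    simp only [sum_apply, map_sum, sum_inner, inner_sum]
    exact Finset.sum_congr rfl fun i hi ↦ h i hi f g

lemma one : IsFormalAdjoint (1 : Sch m →L[ℂ] Sch m) 1 := fun _ _ ↦ rfl

lemma coordOp (m : ℕ) (i : Fin m) : IsFormalAdjoint (coordOp m i) (coordOp m i) :=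
  inner_coordOp m i

lemma partialOp (m : ℕ) (i : Fin m) : IsFormalAdjoint (partialOp m i) (-partialOp m i) :=
  fun f g ↦ by rw [inner_partialOp, neg_apply, map_neg, inner_neg_right]

lemma normSqOp (m : ℕ) : IsFormalAdjoint (normSqOp m) (normSqOp m) := by
  rw [normSqOp_eq_sum]
  exact sum fun i _ ↦ (coordOp m i).mul (coordOp m i)

lemma laplaceOp (m : ℕ) : IsFormalAdjoint (laplaceOp m) (laplaceOp m) := by
  rw [laplaceOp_eq_sum]
  refine sum fun i _ ↦ ?_
  simpa only [neg_mul_neg] using (partialOp m i).mul (partialOp m i)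

/-- The adjoint of `xᵢ∂ᵢ` is `-∂ᵢxᵢ = -xᵢ∂ᵢ - 1`; the `m` constants add up. -/
lemma eulerOp (m : ℕ) : IsFormalAdjoint (eulerOp m) (-eulerOp m - (m : ℂ) • 1) := by
  have h : -HelmholtzFourier.eulerOp m - (m : ℂ) • (1 : Sch m →L[ℂ] Sch m) =
      ∑ i, -HelmholtzFourier.partialOp m i * HelmholtzFourier.coordOp m i := by
    have h1 : ∀ i : Fin m, -HelmholtzFourier.partialOp m i * HelmholtzFourier.coordOp m i =
        -(HelmholtzFourier.coordOp m i * HelmholtzFourier.partialOp m i) - 1 := fun i ↦ by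
      rw [neg_mul, partialOp_mul_coordOp, if_pos rfl]; abel
    simp only [h1, Finset.sum_sub_distrib, Finset.sum_neg_distrib, HelmholtzFourier.eulerOp]
    rw [Finset.sum_const, Finset.card_univ, Fintype.card_fin, ← Nat.cast_smul_eq_nsmul ℂ]
  rw [h]
  exact sum fun i _ ↦ (coordOp m i).mul (partialOp m i)

lemma hOp (m : ℕ) : IsFormalAdjoint (hOp m) (hOp m) :=
  (((laplaceOp m).smul (by simp)).neg).add ((normSqOp m).smul (by simp))

lemma eOp (m : ℕ) : IsFormalAdjoint (eOp m) (-fOp m) := by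
  have h : -HelmholtzFourier.fOp m = -((1 / 4 : ℂ) • HelmholtzFourier.laplaceOp m)
      - (1 / 4 : ℂ) • HelmholtzFourier.normSqOp m +
      (1 / 2 : ℂ) • (-HelmholtzFourier.eulerOp m - (m : ℂ) • (1 : Sch m →L[ℂ] Sch m))
      + ((m : ℂ) / 4) • (1 : Sch m →L[ℂ] Sch m) := by
    rw [HelmholtzFourier.fOp]; module
  rw [h]
  exact (((((laplaceOp m).smul (by simp)).neg).sub ((normSqOp m).smul (by simp))).add
    ((eulerOp m).smul (by simp))).add (one.smul (by simp))

lemma fOp (m : ℕ) : IsFormalAdjoint (fOp m) (-HelmholtzFourier.eOp m) := by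
  have h : -HelmholtzFourier.eOp m = (1 / 4 : ℂ) • HelmholtzFourier.laplaceOp m
      + (1 / 4 : ℂ) • HelmholtzFourier.normSqOp m +
      (1 / 2 : ℂ) • (-HelmholtzFourier.eulerOp m - (m : ℂ) • (1 : Sch m →L[ℂ] Sch m))
      + ((m : ℂ) / 4) • (1 : Sch m →L[ℂ] Sch m) := by
    rw [HelmholtzFourier.eOp]; module
  rw [h]
  exact ((((laplaceOp m).smul (by simp)).add ((normSqOp m).smul (by simp))).add
    ((eulerOp m).smul (by simp))).add (one.smul (by simp))

/-- Since `e* = -f` and `f* = -e`, the products `ef` and `fe` are symmetric. Symmetry makes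
eigenfunctions of Ω with different real eigenvalues orthogonal. -/
lemma casimir (m : ℕ) : IsFormalAdjoint (casimir m) (casimir m) := by
  rw [HelmholtzFourier.casimir, pow_two]
  have h1 : IsFormalAdjoint (HelmholtzFourier.eOp m * HelmholtzFourier.fOp m)
      (HelmholtzFourier.eOp m * HelmholtzFourier.fOp m) := by
    simpa only [neg_mul_neg] using (eOp m).mul (fOp m)
  have h2 : IsFormalAdjoint (HelmholtzFourier.fOp m * HelmholtzFourier.eOp m)
      (HelmholtzFourier.fOp m * HelmholtzFourier.eOp m) := by
    simpa only [neg_mul_neg] using (fOp m).mul (eOp m)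
  exact ((one.add ((hOp m).mul (hOp m))).add (h1.smul (by simp))).add (h2.smul (by simp))

end IsFormalAdjoint

/-! ### Commutation relations with `h` -/

lemma coordOp_mul_partialOp (m : ℕ) (i j : Fin m) :
    coordOp m j * partialOp m i = partialOp m i * coordOp m j - if i = j then 1 else 0 := by
  rw [partialOp_mul_coordOp]; abel

lemma normSqOp_mul_coordOp (m : ℕ) (i : Fin m) :
    normSqOp m * coordOp m i = coordOp m i * normSqOp m := by
  rw [normSqOp_eq_sum, Finset.sum_mul, Finset.mul_sum]
  refine Finset.sum_congr rfl fun j _ ↦ ?_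
  rw [mul_assoc, coordOp_comm m j i, ← mul_assoc, coordOp_comm m j i, mul_assoc]

lemma laplaceOp_mul_partialOp (m : ℕ) (i : Fin m) :
    laplaceOp m * partialOp m i = partialOp m i * laplaceOp m := by
  rw [laplaceOp_eq_sum, Finset.sum_mul, Finset.mul_sum]
  refine Finset.sum_congr rfl fun j _ ↦ ?_
  rw [mul_assoc, partialOp_comm m j i, ← mul_assoc, partialOp_comm m j i, mul_assoc]

lemma laplaceOp_mul_coordOp (m : ℕ) (i : Fin m) :
    laplaceOp m * coordOp m i = coordOp m i * laplaceOp m + (2 : ℂ) • partialOp m i := by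
  have h : ∀ j, partialOp m j * partialOp m j * coordOp m i =
      coordOp m i * (partialOp m j * partialOp m j) +
        if j = i then (2 : ℂ) • partialOp m i else 0 := by
    intro j
    rw [mul_assoc, partialOp_mul_coordOp, mul_add, ← mul_assoc, partialOp_mul_coordOp]
    split_ifs with hji
    · subst hji; rw [two_smul, add_mul]; simp only [mul_one, one_mul, mul_assoc]; abel
    · simp [mul_assoc]
  rw [laplaceOp_eq_sum, Finset.sum_mul, Finset.mul_sum]
  simp only [h, Finset.sum_add_distrib, Finset.sum_ite_eq', Finset.mem_univ, if_true]

lemma normSqOp_mul_partialOp (m : ℕ) (i : Fin m) :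
    normSqOp m * partialOp m i = partialOp m i * normSqOp m - (2 : ℂ) • coordOp m i := by
  have h : ∀ j, coordOp m j * coordOp m j * partialOp m i =
      partialOp m i * (coordOp m j * coordOp m j) -
        if i = j then (2 : ℂ) • coordOp m i else 0 := by
    intro j
    rw [mul_assoc, coordOp_mul_partialOp, mul_sub, ← mul_assoc, coordOp_mul_partialOp]
    split_ifs with hji
    · subst hji; rw [two_smul, sub_mul]; simp only [mul_one, one_mul, mul_assoc]; abel
    · simp [mul_assoc]
  rw [normSqOp_eq_sum, Finset.sum_mul, Finset.mul_sum]
  simp only [h, Finset.sum_sub_distrib, Finset.sum_ite_eq, Finset.mem_univ, if_true]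

/-- Together with `[h, ∂ᵢ] = -xᵢ` this makes `xᵢ + ∂ᵢ` and `xᵢ - ∂ᵢ` eigenvectors of `ad h` with
eigenvalues `-1` and `1`: the annihilation and creation operators. -/
lemma hOp_mul_coordOp (m : ℕ) (i : Fin m) :
    hOp m * coordOp m i = coordOp m i * hOp m - partialOp m i := by
  rw [hOp, add_mul, mul_add, neg_mul, mul_neg, smul_mul_assoc, smul_mul_assoc, mul_smul_comm,
    mul_smul_comm, laplaceOp_mul_coordOp, normSqOp_mul_coordOp]
  module

lemma hOp_mul_partialOp (m : ℕ) (i : Fin m) :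
    hOp m * partialOp m i = partialOp m i * hOp m - coordOp m i := by
  rw [hOp, add_mul, mul_add, neg_mul, mul_neg, smul_mul_assoc, smul_mul_assoc, mul_smul_comm,
    mul_smul_comm, laplaceOp_mul_partialOp, normSqOp_mul_partialOp]
  module

/-! ### Bounds by powers of `h` -/

/-- Integration by parts in `2h = ∑ (xᵢ² - ∂ᵢ²)`. -/
lemma re_inner_hOp (m : ℕ) (f : Sch m) :
    2 * (inner ℂ (toL2 m f) (toL2 m (hOp m f))).re =
      ∑ i, (‖toL2 m (coordOp m i f)‖ ^ 2 + ‖toL2 m (partialOp m i f)‖ ^ 2) := by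
  have h1 : ∀ i, inner ℂ (toL2 m f) (toL2 m (coordOp m i (coordOp m i f))) =
      ((‖toL2 m (coordOp m i f)‖ ^ 2 : ℝ) : ℂ) := fun i ↦ by
    rw [← inner_coordOp, inner_self_eq_norm_sq_to_K]; push_cast; rfl
  have h2 : ∀ i, inner ℂ (toL2 m f) (toL2 m (partialOp m i (partialOp m i f))) =
      -((‖toL2 m (partialOp m i f)‖ ^ 2 : ℝ) : ℂ) := fun i ↦ by
    rw [← neg_inj, ← inner_partialOp, inner_self_eq_norm_sq_to_K, neg_neg]; push_cast; rfl
  have h3 : (2 : ℂ) * inner ℂ (toL2 m f) (toL2 m (hOp m f)) =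
      ((∑ i, (‖toL2 m (coordOp m i f)‖ ^ 2 + ‖toL2 m (partialOp m i f)‖ ^ 2) : ℝ) : ℂ) := by
    have h4 : (2 : ℂ) • hOp m f = ∑ i, coordOp m i (coordOp m i f) -
        ∑ i, partialOp m i (partialOp m i f) := by
      have : (2 : ℂ) • hOp m = normSqOp m - laplaceOp m := by rw [hOp]; module
      rw [← smul_apply, this, sub_apply, normSqOp_eq_sum, laplaceOp_eq_sum, sum_apply, sum_apply]
      rfl
    rw [← inner_smul_right, ← map_smul, h4, map_sub, map_sum, map_sum, inner_sub_right, inner_sum,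
      inner_sum]
    simp only [h1, h2]
    push_cast
    rw [Finset.sum_add_distrib, Finset.sum_neg_distrib, sub_neg_eq_add]
  have h5 := congrArg Complex.re h3
  rw [Complex.ofReal_re] at h5
  rw [← h5]
  simp

lemma re_inner_coordOp_partialOp (m : ℕ) (i : Fin m) (f : Sch m) :
    2 * (inner ℂ (toL2 m (coordOp m i f)) (toL2 m (partialOp m i f))).re = -‖toL2 m f‖ ^ 2 := by
  have h1 : inner ℂ (toL2 m (coordOp m i f)) (toL2 m (partialOp m i f)) +
      inner ℂ (toL2 m (partialOp m i f)) (toL2 m (coordOp m i f)) =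
      -((‖toL2 m f‖ ^ 2 : ℝ) : ℂ) := by
    have h2 := congrArg (fun L ↦ L f) (partialOp_mul_coordOp m i i)
    simp only [if_true, add_apply, mulOp_apply, one_apply_eq_self] at h2
    rw [inner_coordOp, inner_partialOp, h2, map_add, inner_add_right, inner_self_eq_norm_sq_to_K]
    push_cast
    simp
  have h3 := congrArg Complex.re h1
  rw [Complex.add_re, ← inner_conj_symm (toL2 m (partialOp m i f)), Complex.conj_re,
    Complex.neg_re, Complex.ofReal_re] at h3
  linarith

/-- The uncertainty inequality `h ≥ m/2`: expand `‖(xᵢ + ∂ᵢ) f‖² ≥ 0`, whose cross term is `-‖f‖²`,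
and sum over `i`. -/
lemma norm_sq_le_re_inner_hOp (m : ℕ) (f : Sch m) :
    m * ‖toL2 m f‖ ^ 2 ≤ 2 * (inner ℂ (toL2 m f) (toL2 m (hOp m f))).re := by
  rw [re_inner_hOp]
  have h : (m : ℝ) * ‖toL2 m f‖ ^ 2 = ∑ _i : Fin m, ‖toL2 m f‖ ^ 2 := by simp
  rw [h]
  refine Finset.sum_le_sum fun i _ ↦ ?_
  have h1 := norm_add_sq (𝕜 := ℂ) (toL2 m (coordOp m i f)) (toL2 m (partialOp m i f))
  have h2 := re_inner_coordOp_partialOp m i f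
  simp only [RCLike.re_to_complex] at h1
  nlinarith [sq_nonneg ‖toL2 m (coordOp m i f) + toL2 m (partialOp m i f)‖]

lemma re_inner_hOp_le (m : ℕ) (f : Sch m) :
    (inner ℂ (toL2 m f) (toL2 m (hOp m f))).re ≤ ‖toL2 m f‖ * ‖toL2 m (hOp m f)‖ :=
  (Complex.re_le_norm _).trans (norm_inner_le_norm _ _)

lemma norm_le_norm_hOp {m : ℕ} (hm : 1 ≤ m) (f : Sch m) :
    ‖toL2 m f‖ ≤ 2 * ‖toL2 m (hOp m f)‖ := by
  have h1 := norm_sq_le_re_inner_hOp m f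
  have h2 := re_inner_hOp_le m f
  have hm' : (1 : ℝ) ≤ m := by exact_mod_cast hm
  have h0 := norm_nonneg (toL2 m f)
  rcases h0.eq_or_lt with h | h
  · rw [← h]; positivity
  · have h3 : ‖toL2 m f‖ * ‖toL2 m f‖ ≤ ‖toL2 m f‖ * (2 * ‖toL2 m (hOp m f)‖) := by
      nlinarith [mul_le_mul_of_nonneg_right hm' (sq_nonneg ‖toL2 m f‖)]
    exact le_of_mul_le_mul_left h3 h

lemma norm_pow_hOp_mono {m : ℕ} (hm : 1 ≤ m) (f : Sch m) {a b : ℕ} (hab : a ≤ b) :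
    ‖toL2 m ((hOp m ^ a) f)‖ ≤ 2 ^ (b - a) * ‖toL2 m ((hOp m ^ b) f)‖ := by
  obtain ⟨d, rfl⟩ := Nat.exists_eq_add_of_le hab
  rw [Nat.add_sub_cancel_left]
  induction d with
  | zero => simp
  | succ d ih =>
    refine (ih (by omega)).trans ?_
    have h := norm_le_norm_hOp hm ((hOp m ^ (a + d)) f)
    rw [← mulOp_apply, ← pow_succ'] at h
    rw [pow_succ, mul_assoc]
    gcongr
    exact h

/-- One summand of `re_inner_hOp` is at most `2‖f‖‖hf‖ ≤ (‖f‖ + ‖hf‖)²`. -/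
lemma norm_coordOp_le (m : ℕ) (i : Fin m) (f : Sch m) :
    ‖toL2 m (coordOp m i f)‖ ≤ ‖toL2 m f‖ + ‖toL2 m (hOp m f)‖ := by
  have h1 := re_inner_hOp m f
  have h2 := re_inner_hOp_le m f
  have h3 := Finset.single_le_sum (f := fun i ↦ ‖toL2 m (coordOp m i f)‖ ^ 2 +
    ‖toL2 m (partialOp m i f)‖ ^ 2) (fun i _ ↦ by positivity) (Finset.mem_univ i)
  refine le_of_sq_le_sq ?_ (by positivity)
  nlinarith [sq_nonneg ‖toL2 m (partialOp m i f)‖, sq_nonneg ‖toL2 m f‖,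
    sq_nonneg ‖toL2 m (hOp m f)‖]

lemma norm_partialOp_le (m : ℕ) (i : Fin m) (f : Sch m) :
    ‖toL2 m (partialOp m i f)‖ ≤ ‖toL2 m f‖ + ‖toL2 m (hOp m f)‖ := by
  have h1 := re_inner_hOp m f
  have h2 := re_inner_hOp_le m f
  have h3 := Finset.single_le_sum (f := fun i ↦ ‖toL2 m (coordOp m i f)‖ ^ 2 +
    ‖toL2 m (partialOp m i f)‖ ^ 2) (fun i _ ↦ by positivity) (Finset.mem_univ i)
  refine le_of_sq_le_sq ?_ (by positivity)
  nlinarith [sq_nonneg ‖toL2 m (coordOp m i f)‖, sq_nonneg ‖toL2 m f‖,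
    sq_nonneg ‖toL2 m (hOp m f)‖]

/-- `D` is bounded in `L²` by a power of `h`. -/
def IsHBounded {m : ℕ} (D : Sch m →L[ℂ] Sch m) : Prop :=
  ∃ (C : ℝ) (N : ℕ), 0 ≤ C ∧ ∀ f : Sch m, ‖toL2 m (D f)‖ ≤ C * ‖toL2 m ((hOp m ^ N) f)‖

lemma IsHBounded.add {m : ℕ} (hm : 1 ≤ m) {D E : Sch m →L[ℂ] Sch m} (hD : IsHBounded D)
    (hE : IsHBounded E) : IsHBounded (D + E) := by
  obtain ⟨C, N, hC, h⟩ := hD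
  obtain ⟨C', N', hC', h'⟩ := hE
  refine ⟨C * 2 ^ (max N N' - N) + C' * 2 ^ (max N N' - N'), max N N', by positivity, fun f ↦ ?_⟩
  rw [add_apply, map_add, add_mul, mul_assoc, mul_assoc]
  refine (norm_add_le _ _).trans (add_le_add ((h f).trans ?_) ((h' f).trans ?_))
  · gcongr; exact norm_pow_hOp_mono hm f (le_max_left _ _)
  · gcongr; exact norm_pow_hOp_mono hm f (le_max_right _ _)

lemma IsHBounded.smul {m : ℕ} {D : Sch m →L[ℂ] Sch m} (hD : IsHBounded D) (c : ℂ) :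
    IsHBounded (c • D) := by
  obtain ⟨C, N, hC, h⟩ := hD
  refine ⟨‖c‖ * C, N, by positivity, fun f ↦ ?_⟩
  rw [smul_apply, map_smul, norm_smul, mul_assoc]
  gcongr
  exact h f

lemma IsHBounded.mul_hOp {m : ℕ} {D : Sch m →L[ℂ] Sch m} (hD : IsHBounded D) :
    IsHBounded (D * hOp m) := by
  obtain ⟨C, N, hC, h⟩ := hD
  refine ⟨C, N + 1, hC, fun f ↦ ?_⟩
  rw [pow_succ, mulOp_apply, mulOp_apply]
  exact h _

/-- The algebra generated by the operators `xᵢ ± ∂ᵢ`. -/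
def weylAlgebra (m : ℕ) : Subalgebra ℂ (Sch m →L[ℂ] Sch m) :=
  Algebra.adjoin ℂ (Set.range (fun i ↦ coordOp m i + partialOp m i) ∪
    Set.range (fun i ↦ coordOp m i - partialOp m i))

lemma coordOp_mem_weylAlgebra (m : ℕ) (i : Fin m) : coordOp m i ∈ weylAlgebra m := by
  have h1 : coordOp m i + partialOp m i ∈ weylAlgebra m :=
    Algebra.subset_adjoin (Or.inl ⟨i, rfl⟩)
  have h2 : coordOp m i - partialOp m i ∈ weylAlgebra m :=
    Algebra.subset_adjoin (Or.inr ⟨i, rfl⟩)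
  have h3 : coordOp m i = (1 / 2 : ℂ) • ((coordOp m i + partialOp m i) +
    (coordOp m i - partialOp m i)) := by module
  rw [h3]
  exact Subalgebra.smul_mem _ (add_mem h1 h2) _

lemma partialOp_mem_weylAlgebra (m : ℕ) (i : Fin m) : partialOp m i ∈ weylAlgebra m := by
  have h1 : coordOp m i + partialOp m i ∈ weylAlgebra m :=
    Algebra.subset_adjoin (Or.inl ⟨i, rfl⟩)
  have h3 : partialOp m i = (coordOp m i + partialOp m i) - coordOp m i := by abel
  rw [h3]
  exact sub_mem h1 (coordOp_mem_weylAlgebra m i)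

lemma normSqOp_mem_weylAlgebra (m : ℕ) : normSqOp m ∈ weylAlgebra m := by
  rw [normSqOp_eq_sum]
  exact sum_mem fun i _ ↦ mul_mem (coordOp_mem_weylAlgebra m i) (coordOp_mem_weylAlgebra m i)

lemma laplaceOp_mem_weylAlgebra (m : ℕ) : laplaceOp m ∈ weylAlgebra m := by
  rw [laplaceOp_eq_sum]
  exact sum_mem fun i _ ↦ mul_mem (partialOp_mem_weylAlgebra m i) (partialOp_mem_weylAlgebra m i)

/-- The bound on `A` produces the term `h D f`. Because `D` is an eigenvector of `ad h`, this is `D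
h f + c D f`, which the bound on `D` controls. -/
lemma IsHBounded.ladder_mul {m : ℕ} (hm : 1 ≤ m) {A D : Sch m →L[ℂ] Sch m}
    (hA : ∀ f, ‖toL2 m (A f)‖ ≤ 2 * (‖toL2 m f‖ + ‖toL2 m (hOp m f)‖))
    (hD : IsHBounded D) {c : ℂ} (hc : hOp m * D = D * hOp m + c • D) : IsHBounded (A * D) := by
  obtain ⟨C, N, hC, h⟩ := hD
  have hD' : IsHBounded (hOp m * D) := by
    rw [hc]
    exact IsHBounded.add hm (IsHBounded.mul_hOp ⟨C, N, hC, h⟩) (IsHBounded.smul ⟨C, N, hC, h⟩ c)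
  obtain ⟨C', N', hC', h'⟩ := hD'
  refine ⟨2 * (C * 2 ^ (max N N' - N) + C' * 2 ^ (max N N' - N')), max N N', by positivity,
    fun f ↦ ?_⟩
  rw [mulOp_apply, mul_assoc, add_mul, mul_assoc, mul_assoc]
  refine (hA _).trans ?_
  gcongr
  · refine (h f).trans ?_
    gcongr; exact norm_pow_hOp_mono hm f (le_max_left _ _)
  · refine (h' f).trans ?_
    gcongr; exact norm_pow_hOp_mono hm f (le_max_right _ _)

/-- Every differential operator with polynomial coefficients is bounded by a power of `h`. -/
lemma isHBounded_of_mem_weylAlgebra {m : ℕ} (hm : 1 ≤ m) {D : Sch m →L[ℂ] Sch m}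
    (hD : D ∈ weylAlgebra m) : IsHBounded D := by
  rw [weylAlgebra, ← Subalgebra.mem_toSubmodule, Algebra.adjoin_eq_span] at hD
  induction hD using Submodule.span_induction with
  | zero => exact ⟨0, 0, le_rfl, fun f ↦ by simp⟩
  | add D E _ _ hD hE => exact hD.add hm hE
  | smul c D _ hD => exact hD.smul c
  | mem D hD =>
    -- Words in the ladder operators are again eigenvectors of `ad h`, and the induction has to
    -- carry this along.
    suffices h : IsHBounded D ∧ ∃ c : ℂ, hOp m * D = D * hOp m + c • D from h.1
    induction hD using Submonoid.closure_induction_left with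
    | one => exact ⟨⟨1, 0, zero_le_one, fun f ↦ by simp⟩, 0, by simp⟩
    | mul_left A hA D _ ih =>
      obtain ⟨ihD, c, hc⟩ := ih
      rcases hA with ⟨i, rfl⟩ | ⟨i, rfl⟩
      · refine ⟨ihD.ladder_mul hm (fun f ↦ ?_) hc, c - 1, ?_⟩
        · rw [add_apply, map_add, two_mul]
          exact (norm_add_le _ _).trans (add_le_add (norm_coordOp_le m i f)
            (norm_partialOp_le m i f))
        · rw [← mul_assoc, mul_add, hOp_mul_coordOp, hOp_mul_partialOp, add_mul, sub_mul, sub_mul,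
            mul_assoc, mul_assoc, hc, add_mul, mul_add, mul_add, mul_smul_comm, mul_smul_comm]
          simp only [add_mul, mul_assoc]
          module
      · refine ⟨ihD.ladder_mul hm (fun f ↦ ?_) hc, c + 1, ?_⟩
        · rw [sub_apply, map_sub, two_mul]
          exact (norm_sub_le _ _).trans (add_le_add (norm_coordOp_le m i f)
            (norm_partialOp_le m i f))
        · rw [← mul_assoc, mul_sub, hOp_mul_coordOp, hOp_mul_partialOp, sub_mul, sub_mul, sub_mul,
            mul_assoc, mul_assoc, hc, sub_mul, mul_add, mul_add, mul_smul_comm, mul_smul_comm]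
          simp only [sub_mul, mul_assoc]
          module

end HelmholtzFourier
end

noncomputable section
namespace HelmholtzFourier

open MeasureTheory FourierTransform

/-! ### Schwartz seminorms are bounded by square integrals -/

lemma one_add_normSqOp_pow_apply (m k : ℕ) (f : Sch m) (x : Space m) :
    ((1 + normSqOp m) ^ k) f x = (((1 + ‖x‖ ^ 2) ^ k : ℝ) : ℂ) * f x := by
  induction k generalizing f with
  | zero => simp
  | succ k ih =>
    rw [pow_succ, mulOp_apply, ih, add_apply, one_apply_eq_self, add_apply, normSqOp_apply]
    push_cast; ring

lemma fourierInv_partialOp (m : ℕ) (i : Fin m) (f : Sch m) :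
    𝓕⁻ (partialOp m i f) = (-(2 * Real.pi * Complex.I)) • coordOp m i (𝓕⁻ f) := by
  have h := SchwartzMap.fourierInv_lineDerivOp_eq f (EuclideanSpace.single i (1 : ℝ) : Space m)
  refine h.trans ?_
  congr 1
  ext x
  have ht : Function.HasTemperateGrowth
      (fun x : Space m ↦ inner ℝ x (EuclideanSpace.single i (1 : ℝ))) := by fun_prop
  rw [SchwartzMap.smulLeftCLM_apply_apply ht, coordOp_apply, EuclideanSpace.inner_single_right]
  simp

lemma fourierInv_laplaceOp (m : ℕ) (f : Sch m) :
    𝓕⁻ (laplaceOp m f) = (-(4 * Real.pi ^ 2) : ℂ) • normSqOp m (𝓕⁻ f) := by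
  have hL : ∀ g : Sch m, 𝓕⁻ g = fourierInvCLM ℂ (Sch m) g := fun _ ↦ rfl
  rw [laplaceOp_eq_sum, normSqOp_eq_sum, sum_apply, sum_apply, Finset.smul_sum, hL, map_sum]
  refine Finset.sum_congr rfl fun i _ ↦ ?_
  rw [← hL, mulOp_apply, mulOp_apply, fourierInv_partialOp, fourierInv_partialOp, map_smul,
    smul_smul]
  congr 1
  linear_combination (-4 * Real.pi ^ 2 : ℂ) * (- Complex.I_sq)

/-- The Fourier kernel is `e^{-2πi⟨x,ξ⟩}`, so `-Δ/(4π²)` corresponds to multiplication by `|x|²`. -/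
lemma fourierInv_bessel_pow (m k : ℕ) (f : Sch m) :
    𝓕⁻ (((1 - (4 * Real.pi ^ 2 : ℂ)⁻¹ • laplaceOp m) ^ k) f) =
      ((1 + normSqOp m) ^ k) (𝓕⁻ f) := by
  have hpi : (4 * Real.pi ^ 2 : ℂ) ≠ 0 := by
    have : (Real.pi : ℂ) ≠ 0 := by exact_mod_cast Real.pi_ne_zero
    simp [this]
  have hL : ∀ g : Sch m, 𝓕⁻ g = fourierInvCLM ℂ (Sch m) g := fun _ ↦ rfl
  induction k generalizing f with
  | zero => simp
  | succ k ih =>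
    rw [pow_succ _ k, pow_succ _ k, mulOp_apply, mulOp_apply, ih, sub_apply, smul_apply, one_apply_eq_self,
      hL, map_sub, map_smul, ← hL, ← hL, fourierInv_laplaceOp, add_apply, one_apply_eq_self,
      smul_smul, mul_neg, inv_mul_cancel₀ hpi]
    congr 1
    module

lemma norm_toL2_eq (m : ℕ) (f : Sch m) : ‖toL2 m f‖ = (∫ x, ‖f x‖ ^ (2 : ℝ)) ^ (1 / 2 : ℝ) := by
  have h := SchwartzMap.norm_toLp' (f := f) (p := 2) (μ := volume) (by simp) (by simp)
  rw [one_div]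
  simpa [toL2] using h

lemma norm_toL2_fourierInv (m : ℕ) (f : Sch m) : ‖toL2 m (𝓕⁻ f)‖ = ‖toL2 m f‖ := by
  have h := SchwartzMap.norm_fourier_toL2_eq (𝓕⁻ f)
  rw [FourierTransform.fourier_fourierInv_eq] at h
  exact h.symm

/-- The weight `(1 + |x|²)^{-m}` is square integrable. -/
lemma memLp_weight (m : ℕ) (hm : 1 ≤ m) :
    MemLp (fun x : Space m ↦ ((1 + ‖x‖ ^ 2) ^ m)⁻¹) 2 volume := by
  have hc : Continuous (fun x : Space m ↦ ((1 + ‖x‖ ^ 2) ^ m)⁻¹) :=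
    Continuous.inv₀ (by fun_prop) fun x ↦ by positivity
  rw [memLp_two_iff_integrable_sq hc.aestronglyMeasurable]
  have hm' : (1 : ℝ) ≤ m := by exact_mod_cast hm
  -- The squared weight is `(1+|x|²)^{-r/2}` with `r = 4m`, and integrability needs `r > m`.
  have h := integrable_rpow_neg_one_add_norm_sq (E := Space m) (μ := volume) (r := 4 * m) (by
    rw [finrank_euclideanSpace_fin]; linarith)
  refine h.congr (Filter.Eventually.of_forall fun x ↦ ?_)
  have hx : (0 : ℝ) ≤ 1 + ‖x‖ ^ 2 := by positivity
  have he : (-(4 * (m : ℝ)) / 2) = -((m * 2 : ℕ) : ℝ) := by push_cast; ring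
  simp only
  rw [he, Real.rpow_neg hx, Real.rpow_natCast, inv_pow, pow_mul]

/-- A Sobolev inequality: the supremum is bounded by the square integral of a power of `1 - cΔ`. -/
lemma exists_norm_apply_le (m : ℕ) (hm : 1 ≤ m) : ∃ C : ℝ, 0 ≤ C ∧ ∀ (f : Sch m) (x : Space m),
    ‖f x‖ ≤ C * ‖toL2 m (((1 - (4 * Real.pi ^ 2 : ℂ)⁻¹ • laplaceOp m) ^ m) f)‖ := by
  refine ⟨(∫ x : Space m, ‖((((1 + ‖x‖ ^ 2) ^ m)⁻¹ : ℝ) : ℂ)‖ ^ (2 : ℝ)) ^ (1 / 2 : ℝ),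
    Real.rpow_nonneg (integral_nonneg fun x ↦ by positivity) _, fun f x ↦ ?_⟩
  -- The sup norm of `f` is at most the `L¹` norm of its inverse Fourier transform. Writing the
  -- latter as the weight times `w`, Cauchy–Schwarz and Plancherel give the bound.
  have h1 := SchwartzMap.norm_fourier_apply_le_toLp_one (𝓕⁻ f) x
  rw [FourierTransform.fourier_fourierInv_eq, SchwartzMap.norm_toLp_one] at h1
  refine h1.trans ?_
  set w : Sch m := ((1 + normSqOp m) ^ m) (𝓕⁻ f) with hw
  have h2 := integral_mul_norm_le_Lp_mul_Lq (μ := (volume : Measure (Space m)))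
    (f := fun x : Space m ↦ ((((1 + ‖x‖ ^ 2) ^ m)⁻¹ : ℝ) : ℂ)) (g := w) (p := 2) (q := 2)
    Real.HolderConjugate.two_two (by simpa using! (memLp_weight m hm).ofReal (K := ℂ))
    (by simpa using w.memLp 2 volume)
  rw [← norm_toL2_eq, hw, ← fourierInv_bessel_pow, norm_toL2_fourierInv] at h2
  refine le_trans (le_of_eq ?_) h2
  congr 1; ext y
  rw [fourierInv_bessel_pow, one_add_normSqOp_pow_apply, norm_mul, Complex.norm_real,
    Complex.norm_real, ← mul_assoc,
    norm_inv, inv_mul_cancel₀, one_mul]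
  rw [Real.norm_eq_abs, abs_ne_zero]
  positivity

lemma norm_iteratedFDeriv_le_sum (m n : ℕ) (f : Sch m) (x : Space m) :
    ‖iteratedFDeriv ℝ n f x‖ ≤ ∑ r : Fin n → Fin m,
      ‖iteratedFDeriv ℝ n f x (fun j ↦ EuclideanSpace.single (r j) (1 : ℝ))‖ := by
  refine ContinuousMultilinearMap.opNorm_le_bound (by positivity) fun v ↦ ?_
  have hv : v = fun j ↦ ∑ i, (v j i) • (EuclideanSpace.single i (1 : ℝ) : Space m) := by
    ext j i
    simp [Finset.sum_apply, Pi.single_apply]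
  conv_lhs => rw [hv, ContinuousMultilinearMap.map_sum]
  rw [Finset.sum_mul]
  refine (norm_sum_le _ _).trans (Finset.sum_le_sum fun r _ ↦ ?_)
  rw [ContinuousMultilinearMap.map_smul_univ, norm_smul, mul_comm, norm_prod]
  gcongr with j
  exact PiLp.norm_apply_le _ _

/-- The iterated coordinate derivative. -/
def iteratedPartialOp (m : ℕ) : (n : ℕ) → (Fin n → Fin m) → Sch m →L[ℂ] Sch m
  | 0, _ => 1
  | n + 1, r => partialOp m (r 0) * iteratedPartialOp m n (fun j ↦ r j.succ)

lemma iteratedPartialOp_mem_weylAlgebra (m n : ℕ) (r : Fin n → Fin m) :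
    iteratedPartialOp m n r ∈ weylAlgebra m := by
  induction n with
  | zero => exact one_mem _
  | succ n ih => exact mul_mem (partialOp_mem_weylAlgebra m _) (ih _)

lemma iteratedPartialOp_apply (m n : ℕ) (r : Fin n → Fin m) (f : Sch m) (x : Space m) :
    iteratedPartialOp m n r f x =
      iteratedFDeriv ℝ n f x (fun j ↦ EuclideanSpace.single (r j) (1 : ℝ)) := by
  rw [← SchwartzMap.iteratedLineDerivOp_eq_iteratedFDeriv]
  congr 1
  induction n with
  | zero => rfl
  | succ n ih =>
    rw [LineDeriv.iteratedLineDerivOp_succ_left, iteratedPartialOp, mulOp_apply, ih]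
    rfl

/-- The Schwartz seminorms are bounded by the norms `‖h^N f‖` in `L²`. -/
lemma exists_seminorm_le {m : ℕ} (hm : 1 ≤ m) (k n : ℕ) : ∃ (C : ℝ) (N : ℕ), 0 ≤ C ∧
    ∀ f : Sch m, SchwartzMap.seminorm ℂ k n f ≤ C * ‖toL2 m ((hOp m ^ N) f)‖ := by
  obtain ⟨C, hC, hsup⟩ := exists_norm_apply_le m hm
  -- The Sobolev operator, the weight and the derivative are combined into one element of the Weyl
  -- algebra, so a single power of `h` controls all three.
  have hD : ∀ r : Fin n → Fin m, IsHBounded ((1 - (4 * Real.pi ^ 2 : ℂ)⁻¹ • laplaceOp m) ^ m *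
      (1 + normSqOp m) ^ k * iteratedPartialOp m n r) := fun r ↦
    isHBounded_of_mem_weylAlgebra hm (mul_mem (mul_mem
      (pow_mem (sub_mem (one_mem _) (Subalgebra.smul_mem _ (laplaceOp_mem_weylAlgebra m) _)) _)
      (pow_mem (add_mem (one_mem _) (normSqOp_mem_weylAlgebra m)) _))
      (iteratedPartialOp_mem_weylAlgebra m n r))
  choose A N hA hN using hD
  set M := Finset.univ.sup N with hM
  refine ⟨∑ r, C * (A r * 2 ^ (M - N r)), M, Finset.sum_nonneg fun r _ ↦ by
    have := hA r; positivity, fun f ↦ ?_⟩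
  refine SchwartzMap.seminorm_le_bound ℂ k n f (mul_nonneg (Finset.sum_nonneg fun r _ ↦ by
    have := hA r; positivity) (norm_nonneg _)) fun x ↦ ?_
  rw [Finset.sum_mul]
  have hx : ‖x‖ ^ k ≤ (1 + ‖x‖ ^ 2) ^ k := by
    gcongr
    nlinarith [sq_nonneg (‖x‖ - 1), norm_nonneg x]
  calc ‖x‖ ^ k * ‖iteratedFDeriv ℝ n f x‖
      ≤ (1 + ‖x‖ ^ 2) ^ k * ∑ r : Fin n → Fin m, ‖iteratedPartialOp m n r f x‖ := by
        gcongr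
        simp only [iteratedPartialOp_apply]
        exact norm_iteratedFDeriv_le_sum m n f x
    _ = ∑ r : Fin n → Fin m, ‖((1 + normSqOp m) ^ k) (iteratedPartialOp m n r f) x‖ := by
        rw [Finset.mul_sum]
        refine Finset.sum_congr rfl fun r _ ↦ ?_
        rw [one_add_normSqOp_pow_apply, norm_mul, Complex.norm_real, Real.norm_of_nonneg]
        positivity
    _ ≤ _ := by
        refine Finset.sum_le_sum fun r _ ↦ (hsup _ x).trans ?_
        rw [mul_assoc, mul_assoc]
        gcongr
        refine (hN r f).trans ?_
        have := hA r
        gcongr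
        exact norm_pow_hOp_mono hm f (Finset.le_sup (Finset.mem_univ r))

end HelmholtzFourier
end

noncomputable section
namespace HelmholtzFourier

open MeasureTheory FourierTransform Filter Topology

/-! ### Completeness of the Schwartz space -/

section Completeness

variable {E F : Type*} [NormedAddCommGroup E] [NormedSpace ℝ E] [NormedAddCommGroup F]
  [NormedSpace ℝ F]

lemma seminorm_sub_lt_of_cauchySeq {u : ℕ → 𝓢(E, F)} (hu : CauchySeq u) (k n : ℕ) {ε : ℝ}
    (hε : 0 < ε) : ∃ N, ∀ i ≥ N, ∀ j ≥ N, SchwartzMap.seminorm ℝ k n (u i - u j) < ε := by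
  have hc : Continuous (SchwartzMap.seminorm ℝ k n : 𝓢(E, F) → ℝ) :=
    (schwartz_withSeminorms ℝ E F).continuous_seminorm (k, n)
  have hV : {p : 𝓢(E, F) × 𝓢(E, F) | SchwartzMap.seminorm ℝ k n (p.2 - p.1) < ε} ∈
      uniformity 𝓢(E, F) := by
    rw [uniformity_eq_comap_nhds_zero]
    exact preimage_mem_comap ((isOpen_Iio.preimage hc).mem_nhds (by simpa using hε))
  obtain ⟨N, hN⟩ := cauchySeq_iff.1 hu _ hV
  exact ⟨N, fun i hi j hj ↦ hN j hj i hi⟩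

lemma norm_iteratedFDeriv_sub_le (f g : 𝓢(E, F)) (k n : ℕ) (x : E) :
    ‖x‖ ^ k * ‖iteratedFDeriv ℝ n f x - iteratedFDeriv ℝ n g x‖ ≤
      SchwartzMap.seminorm ℝ k n (f - g) := by
  have h := SchwartzMap.le_seminorm ℝ k n (f - g) x
  have h2 : iteratedFDeriv ℝ n (f - g : 𝓢(E, F)) x =
      iteratedFDeriv ℝ n f x - iteratedFDeriv ℝ n g x :=
    iteratedFDeriv_sub_apply (f.contDiffAt n) (g.contDiffAt n)
  rwa [h2] at h

/-- If all derivatives of a Cauchy sequence of Schwartz functions converge pointwise, then they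
converge uniformly with all weights. -/
lemma norm_iteratedFDeriv_sub_limit_le {u : ℕ → 𝓢(E, F)} (hu : CauchySeq u)
    {G : (x : E) → FormalMultilinearSeries ℝ E F}
    (hG : ∀ n x, Tendsto (fun i ↦ iteratedFDeriv ℝ n (u i) x) atTop (𝓝 (G x n)))
    (k n : ℕ) {ε : ℝ} (hε : 0 < ε) :
    ∃ N, ∀ i ≥ N, ∀ x, ‖x‖ ^ k * ‖iteratedFDeriv ℝ n (u i) x - G x n‖ ≤ ε := by
  obtain ⟨N, hN⟩ := seminorm_sub_lt_of_cauchySeq hu k n hε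
  refine ⟨N, fun i hi x ↦ ?_⟩
  refine le_of_tendsto ((tendsto_const_nhds.sub (hG n x)).norm.const_mul (‖x‖ ^ k)) ?_
  filter_upwards [eventually_ge_atTop N] with j hj
  exact (norm_iteratedFDeriv_sub_le _ _ k n x).trans (hN i hi j hj).le

/-- The derivatives of each order converge uniformly, so the limit may be differentiated term by
term. -/
lemma hasFTaylorSeriesUpTo_limit {u : ℕ → 𝓢(E, F)} (hu : CauchySeq u)
    {G : (x : E) → FormalMultilinearSeries ℝ E F}
    (hG : ∀ n x, Tendsto (fun i ↦ iteratedFDeriv ℝ n (u i) x) atTop (𝓝 (G x n))) :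
    HasFTaylorSeriesUpTo ∞ (fun x ↦ (G x 0).curry0) G := by
  rw [hasFTaylorSeriesUpTo_top_iff' le_rfl]
  refine ⟨fun x ↦ rfl, fun n x ↦ ?_⟩
  refine hasFDerivAt_of_tendstoUniformly (l := atTop)
    (f := fun i ↦ iteratedFDeriv ℝ n (u i)) (f' := fun i y ↦ fderiv ℝ (iteratedFDeriv ℝ n (u i)) y)
    (g' := fun y ↦ (G y (n + 1)).curryLeft) ?_ ?_ (hG n) x
  · rw [Metric.tendstoUniformly_iff]
    intro ε hε
    obtain ⟨N, hN⟩ := norm_iteratedFDeriv_sub_limit_le hu hG 0 (n + 1) (half_pos hε)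
    filter_upwards [eventually_ge_atTop N] with i hi y
    have h := hN i hi y
    rw [pow_zero, one_mul] at h
    have h2 : (G y (n + 1)).curryLeft - fderiv ℝ (iteratedFDeriv ℝ n (u i)) y =
        continuousMultilinearCurryLeftEquiv ℝ (fun _ : Fin (n + 1) ↦ E) F
          (G y (n + 1) - iteratedFDeriv ℝ (n + 1) (u i) y) := by
      rw [fderiv_iteratedFDeriv]; rfl
    rw [dist_eq_norm, h2, LinearIsometryEquiv.norm_map, norm_sub_rev]
    linarith
  · intro i y
    exact (((u i).smooth ⊤).differentiable_iteratedFDeriv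
      (mod_cast ENat.natCast_lt_top n) y).hasFDerivAt

/-- The extension from the dense Hermite span needs a complete target. The uniformity is countably
generated, so Cauchy sequences suffice; the limit is assembled from the pointwise limits of all
derivatives. -/
instance completeSpace_schwartzMap [CompleteSpace F] : CompleteSpace 𝓢(E, F) := by
  have : (uniformity 𝓢(E, F)).IsCountablyGenerated :=
    IsUniformAddGroup.uniformity_countably_generated
  refine UniformSpace.complete_of_cauchySeq_tendsto fun u hu ↦ ?_
  have hlim : ∀ (x : E) (n : ℕ), ∃ T : E[×n]→L[ℝ] F,
      Tendsto (fun i ↦ iteratedFDeriv ℝ n (u i) x) atTop (𝓝 T) := by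
    intro x n
    refine cauchySeq_tendsto_of_complete (Metric.cauchySeq_iff.2 fun ε hε ↦ ?_)
    obtain ⟨N, hN⟩ := seminorm_sub_lt_of_cauchySeq hu 0 n hε
    refine ⟨N, fun i hi j hj ↦ lt_of_le_of_lt ?_ (hN i hi j hj)⟩
    simpa [dist_eq_norm] using norm_iteratedFDeriv_sub_le (u i) (u j) 0 n x
  choose G hG using hlim
  have hG' : ∀ n x, Tendsto (fun i ↦ iteratedFDeriv ℝ n (u i) x) atTop (𝓝 (G x n)) :=
    fun n x ↦ hG x n
  have hT := hasFTaylorSeriesUpTo_limit hu hG'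
  have hD : ∀ n x, iteratedFDeriv ℝ n (fun x ↦ (G x 0).curry0) x = G x n :=
    fun n x ↦ (hT.eq_iteratedFDeriv (mod_cast le_top) x).symm
  let f : 𝓢(E, F) :=
    { toFun := fun x ↦ (G x 0).curry0
      smooth' := HasFTaylorSeriesUpTo.contDiff (n := ⊤) hT
      decay' := by
        intro k n
        obtain ⟨N, hN⟩ := norm_iteratedFDeriv_sub_limit_le hu hG' k n one_pos
        refine ⟨SchwartzMap.seminorm ℝ k n (u N) + 1, fun x ↦ ?_⟩
        rw [hD]
        have h1 := hN N le_rfl x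
        have h2 := SchwartzMap.le_seminorm ℝ k n (u N) x
        have h3 : ‖G x n‖ ≤ ‖iteratedFDeriv ℝ n (u N) x‖ +
            ‖iteratedFDeriv ℝ n (u N) x - G x n‖ := by
          have := norm_sub_le (iteratedFDeriv ℝ n (u N) x) (iteratedFDeriv ℝ n (u N) x - G x n)
          rwa [sub_sub_cancel] at this
        nlinarith [mul_le_mul_of_nonneg_left h3 (pow_nonneg (norm_nonneg x) k)] }
  refine ⟨f, ((schwartz_withSeminorms ℝ E F).tendsto_nhds_atTop _ _).2 ?_⟩
  rintro ⟨k, n⟩ ε hε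
  obtain ⟨N, hN⟩ := norm_iteratedFDeriv_sub_limit_le hu hG' k n (half_pos hε)
  refine ⟨N, fun i hi ↦ lt_of_le_of_lt ?_ (half_lt_self hε)⟩
  refine SchwartzMap.seminorm_le_bound ℝ k n _ (half_pos hε).le fun x ↦ ?_
  have h2 : iteratedFDeriv ℝ n (u i - f : 𝓢(E, F)) x =
      iteratedFDeriv ℝ n (u i) x - iteratedFDeriv ℝ n f x :=
    iteratedFDeriv_sub_apply ((u i).contDiffAt n) (f.contDiffAt n)
  rw [h2]
  have h3 : iteratedFDeriv ℝ n f x = G x n := hD n x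
  rw [h3]
  exact hN i hi x

end Completeness

end HelmholtzFourier
end

noncomputable section
namespace HelmholtzFourier

open MeasureTheory FourierTransform Filter Topology

/-! ### Density of the span of the Hermite functions -/

section

variable {m : ℕ}

/-- A continuous exponential times the Gaussian is square integrable. -/
lemma memLp_exp_mul_gaussian (m : ℕ) (c : ℝ) :
    MemLp (fun x : Space m ↦ Real.exp (c * ‖x‖) * Real.exp (-(‖x‖ ^ 2) / 2)) 2 volume := by
  have hc : Continuous (fun x : Space m ↦ Real.exp (c * ‖x‖) * Real.exp (-(‖x‖ ^ 2) / 2)) := by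
    fun_prop
  rw [memLp_two_iff_integrable_sq hc.aestronglyMeasurable]
  -- The dominating function comes from `2c|x| - |x|² ≤ 2c² - |x|²/2`, which is `(|x| - 2c)² ≥ 0`.
  have hg : Integrable (fun x : Space m ↦ Real.exp (2 * c ^ 2) * Real.exp (-(‖x‖ ^ 2) / 2)) := by
    have h := (gaussian m).integrable (μ := volume)
    have h2 := h.norm.const_mul (Real.exp (2 * c ^ 2))
    refine h2.congr (Eventually.of_forall fun x ↦ ?_)
    have h3 : gaussian m x = ((Real.exp (-(‖x‖ ^ 2) / 2) : ℝ) : ℂ) := rfl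
    simp only [h3, Complex.norm_real, Real.norm_of_nonneg (Real.exp_pos _).le]
  refine hg.mono' (by fun_prop) (Eventually.of_forall fun x ↦ ?_)
  rw [Real.norm_of_nonneg (by positivity), ← Real.exp_add, ← Real.exp_add, ← Real.exp_nat_mul]
  apply Real.exp_le_exp.2
  push_cast
  nlinarith [sq_nonneg (‖x‖ - 2 * c)]

lemma integrable_exp_mul_gaussian_mul (u : Lp (α := Space m) ℂ 2) (c : ℝ) :
    Integrable (fun x : Space m ↦
      ((Real.exp (c * ‖x‖) * Real.exp (-(‖x‖ ^ 2) / 2) : ℝ) : ℂ) * u x) :=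
  ((memLp_exp_mul_gaussian m c).ofReal (K := ℂ)).integrable_mul (Lp.memLp u)

lemma integral_pow_inner_mul_eq_zero {u : Lp (α := Space m) ℂ 2}
    (hu : ∀ P, inner ℂ (toL2 m (polyGauss m P)) u = 0) (ξ : Space m) (n : ℕ) :
    ∫ x : Space m, ((inner ℝ x ξ : ℝ) : ℂ) ^ n * (((Real.exp (-(‖x‖ ^ 2) / 2) : ℝ) : ℂ) * u x) = 0 := by
  have h := hu ((∑ i, MvPolynomial.C ((ξ i : ℝ) : ℂ) * MvPolynomial.X i) ^ n)
  rw [L2.inner_def] at h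
  rw [← h]
  refine integral_congr_ae ?_
  filter_upwards [SchwartzMap.coeFn_toLp (polyGauss m
    ((∑ i, MvPolynomial.C ((ξ i : ℝ) : ℂ) * MvPolynomial.X i) ^ n)) 2 volume] with x hx
  have hx' : toL2 m (polyGauss m
    ((∑ i, MvPolynomial.C ((ξ i : ℝ) : ℂ) * MvPolynomial.X i) ^ n)) x = _ := hx
  have hi : (∑ i, ((ξ i : ℝ) : ℂ) * ((x i : ℝ) : ℂ)) = ((inner ℝ x ξ : ℝ) : ℂ) := by
    rw [PiLp.inner_apply]
    push_cast
    simp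
  rw [hx', polyGauss_apply]
  simp only [map_pow, map_sum, map_mul, MvPolynomial.eval_C, MvPolynomial.eval_X, hi]
  rw [RCLike.inner_apply', map_mul, map_pow, Complex.conj_ofReal, Complex.conj_ofReal]
  ring

/-- Expand `e^{-2πi⟨x,ξ⟩}` into its power series. The moments against powers of `⟨x,ξ⟩` vanish, and
termwise integration is dominated by `e^{2π|ξ||x|}`, which the Gaussian makes integrable against
`u`. -/
lemma fourier_gaussian_mul_eq_zero {u : Lp (α := Space m) ℂ 2}
    (hu : ∀ P, inner ℂ (toL2 m (polyGauss m P)) u = 0) (ξ : Space m) :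
    𝓕 (fun x : Space m ↦ ((Real.exp (-(‖x‖ ^ 2) / 2) : ℝ) : ℂ) * u x) ξ = 0 := by
  set v : Space m → ℂ := fun x ↦ ((Real.exp (-(‖x‖ ^ 2) / 2) : ℝ) : ℂ) * u x with hv
  have hvm : AEStronglyMeasurable v volume := by
    have := (integrable_exp_mul_gaussian_mul u 0).aestronglyMeasurable
    simpa [hv] using this
  have hint := (integrable_exp_mul_gaussian_mul u (2 * Real.pi * ‖ξ‖)).norm
  have hnorm : ∀ x, ‖((Real.exp (2 * Real.pi * ‖ξ‖ * ‖x‖) * Real.exp (-(‖x‖ ^ 2) / 2) : ℝ) : ℂ) * u x‖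
      = Real.exp (2 * Real.pi * ‖ξ‖ * ‖x‖) * ‖v x‖ := by
    intro x
    rw [Complex.ofReal_mul, mul_assoc, norm_mul, Complex.norm_real,
      Real.norm_of_nonneg (Real.exp_pos _).le]
  have hsum := hasSum_integral_of_dominated_convergence (μ := (volume : Measure (Space m)))
    (F := fun (n : ℕ) x ↦ ((-(2 * Real.pi * (inner ℝ x ξ : ℝ)) * Complex.I : ℂ) ^ n / (n ! : ℂ)) * v x)
    (f := fun x ↦ Complex.exp (-(2 * Real.pi * (inner ℝ x ξ : ℝ)) * Complex.I) * v x)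
    (fun (n : ℕ) x ↦ ((2 * Real.pi * ‖ξ‖ * ‖x‖) ^ n / (n ! : ℝ)) * ‖v x‖)
    (fun n ↦ by
      refine AEStronglyMeasurable.mul (Continuous.aestronglyMeasurable ?_) hvm
      fun_prop)
    (fun n ↦ Eventually.of_forall fun x ↦ by
      rw [norm_mul, norm_div, norm_pow, Complex.norm_natCast]
      gcongr
      rw [norm_mul, Complex.norm_I, mul_one, norm_neg, norm_mul, norm_mul, Complex.norm_real,
        Complex.norm_real, Complex.norm_ofNat, Real.norm_of_nonneg Real.pi_pos.le, mul_assoc,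
        mul_assoc, mul_assoc, mul_comm ‖ξ‖]
      have := norm_inner_le_norm (𝕜 := ℝ) x ξ
      gcongr)
    (Eventually.of_forall fun x ↦ (Real.summable_pow_div_factorial _).mul_right _)
    (by
      refine hint.congr (Eventually.of_forall fun x ↦ ?_)
      simp only [hnorm]
      rw [tsum_mul_right, Real.exp_eq_exp_ℝ, NormedSpace.exp_eq_tsum_div])
    (Eventually.of_forall fun x ↦ by
      refine HasSum.mul_right _ ?_
      rw [Complex.exp_eq_exp_ℂ]
      exact NormedSpace.expSeries_div_hasSum_exp _)
  have hz : ∀ n : ℕ, ∫ x : Space m,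
      ((-(2 * Real.pi * (inner ℝ x ξ : ℝ)) * Complex.I : ℂ) ^ n / (n ! : ℂ)) * v x = 0 := by
    intro n
    have h := integral_pow_inner_mul_eq_zero hu ξ n
    have h2 := congrArg (fun z ↦ ((-(2 * Real.pi) * Complex.I : ℂ) ^ n / (n ! : ℂ)) * z) h
    simp only [mul_zero, ← integral_const_mul] at h2
    rw [← h2]
    congr 1; ext x
    rw [hv]
    have : (-(2 * Real.pi * (inner ℝ x ξ : ℝ)) * Complex.I : ℂ) =
      (-(2 * Real.pi) * Complex.I) * (inner ℝ x ξ : ℝ) := by ring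
    rw [this, mul_pow]
    ring
  simp only [hz] at hsum
  have h0 := hsum.unique hasSum_zero
  rw [Real.fourier_eq', ← h0]
  congr 1; ext x
  rw [smul_eq_mul]
  congr 2
  push_cast; ring

/-- The products of polynomials and the Gaussian are complete in `L²`. -/
lemma eq_zero_of_inner_polyGauss {u : Lp (α := Space m) ℂ 2}
    (hu : ∀ P, inner ℂ (toL2 m (polyGauss m P)) u = 0) : u = 0 := by
  set v : Space m → ℂ := fun x ↦ ((Real.exp (-(‖x‖ ^ 2) / 2) : ℝ) : ℂ) * u x with hv
  have hvi : Integrable v := by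
    have := integrable_exp_mul_gaussian_mul u 0
    simpa [hv] using this
  -- Duality moves the Fourier transform from `𝓕⁻ s` to `v`, whose transform is zero. Test functions
  -- then show `v = 0` almost everywhere.
  have hF : ∀ s : Sch m, ∫ x, v x • s x = 0 := by
    intro s
    have h := VectorFourier.integral_fourierIntegral_smul_eq_flip (μ := volume) (ν := volume)
      (L := innerₗ (Space m)) (f := v) (g := (𝓕⁻ s : Sch m)) Real.continuous_fourierChar
      continuous_inner hvi (𝓕⁻ s).integrable
    have h1 : ∀ ξ, VectorFourier.fourierIntegral Real.fourierChar volume (innerₗ (Space m)) v ξ = 0 :=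
      fun ξ ↦ fourier_gaussian_mul_eq_zero hu ξ
    have h2 : ∀ x, VectorFourier.fourierIntegral Real.fourierChar volume (innerₗ (Space m)).flip
        (𝓕⁻ s : Sch m) x = s x := by
      intro x
      have h3 : (𝓕 (𝓕⁻ s : Sch m) : Sch m) x = s x := by
        rw [FourierTransform.fourier_fourierInv_eq]
      rw [SchwartzMap.fourier_coe] at h3
      rw [flip_innerₗ]
      exact h3
    simp only [h1, h2, zero_smul, integral_zero] at h
    exact h.symm
  have hv0 : ∀ᵐ x, v x = 0 := by
    refine ae_eq_zero_of_integral_contDiff_smul_eq_zero hvi.locallyIntegrable fun g hg hgc ↦ ?_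
    have hg' : ContDiff ℝ ∞ (fun x ↦ ((g x : ℝ) : ℂ)) := Complex.ofRealCLM.contDiff.comp hg
    have hgc' : HasCompactSupport (fun x ↦ ((g x : ℝ) : ℂ)) :=
      hgc.comp_left (g := fun t : ℝ ↦ (t : ℂ)) (by simp)
    rw [← hF (hgc'.toSchwartzMap hg')]
    congr 1; ext x
    exact (Complex.real_smul).trans (mul_comm _ _)
  rw [Lp.eq_zero_iff_ae_eq_zero]
  filter_upwards [hv0] with x hx
  rw [hv] at hx
  rcases mul_eq_zero.1 hx with h | h
  · exact absurd h (by exact_mod_cast (Real.exp_pos _).ne')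
  · exact h

end

lemma dense_toL2_hermiteSpan {m : ℕ} (hm : 1 ≤ m) :
    ((hermiteSpan m).map (toL2 m).toLinearMap).topologicalClosure = ⊤ := by
  rw [Submodule.topologicalClosure_eq_top_iff, Submodule.eq_bot_iff]
  intro u hu
  refine eq_zero_of_inner_polyGauss fun P ↦ ?_
  exact (Submodule.mem_orthogonal _ _).1 hu _
    (Submodule.mem_map_of_mem (polyGauss_mem_hermiteSpan hm P))

/-- The eigenvalues `2j+k+m/2` of `h` on the span are positive. -/
lemma exists_hOp_pow_eq {m : ℕ} (hm : 1 ≤ m) (N : ℕ) {w : Sch m} (hw : w ∈ hermiteSpan m) :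
    ∃ w' ∈ hermiteSpan m, (hOp m ^ N) w' = w := by
  have key : ∀ w ∈ hermiteSpan m, ∃ w' ∈ hermiteSpan m, hOp m w' = w := by
    intro w hw
    induction hw using Submodule.span_induction with
    | mem w hw =>
      obtain ⟨j, k, H, hH, rfl⟩ := hw
      have hc : (2 * j + k + m / 2 : ℂ) ≠ 0 := by
        have h1 : (0 : ℝ) < 2 * j + k + m / 2 := by positivity
        have h2 := Complex.ofReal_ne_zero.2 h1.ne'
        push_cast at h2
        exact h2
      refine ⟨(2 * j + k + m / 2 : ℂ)⁻¹ • hermiteFn m j k H,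
        Submodule.smul_mem _ _ (hermiteFn_mem_hermiteSpan hH j), ?_⟩
      rw [map_smul, hOp_hermiteFn hH, inv_smul_smul₀ hc]
    | zero => exact ⟨0, Submodule.zero_mem _, map_zero _⟩
    | add p q _ _ hp hq =>
      obtain ⟨p', hp', h1⟩ := hp
      obtain ⟨q', hq', h2⟩ := hq
      exact ⟨p' + q', Submodule.add_mem _ hp' hq', by rw [map_add, h1, h2]⟩
    | smul c p _ hp =>
      obtain ⟨p', hp', h1⟩ := hp
      exact ⟨c • p', Submodule.smul_mem _ _ hp', by rw [map_smul, h1]⟩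
  induction N with
  | zero => exact ⟨w, hw, by simp⟩
  | succ N ih =>
    obtain ⟨w', hw', h⟩ := ih
    obtain ⟨w'', hw'', h'⟩ := key w' hw'
    exact ⟨w'', hw'', by rw [pow_succ, mulOp_apply, h', h]⟩

lemma exists_sup_seminorm_le {m : ℕ} (hm : 1 ≤ m) (s : Finset (ℕ × ℕ)) :
    ∃ (C : ℝ) (N : ℕ), 0 ≤ C ∧ ∀ f : Sch m,
      s.sup (schwartzSeminormFamily ℂ (Space m) ℂ) f ≤ C * ‖toL2 m ((hOp m ^ N) f)‖ := by
  induction s using Finset.induction_on with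
  | empty => exact ⟨0, 0, le_rfl, fun f ↦ by simp⟩
  | insert a s _ ih =>
    obtain ⟨C, N, hC, h⟩ := ih
    obtain ⟨C', N', hC', h'⟩ := exists_seminorm_le hm a.1 a.2
    refine ⟨C' * 2 ^ (max N N' - N') + C * 2 ^ (max N N' - N), max N N', by positivity,
      fun f ↦ ?_⟩
    rw [Finset.sup_insert, Seminorm.sup_apply, add_mul, mul_assoc, mul_assoc]
    have h1 : schwartzSeminormFamily ℂ (Space m) ℂ a f ≤
        C' * (2 ^ (max N N' - N') * ‖toL2 m ((hOp m ^ max N N') f)‖) := by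
      refine (h' f).trans ?_
      gcongr; exact norm_pow_hOp_mono hm f (le_max_right _ _)
    have h2 : s.sup (schwartzSeminormFamily ℂ (Space m) ℂ) f ≤
        C * (2 ^ (max N N' - N) * ‖toL2 m ((hOp m ^ max N N') f)‖) := by
      refine (h f).trans ?_
      gcongr; exact norm_pow_hOp_mono hm f (le_max_left _ _)
    refine max_le (h1.trans (le_add_of_nonneg_right (by positivity)))
      (h2.trans (le_add_of_nonneg_left (by positivity)))

/-- The finite linear combinations of Hermite functions are dense in the Schwartz space. -/
lemma dense_hermiteSpan {m : ℕ} (hm : 1 ≤ m) : Dense (hermiteSpan m : Set (Sch m)) := by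
  intro f
  rw [mem_closure_iff_nhds]
  intro U hU
  obtain ⟨s, r, hr, hs⟩ := ((schwartz_withSeminorms ℂ (Space m) ℂ).mem_nhds_iff f U).1 hU
  obtain ⟨C, N, hC, h⟩ := exists_sup_seminorm_le hm s
  have hd : toL2 m ((hOp m ^ N) f) ∈
      ((hermiteSpan m).map (toL2 m).toLinearMap).topologicalClosure := by
    rw [dense_toL2_hermiteSpan hm]; trivial
  have hd' : toL2 m ((hOp m ^ N) f) ∈
      closure (((hermiteSpan m).map (toL2 m).toLinearMap : Submodule ℂ _) : Set _) := hd
  -- It is `h^N f` that is approximated in `L²`. The approximant has the form `h^N w'`, and the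
  -- seminorms of `w' - f` are bounded by `‖h^N (w' - f)‖`. The denominator `C + 1` covers `C = 0`.
  obtain ⟨b, hb, hdist⟩ := Metric.mem_closure_iff.1 hd' (r / (C + 1)) (by positivity)
  obtain ⟨w, hw, rfl⟩ := hb
  obtain ⟨w', hw', rfl⟩ := exists_hOp_pow_eq hm N hw
  refine ⟨w', hs ?_, hw'⟩
  rw [Seminorm.mem_ball]
  refine (h _).trans_lt ?_
  rw [dist_eq_norm, norm_sub_rev] at hdist
  have h3 : ‖toL2 m ((hOp m ^ N) (w' - f))‖ < r / (C + 1) := by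
    rw [map_sub, map_sub]; exact hdist
  rw [lt_div_iff₀ (by positivity)] at h3
  nlinarith [norm_nonneg (toL2 m ((hOp m ^ N) (w' - f)))]

end HelmholtzFourier
end

noncomputable section
namespace HelmholtzFourier

/-! ### Values of the polynomials `E_n` and `D_n` -/

/-- The product `∏_{l < n} (y - l) (y + l + 1)`. -/
def centralProd (n : ℕ) (y : ℂ) : ℂ := ∏ l ∈ Finset.range n, (y - l) * (y + l + 1)

/-- The factors are the `2n` consecutive integers from `y-n+1` to `y+n`; for `y < n` both sides
vanish. -/
lemma centralProd_natCast (n y : ℕ) :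
    centralProd n y = ((y + n).descFactorial (2 * n) : ℕ) := by
  induction n with
  | zero => simp [centralProd]
  | succ n ih =>
    rw [centralProd, Finset.prod_range_succ, ← centralProd, ih,
      show y + (n + 1) = (y + n) + 1 by ring, show 2 * (n + 1) = (2 * n + 1) + 1 by ring,
      Nat.succ_descFactorial_succ, Nat.descFactorial_succ]
    rcases le_or_gt n y with h | h
    · rw [show y + n - 2 * n = y - n by omega]
      push_cast [Nat.cast_sub h]
      ring
    · rw [Nat.descFactorial_eq_zero_iff_lt.2 (by omega : y + n < 2 * n)]
      simp

lemma centralProd_sub_one (n : ℕ) (y : ℂ) :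
    centralProd n y * (y - n) = centralProd n (y - 1) * (y + n) := by
  induction n with
  | zero => simp [centralProd]
  | succ n ih =>
    simp only [centralProd, Finset.prod_range_succ] at ih ⊢
    push_cast
    linear_combination ((y + n + 1) * (y - n - 1)) * ih

lemma two_mul_prod_sq_sub_sq (n : ℕ) (y : ℂ) :
    2 * ∏ l ∈ Finset.range n, (y ^ 2 - (l : ℂ) ^ 2) = centralProd n y + centralProd n (y - 1) := by
  induction n with
  | zero => norm_num [centralProd]
  | succ n ih =>
    have h := centralProd_sub_one n y
    simp only [centralProd, Finset.prod_range_succ] at ih h ⊢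
    linear_combination (y ^ 2 - n ^ 2) * ih - h

/-- For `n, y ≥ 1` the value is `binom(y+n, 2n) + binom(y+n-1, 2n)`, by `two_mul_prod_sq_sub_sq` in
numerator and denominator. -/
lemma polyE_eval_natCast_sq (n y : ℕ) : ∃ z : ℤ, (polyE n).eval ((y : ℂ) ^ 2) = z := by
  rcases n with _ | n
  · exact ⟨1, by simp [polyE]⟩
  rcases y with _ | y
  · refine ⟨0, ?_⟩
    rw [polyE_eval_sq, Finset.prod_eq_zero (i := 0) (by simp) (by simp)]
    simp
  have h1 := two_mul_prod_sq_sub_sq (n + 1) ((y + 1 : ℕ) : ℂ)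
  have h2 := two_mul_prod_sq_sub_sq (n + 1) ((n + 1 : ℕ) : ℂ)
  have e : ∀ t : ℕ, ((t + 1 : ℕ) : ℂ) - 1 = (t : ℂ) := fun t ↦ by push_cast; ring
  rw [e, centralProd_natCast, centralProd_natCast, Nat.descFactorial_eq_factorial_mul_choose,
    Nat.descFactorial_eq_factorial_mul_choose] at h1 h2
  rw [show n + 1 + (n + 1) = 2 * (n + 1) by ring, Nat.choose_self,
    Nat.choose_eq_zero_of_lt (by omega : n + (n + 1) < 2 * (n + 1))] at h2
  refine ⟨((y + 1 + (n + 1)).choose (2 * (n + 1)) + (y + (n + 1)).choose (2 * (n + 1)) : ℕ), ?_⟩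
  have hf : ((2 * (n + 1))! : ℂ) ≠ 0 := by exact_mod_cast Nat.factorial_ne_zero _
  rw [polyE_eval_sq, Finset.prod_div_distrib, ← mul_div_mul_left _ _ (two_ne_zero' ℂ), h1, h2]
  push_cast
  field_simp
  ring

/-- Here `(y+1/2)² - (l+1/2)² = (y-l)(y+l+1)`, and the value is the single binomial coefficient
`binom(y+n, 2n)`. -/
lemma polyD_eval_natCast_add_half_sq (n y : ℕ) :
    ∃ z : ℤ, (polyD n).eval (((y : ℂ) + 1 / 2) ^ 2) = z := by
  have e : ∀ t : ℕ, ∏ l ∈ Finset.range n, (((t : ℂ) + 1 / 2) ^ 2 - ((l : ℂ) + 1 / 2) ^ 2) =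
      centralProd n t := fun t ↦ Finset.prod_congr rfl fun l _ ↦ by ring
  refine ⟨((y + n).choose (2 * n) : ℕ), ?_⟩
  have hf : ((2 * n)! : ℂ) ≠ 0 := by exact_mod_cast Nat.factorial_ne_zero _
  rw [polyD_eval_sq, Finset.prod_div_distrib, e, e, centralProd_natCast, centralProd_natCast,
    Nat.descFactorial_eq_factorial_mul_choose, Nat.descFactorial_eq_factorial_mul_choose,
    show n + n = 2 * n by ring, Nat.choose_self]
  push_cast
  field_simp

/-- The points `y²` (even dimension) and `(y + 1/2)²` (odd dimension), which are the possible
eigenvalues of the Casimir operator. -/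
def node (m y : ℕ) : ℂ := if Even m then (y : ℂ) ^ 2 else ((y : ℂ) + 1 / 2) ^ 2

/-- On the right `m / 2` and `- 1` are natural-number operations. Truncation occurs only for `m =
1`, `k = 0`, where it is harmless because `(-1/2)² = (1/2)²`. -/
lemma casimirEigenvalue_eq_node {m : ℕ} (hm : 1 ≤ m) (k : ℕ) :
    ((m : ℂ) / 2 + k - 1) ^ 2 = node m (m / 2 + k - 1) := by
  rcases Nat.even_or_odd' m with ⟨r, rfl | rfl⟩
  · rw [node, if_pos (even_two_mul r), Nat.mul_div_cancel_left r two_pos,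
      Nat.cast_sub (by omega : 1 ≤ r + k)]
    push_cast
    ring
  · rw [node, if_neg (by simp), show (2 * r + 1) / 2 = r by omega]
    rcases Nat.eq_zero_or_pos (r + k) with h | h
    · obtain ⟨rfl, rfl⟩ : r = 0 ∧ k = 0 := by omega
      norm_num
    · rw [Nat.cast_sub h]
      push_cast
      ring

/-- This makes the series finite at every node and the system for the coefficients triangular. -/
lemma seriesPoly_eval_node_eq_zero (m : ℕ) {n y : ℕ} (h : y < n) :
    (seriesPoly m n).eval (node m y) = 0 := by
  unfold seriesPoly node
  split_ifs
  · rw [polyE_eval_sq, Finset.prod_eq_zero (Finset.mem_range.2 h) (by simp)]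
  · rw [polyD_eval_sq, Finset.prod_eq_zero (Finset.mem_range.2 h) (by simp)]

lemma seriesPoly_eval_node_self (m n : ℕ) : (seriesPoly m n).eval (node m n) = 1 := by
  unfold seriesPoly node
  split_ifs
  · rw [polyE_eval_sq]
    refine Finset.prod_eq_one fun l hl ↦ div_self ?_
    have h : l < n := Finset.mem_range.1 hl
    rw [sq_sub_sq]
    refine mul_ne_zero (by exact_mod_cast (by omega : n + l ≠ 0)) ?_
    exact sub_ne_zero.2 (by exact_mod_cast h.ne')
  · rw [polyD_eval_sq]
    refine Finset.prod_eq_one fun l hl ↦ div_self ?_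
    have h : l < n := Finset.mem_range.1 hl
    rw [show ((n : ℂ) + 1 / 2) ^ 2 - ((l : ℂ) + 1 / 2) ^ 2 = (n + l + 1) * (n - l) by ring]
    refine mul_ne_zero (by exact_mod_cast (by omega : n + l + 1 ≠ 0)) ?_
    exact sub_ne_zero.2 (by exact_mod_cast h.ne')

lemma exists_seriesPoly_eval_node_eq_intCast (m n y : ℕ) :
    ∃ z : ℤ, (seriesPoly m n).eval (node m y) = z := by
  unfold seriesPoly node
  split_ifs
  · exact polyE_eval_natCast_sq n y
  · exact polyD_eval_natCast_add_half_sq n y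

/-- The integer values of the polynomials `E_n`, `D_n` at the eigenvalues of the Casimir
operator. -/
def seriesValue (m n y : ℕ) : ℤ := (exists_seriesPoly_eval_node_eq_intCast m n y).choose

lemma seriesPoly_eval_node (m n y : ℕ) : (seriesPoly m n).eval (node m y) = seriesValue m n y :=
  (exists_seriesPoly_eval_node_eq_intCast m n y).choose_spec

lemma seriesValue_self (m n : ℕ) : seriesValue m n n = 1 := by
  have h := seriesPoly_eval_node m n n
  rw [seriesPoly_eval_node_self] at h
  exact_mod_cast h.symm

/-- The value of the series `∑ aₙ Eₙ` or `∑ aₙ Dₙ` at an eigenvalue of the Casimir operator. -/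
def seriesSum (m : ℕ) (a : ℕ → ℕ) (y : ℕ) : ℤ :=
  ∑ n ∈ Finset.range (y + 1), (a n : ℤ) * seriesValue m n y

lemma hasSum_series_node (m : ℕ) (a : ℕ → ℕ) (y : ℕ) :
    HasSum (fun n ↦ (a n : ℂ) * (seriesPoly m n).eval (node m y)) (seriesSum m a y : ℂ) := by
  have h : HasSum (fun n ↦ (a n : ℂ) * (seriesPoly m n).eval (node m y))
      (∑ n ∈ Finset.range (y + 1), (a n : ℂ) * (seriesPoly m n).eval (node m y)) :=
    hasSum_sum_of_ne_finset_zero fun n hn ↦ by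
      rw [seriesPoly_eval_node_eq_zero m (by simpa using hn), mul_zero]
  rw [seriesSum]
  simpa [seriesPoly_eval_node] using h

/-- A sequence with values in `{0, 1, 2, 3}` that solves a triangular system of congruences
modulo `4`. -/
def triangularSol (c : ℕ → ℤ) (z : ℕ → ℕ → ℤ) : ℕ → ℕ
  | n => ((c n - ∑ l : Fin n, (triangularSol c z l : ℤ) * z l n) % 4).toNat
  decreasing_by exact l.2

lemma triangularSol_mem (c : ℕ → ℤ) (z : ℕ → ℕ → ℤ) (n : ℕ) :
    triangularSol c z n ∈ ({0, 1, 2, 3} : Set ℕ) := by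
  rw [triangularSol]
  simp only [Set.mem_insert_iff, Set.mem_singleton_iff]
  omega

lemma triangularSol_sum_modEq (c : ℕ → ℤ) (z : ℕ → ℕ → ℤ) (hz : ∀ n, z n n = 1) (n : ℕ) :
    ∑ l ∈ Finset.range (n + 1), (triangularSol c z l : ℤ) * z l n ≡ c n [ZMOD 4] := by
  rw [Finset.sum_range_succ, hz, mul_one, triangularSol.eq_1 c z n,
    Finset.sum_range (fun l ↦ (triangularSol c z l : ℤ) * z l n), Int.ModEq]
  omega

end HelmholtzFourier
end

noncomputable section
namespace HelmholtzFourier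

/-! ### Functions of diagonalizable operators -/

/-- A function of a diagonalizable endomorphism. -/
lemma exists_apply_eq_smul_of_iSup_eigenspace {E : Type*} [AddCommGroup E] [Module ℂ E]
    {A : Module.End ℂ E} (hA : ⨆ μ, Module.End.eigenspace A μ = ⊤) (u : ℂ → ℂ) :
    ∃ B : Module.End ℂ E, ∀ (μ : ℂ) (v : E), A v = μ • v → B v = u μ • v := by
  classical
  have hi : DirectSum.IsInternal (Module.End.eigenspace A) :=
    DirectSum.isInternal_submodule_of_iSupIndep_of_iSup_eq_top
      (Module.End.eigenspaces_iSupIndep A) hA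
  let e := LinearEquiv.ofBijective (DirectSum.coeLinearMap (Module.End.eigenspace A)) hi
  refine ⟨(DirectSum.toModule ℂ ℂ E
    (fun μ ↦ u μ • (Module.End.eigenspace A μ).subtype)) ∘ₗ e.symm.toLinearMap, fun μ v hv ↦ ?_⟩
  have h : e.symm v = DirectSum.lof ℂ ℂ (fun μ ↦ Module.End.eigenspace A μ) μ
      ⟨v, Module.End.mem_eigenspace_iff.2 hv⟩ := by
    rw [LinearEquiv.symm_apply_eq]
    exact (DirectSum.coeLinearMap_lof (Module.End.eigenspace A) μ
      ⟨v, Module.End.mem_eigenspace_iff.2 hv⟩).symm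
  simp [h]

variable {m : ℕ}

/-- The Hermite functions as elements of their span. -/
def hermiteElt {k : ℕ} (H : sphericalHarmonics m k) (j : ℕ) : hermiteSpan m :=
  ⟨hermiteFn m j k H, hermiteFn_mem_hermiteSpan H.2 j⟩

lemma coe_hermiteElt {k : ℕ} (H : sphericalHarmonics m k) (j : ℕ) :
    (hermiteElt H j : Sch m) = hermiteFn m j k H := rfl

lemma span_hermiteElt : Submodule.span ℂ
    {g : hermiteSpan m | ∃ (k : ℕ) (H : sphericalHarmonics m k) (j : ℕ), g = hermiteElt H j} =
      ⊤ := by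
  have h := Submodule.span_span_coe_preimage (R := ℂ)
    (s := {g : Sch m | ∃ j k : ℕ, ∃ H ∈ sphericalHarmonics m k, g = hermiteFn m j k H})
  refine Eq.trans ?_ h
  congr 1
  ext g
  constructor
  · rintro ⟨k, H, j, rfl⟩
    exact ⟨j, k, H, H.2, rfl⟩
  · rintro ⟨j, k, H, hH, h⟩
    exact ⟨k, ⟨H, hH⟩, j, Subtype.ext h⟩

lemma hermiteSpan_induction {P : hermiteSpan m → Prop}
    (mem : ∀ (k : ℕ) (H : sphericalHarmonics m k) (j : ℕ), P (hermiteElt H j))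
    (zero : P 0) (add : ∀ v w, P v → P w → P (v + w)) (smul : ∀ (c : ℂ) v, P v → P (c • v))
    (g : hermiteSpan m) : P g := by
  have hg : g ∈ Submodule.span ℂ
      {g : hermiteSpan m | ∃ (k : ℕ) (H : sphericalHarmonics m k) (j : ℕ), g = hermiteElt H j} := by
    rw [span_hermiteElt]; trivial
  induction hg using Submodule.span_induction with
  | mem g hg => obtain ⟨k, H, j, rfl⟩ := hg; exact mem k H j
  | zero => exact zero
  | add v w _ _ hv hw => exact add v w hv hw
  | smul c v _ hv => exact smul c v hv

lemma apply_mem_hermiteSpan {A : Sch m →L[ℂ] Sch m} {c : ℕ → ℕ → ℂ}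
    (hA : ∀ (k : ℕ) (H : sphericalHarmonics m k) (j : ℕ),
      A (hermiteFn m j k H) = c j k • hermiteFn m j k H) :
    ∀ g ∈ hermiteSpan m, A g ∈ hermiteSpan m := by
  intro g hg
  refine hermiteSpan_induction (P := fun g ↦ A (g : Sch m) ∈ hermiteSpan m) ?_ ?_ ?_ ?_ ⟨g, hg⟩
  · intro k H j
    rw [coe_hermiteElt, hA]
    exact Submodule.smul_mem _ _ (hermiteElt H j).2
  · simp
  · intro v w hv hw
    simpa using Submodule.add_mem _ hv hw
  · intro c v hv
    simpa using Submodule.smul_mem _ c hv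

/-- A function of a continuous operator that is diagonal on the Hermite functions. -/
lemma exists_apply_hermiteElt {A : Sch m →L[ℂ] Sch m} {c : ℕ → ℕ → ℂ}
    (hA : ∀ (k : ℕ) (H : sphericalHarmonics m k) (j : ℕ),
      A (hermiteFn m j k H) = c j k • hermiteFn m j k H) (u : ℂ → ℂ) :
    ∃ B : Module.End ℂ (hermiteSpan m), ∀ (k : ℕ) (H : sphericalHarmonics m k) (j : ℕ),
      B (hermiteElt H j) = u (c j k) • hermiteElt H j := by
  let A' : Module.End ℂ (hermiteSpan m) :=
    A.toLinearMap.restrict (p := hermiteSpan m) (q := hermiteSpan m) (apply_mem_hermiteSpan hA)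
  have hA' : ∀ (k : ℕ) (H : sphericalHarmonics m k) (j : ℕ),
      A' (hermiteElt H j) = c j k • hermiteElt H j := fun k H j ↦ Subtype.ext (hA k H j)
  -- Eigenspaces are automatically independent, so it suffices that the Hermite functions span;
  -- their linear independence is not needed.
  obtain ⟨B, hB⟩ := exists_apply_eq_smul_of_iSup_eigenspace (A := A') (by
    rw [eq_top_iff, ← span_hermiteElt, Submodule.span_le]
    rintro _ ⟨k, H, j, rfl⟩
    exact Submodule.mem_iSup_of_mem (c j k) (Module.End.mem_eigenspace_iff.2 (hA' k H j))) u
  exact ⟨B, fun k H j ↦ hB _ _ (hA' k H j)⟩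

/-! ### Pointwise convergent series of operators -/

lemma hasSum_of_hermiteElt {B : ℕ → hermiteSpan m →ₗ[ℂ] Sch m} {U : Module.End ℂ (hermiteSpan m)}
    (h : ∀ (k : ℕ) (H : sphericalHarmonics m k) (j : ℕ),
      HasSum (fun n ↦ B n (hermiteElt H j)) (U (hermiteElt H j) : Sch m)) (g : hermiteSpan m) :
    HasSum (fun n ↦ B n g) (U g : Sch m) := by
  refine hermiteSpan_induction (P := fun g ↦ HasSum (fun n ↦ B n g) (U g : Sch m)) h ?_ ?_ ?_ g
  · simp
  · intro v w hv hw
    simpa using hv.add hw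
  · intro c v hv
    simpa using hv.const_smul c

lemma isExp_of_hermiteElt {A U : Module.End ℂ (hermiteSpan m)} {c : ℕ → ℕ → ℂ}
    (hA : ∀ (k : ℕ) (H : sphericalHarmonics m k) (j : ℕ),
      A (hermiteElt H j) = c j k • hermiteElt H j)
    (hU : ∀ (k : ℕ) (H : sphericalHarmonics m k) (j : ℕ),
      U (hermiteElt H j) = Complex.exp (c j k) • hermiteElt H j) : IsExp m A U := by
  refine hasSum_of_hermiteElt
    (B := fun n ↦ ((n ! : ℂ)⁻¹) • ((hermiteSpan m).subtype ∘ₗ (A ^ n))) fun k H j ↦ ?_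
  have hp : ∀ n : ℕ, (A ^ n) (hermiteElt H j) = (c j k) ^ n • hermiteElt H j := by
    intro n
    induction n with
    | zero => simp
    | succ n ih => rw [pow_succ', Module.End.mul_apply, ih, map_smul, hA, smul_smul, pow_succ]
  have h := (NormedSpace.expSeries_div_hasSum_exp (c j k)).smul_const
    (hermiteElt H j : Sch m)
  rw [← Complex.exp_eq_exp_ℂ] at h
  rw [hU, Submodule.coe_smul]
  convert h using 2 with n
  simp [hp, smul_smul, div_eq_inv_mul]

lemma IsExp.unique {A U U' : Module.End ℂ (hermiteSpan m)} (hU : IsExp m A U)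
    (hU' : IsExp m A U') : U = U' :=
  LinearMap.ext fun g ↦ Subtype.ext ((hU g).unique (hU' g))

lemma IsSeriesInCasimir.unique {a : ℕ → ℕ} {F F' : Module.End ℂ (hermiteSpan m)}
    (hF : IsSeriesInCasimir m a F) (hF' : IsSeriesInCasimir m a F') : F = F' :=
  LinearMap.ext fun g ↦ Subtype.ext ((hF g).unique (hF' g))

lemma aeval_apply_of_apply_eq_smul {A : Sch m →L[ℂ] Sch m} {c : ℂ} {v : Sch m}
    (h : A v = c • v) (p : Polynomial ℂ) : Polynomial.aeval A p v = p.eval c • v := by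
  induction p using Polynomial.induction_on with
  | C a => simp [Algebra.algebraMap_eq_smul_one]
  | add p q hp hq => simp [hp, hq, add_smul]
  | monomial n a ih =>
    rw [pow_succ, ← mul_assoc, map_mul, Polynomial.aeval_X, mulOp_apply, h, map_smul, ih, smul_smul,
      Polynomial.eval_mul_X, mul_comm]

lemma casimir_hermiteFn_node (hm : 1 ≤ m) (k : ℕ) (H : sphericalHarmonics m k) (j : ℕ) :
    casimir m (hermiteFn m j k H) = node m (m / 2 + k - 1) • hermiteFn m j k H := by
  rw [casimir_hermiteFn H.2, casimirEigenvalue_eq_node hm]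

lemma isSeriesInCasimir_of_hermiteElt (hm : 1 ≤ m) {a : ℕ → ℕ} {F : Module.End ℂ (hermiteSpan m)}
    (hF : ∀ (k : ℕ) (H : sphericalHarmonics m k) (j : ℕ),
      F (hermiteElt H j) = (seriesSum m a (m / 2 + k - 1) : ℂ) • hermiteElt H j) :
    IsSeriesInCasimir m a F := by
  refine hasSum_of_hermiteElt (B := fun n ↦ (a n : ℂ) •
    ((Polynomial.aeval (casimir m) (seriesPoly m n)).toLinearMap ∘ₗ (hermiteSpan m).subtype))
    fun k H j ↦ ?_
  have h := (hasSum_series_node m a (m / 2 + k - 1)).smul_const (hermiteElt H j : Sch m)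
  rw [hF, Submodule.coe_smul]
  convert h using 2 with n
  simp [coe_hermiteElt, aeval_apply_of_apply_eq_smul (casimir_hermiteFn_node hm k H j), smul_smul]

/-- The eigenvalue `i^{s_k + 2j + k}` of the operator exponential on `φ_{j,k}`. -/
def exponentialEigenvalue (m : ℕ) (a : ℕ → ℕ) (j k : ℕ) : ℂ :=
  Complex.I ^ (seriesSum m a (m / 2 + k - 1) + (2 * j + k : ℕ))

lemma exp_I_mul_pi_div_two_mul_intCast (z : ℤ) :
    Complex.exp (Complex.I * (Real.pi / 2) * z) = Complex.I ^ z := by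
  rw [mul_comm, Complex.exp_int_mul, mul_comm Complex.I, Complex.exp_pi_div_two_mul_I]

/-- The operator exponential on the span of the Hermite functions. -/
lemma exists_end_exponential (hm : 1 ≤ m) (a : ℕ → ℕ) :
    ∃ F N U V : Module.End ℂ (hermiteSpan m),
    IsSeriesInCasimir m a F ∧
    (∀ g : hermiteSpan m, (N g : Sch m) = hOp m (g : Sch m) - ((m : ℂ) / 2) • (g : Sch m)) ∧
    IsExp m ((Complex.I * (Real.pi / 2 : ℂ)) • F) U ∧
    IsExp m ((Complex.I * (Real.pi / 2 : ℂ)) • N) V ∧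
    ∀ (k : ℕ) (H : sphericalHarmonics m k) (j : ℕ),
      U (V (hermiteElt H j)) = exponentialEigenvalue m a j k • hermiteElt H j := by
  have hC := fun k H j ↦ casimir_hermiteFn_node hm k H j
  have hN := fun (k : ℕ) (H : sphericalHarmonics m k) (j : ℕ) ↦ hOp_hermiteFn H.2 j
  -- Only the values at the nodes matter; where the series diverges `u` has the default value of
  -- `tsum`.
  let u : ℂ → ℂ := fun t ↦ ∑' n, (a n : ℂ) * (seriesPoly m n).eval t
  have hu : ∀ y, u (node m y) = seriesSum m a y := fun y ↦ (hasSum_series_node m a y).tsum_eq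
  obtain ⟨F, hF⟩ := exists_apply_hermiteElt (c := fun _ k ↦ node m (m / 2 + k - 1)) hC u
  obtain ⟨U, hU⟩ := exists_apply_hermiteElt (c := fun _ k ↦ node m (m / 2 + k - 1)) hC
    (fun t ↦ Complex.exp (Complex.I * (Real.pi / 2) * u t))
  obtain ⟨N, hN'⟩ := exists_apply_hermiteElt (c := fun j k ↦ (2 * j + k + m / 2 : ℂ)) hN
    (fun t ↦ t - m / 2)
  obtain ⟨V, hV⟩ := exists_apply_hermiteElt (c := fun j k ↦ (2 * j + k + m / 2 : ℂ)) hN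
    (fun t ↦ Complex.exp (Complex.I * (Real.pi / 2) * (t - m / 2)))
  simp only [hu, add_sub_cancel_right] at hF hU hN' hV
  refine ⟨F, N, U, V, isSeriesInCasimir_of_hermiteElt hm hF, ?_, ?_, ?_, ?_⟩
  · refine hermiteSpan_induction ?_ (by simp) ?_ ?_
    · intro k H j
      rw [hN', coe_hermiteElt, hN, ← sub_smul, add_sub_cancel_right]
      rfl
    · intro v w hv hw
      simp only [map_add, Submodule.coe_add, hv, hw, smul_add]
      abel
    · intro c v hv
      simp only [map_smul, Submodule.coe_smul, hv, smul_sub, smul_comm c]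
  · exact isExp_of_hermiteElt (fun k H j ↦ by rw [LinearMap.smul_apply, hF, smul_smul]) hU
  · exact isExp_of_hermiteElt (fun k H j ↦ by rw [LinearMap.smul_apply, hN', smul_smul]) hV
  · intro k H j
    rw [hV, map_smul, hU, smul_smul, mul_comm, exponentialEigenvalue, zpow_add₀ Complex.I_ne_zero,
      exp_I_mul_pi_div_two_mul_intCast, ← exp_I_mul_pi_div_two_mul_intCast ((2 * j + k : ℕ) : ℤ)]
    push_cast
    rfl

end HelmholtzFourier
end

noncomputable section
namespace HelmholtzFourier
open Filter Topology

variable {m : ℕ}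

/-! ### Continuous extension of the operator exponential -/

lemma inner_toL2_eq_zero {A : Sch m →L[ℂ] Sch m} (hA : IsFormalAdjoint A A) {v w : Sch m}
    {c d : ℝ} (hv : A v = (c : ℂ) • v) (hw : A w = (d : ℂ) • w) (hcd : c ≠ d) :
    inner ℂ (toL2 m v) (toL2 m w) = 0 := by
  have h := hA v w
  rw [hv, hw, map_smul, map_smul, inner_smul_left, inner_smul_right, Complex.conj_ofReal,
    mul_eq_mul_right_iff] at h
  exact h.resolve_left (by exact_mod_cast hcd)

/-- An operator on the span of the Hermite functions that multiplies them by phases which depend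
only on the eigenvalues of `h` and of the Casimir operator preserves the `L²` inner product. -/
lemma inner_toL2_map {B : Module.End ℂ (hermiteSpan m)} {c : ℝ → ℝ → ℂ}
    (hc : ∀ s t, ‖c s t‖ = 1)
    (hB : ∀ (k : ℕ) (H : sphericalHarmonics m k) (j : ℕ), B (hermiteElt H j) =
      c (2 * j + k + m / 2) (((m : ℝ) / 2 + k - 1) ^ 2) • hermiteElt H j) (v w : hermiteSpan m) :
    inner ℂ (toL2 m (B v)) (toL2 m (B w)) = inner ℂ (toL2 m v) (toL2 m w) := by
  refine hermiteSpan_induction (P := fun v ↦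
    inner ℂ (toL2 m (B v)) (toL2 m (B w)) = inner ℂ (toL2 m v) (toL2 m w)) ?_ ?_ ?_ ?_ v
  · intro k H j
    refine hermiteSpan_induction (P := fun w ↦ inner ℂ (toL2 m (B (hermiteElt H j)))
      (toL2 m (B w)) = inner ℂ (toL2 m (hermiteElt H j)) (toL2 m w)) ?_ ?_ ?_ ?_ w
    · intro k' H' j'
      rw [hB, hB, Submodule.coe_smul, Submodule.coe_smul, map_smul, map_smul, inner_smul_left,
        inner_smul_right, ← mul_assoc]
      -- If both eigenvalues agree, the two phases are equal and cancel. Otherwise symmetry of `h`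
      -- or of Ω makes the inner product zero.
      by_cases h1 : (2 * j + k + m / 2 : ℝ) = 2 * j' + k' + m / 2
      · by_cases h2 : ((m : ℝ) / 2 + k - 1) ^ 2 = ((m : ℝ) / 2 + k' - 1) ^ 2
        · rw [h1, h2, Complex.conj_mul', hc]
          simp
        · rw [inner_toL2_eq_zero (IsFormalAdjoint.casimir m) _ _ h2, mul_zero]
          · rw [coe_hermiteElt, casimir_hermiteFn H.2]; push_cast; rfl
          · rw [coe_hermiteElt, casimir_hermiteFn H'.2]; push_cast; rfl
      · rw [inner_toL2_eq_zero (IsFormalAdjoint.hOp m) _ _ h1, mul_zero]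
        · rw [coe_hermiteElt, hOp_hermiteFn H.2]; push_cast; rfl
        · rw [coe_hermiteElt, hOp_hermiteFn H'.2]; push_cast; rfl
    · simp
    · intro v w hv hw
      simp only [map_add, Submodule.coe_add, inner_add_right, hv, hw]
    · intro c v hv
      simp only [map_smul, Submodule.coe_smul, inner_smul_right, hv]
  · simp
  · intro v w hv hw
    simp only [map_add, Submodule.coe_add, inner_add_left, hv, hw]
  · intro c v hv
    simp only [map_smul, Submodule.coe_smul, inner_smul_left, hv]

lemma norm_toL2_map {B : Module.End ℂ (hermiteSpan m)} {c : ℝ → ℝ → ℂ}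
    (hc : ∀ s t, ‖c s t‖ = 1)
    (hB : ∀ (k : ℕ) (H : sphericalHarmonics m k) (j : ℕ), B (hermiteElt H j) =
      c (2 * j + k + m / 2) (((m : ℝ) / 2 + k - 1) ^ 2) • hermiteElt H j) (v : hermiteSpan m) :
    ‖toL2 m (B v)‖ = ‖toL2 m v‖ := by
  rw [@norm_eq_sqrt_re_inner ℂ, @norm_eq_sqrt_re_inner ℂ, inner_toL2_map hc hB]

lemma hOp_pow_mem_hermiteSpan (N : ℕ) (v : hermiteSpan m) : (hOp m ^ N) v ∈ hermiteSpan m := by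
  induction N with
  | zero => exact v.2
  | succ N ih =>
    rw [pow_succ', mulOp_apply]
    exact apply_mem_hermiteSpan (fun k H j ↦ hOp_hermiteFn H.2 j) _ ih

lemma hOp_pow_hermiteFn {k : ℕ} (H : sphericalHarmonics m k) (j N : ℕ) :
    (hOp m ^ N) (hermiteFn m j k H) = (2 * j + k + m / 2 : ℂ) ^ N • hermiteFn m j k H := by
  induction N with
  | zero => simp
  | succ N ih => rw [pow_succ', mulOp_apply, ih, map_smul, hOp_hermiteFn H.2, smul_smul, pow_succ]

lemma hOp_pow_apply_end {B : Module.End ℂ (hermiteSpan m)} {c : ℕ → ℕ → ℂ}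
    (hB : ∀ (k : ℕ) (H : sphericalHarmonics m k) (j : ℕ),
      B (hermiteElt H j) = c j k • hermiteElt H j) (N : ℕ) (v : hermiteSpan m) :
    (hOp m ^ N) (B v) = B ⟨(hOp m ^ N) v, hOp_pow_mem_hermiteSpan N v⟩ := by
  refine hermiteSpan_induction (P := fun v ↦ (hOp m ^ N) (B v : Sch m) =
    B ⟨(hOp m ^ N) v, hOp_pow_mem_hermiteSpan N v⟩) ?_ ?_ ?_ ?_ v
  · intro k H j
    have h : (⟨(hOp m ^ N) (hermiteElt H j), hOp_pow_mem_hermiteSpan N _⟩ : hermiteSpan m) =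
        (2 * j + k + m / 2 : ℂ) ^ N • hermiteElt H j :=
      Subtype.ext (hOp_pow_hermiteFn H j N)
    rw [h, map_smul, hB, Submodule.coe_smul, map_smul, coe_hermiteElt, hOp_pow_hermiteFn,
      Submodule.coe_smul, Submodule.coe_smul, coe_hermiteElt, smul_comm]
  · have h : (⟨(hOp m ^ N) (0 : hermiteSpan m), hOp_pow_mem_hermiteSpan N _⟩ : hermiteSpan m) = 0 :=
      Subtype.ext (by simp)
    rw [h]
    simp
  · intro v w hv hw
    have h : (⟨(hOp m ^ N) (v + w : hermiteSpan m), hOp_pow_mem_hermiteSpan N _⟩ : hermiteSpan m) =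
        ⟨(hOp m ^ N) v, hOp_pow_mem_hermiteSpan N v⟩ +
          ⟨(hOp m ^ N) w, hOp_pow_mem_hermiteSpan N w⟩ := Subtype.ext (by simp)
    rw [h, map_add, map_add, Submodule.coe_add, map_add, hv, hw, Submodule.coe_add]
  · intro c v hv
    have h : (⟨(hOp m ^ N) (c • v : hermiteSpan m), hOp_pow_mem_hermiteSpan N _⟩ : hermiteSpan m) =
        c • ⟨(hOp m ^ N) v, hOp_pow_mem_hermiteSpan N v⟩ := Subtype.ext (by simp)
    rw [h, map_smul, map_smul, Submodule.coe_smul, map_smul, hv, Submodule.coe_smul]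

/-- An operator on the span of the Hermite functions that multiplies them by phases which depend
only on the eigenvalues of `h` and of the Casimir operator extends continuously. -/
lemma exists_continuous_extension (hm : 1 ≤ m) {B : Module.End ℂ (hermiteSpan m)}
    {c : ℝ → ℝ → ℂ} (hc : ∀ s t, ‖c s t‖ = 1)
    (hB : ∀ (k : ℕ) (H : sphericalHarmonics m k) (j : ℕ), B (hermiteElt H j) =
      c (2 * j + k + m / 2) (((m : ℝ) / 2 + k - 1) ^ 2) • hermiteElt H j) :
    ∃ T : Sch m →L[ℂ] Sch m, ∀ v : hermiteSpan m, T v = B v := by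
  -- `B` commutes with `h` and is isometric in `L²`, so it preserves each norm `‖h^N v‖`, and these
  -- control the seminorms.
  have hN : ∀ (N : ℕ) (v : hermiteSpan m),
      ‖toL2 m ((hOp m ^ N) (B v))‖ = ‖toL2 m ((hOp m ^ N) v)‖ := fun N v ↦ by
    rw [hOp_pow_apply_end (c := fun j k ↦ c (2 * j + k + m / 2) (((m : ℝ) / 2 + k - 1) ^ 2)) hB,
      norm_toL2_map hc hB]
  have : IsUniformAddGroup (hermiteSpan m) := (hermiteSpan m).toAddSubgroup.isUniformAddGroup
  have hcont : Continuous ((hermiteSpan m).subtype ∘ₗ B) := by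
    refine continuous_of_tendsto_nhds_zero ((hermiteSpan m).subtype ∘ₗ B) ?_
    rw [(schwartz_withSeminorms ℂ (Space m) ℂ).tendsto_nhds]
    rintro ⟨k, n⟩ ε hε
    obtain ⟨C, N, hC, h⟩ := exists_seminorm_le hm k n
    have ht : Tendsto (fun v : hermiteSpan m ↦ C * ‖toL2 m ((hOp m ^ N) v)‖) (𝓝 0) (𝓝 0) := by
      have hcts : Continuous (fun v : hermiteSpan m ↦ C * ‖toL2 m ((hOp m ^ N) v)‖) :=
        continuous_const.mul (((toL2 m).continuous.comp
          ((hOp m ^ N).continuous.comp continuous_subtype_val)).norm)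
      simpa using hcts.tendsto 0
    filter_upwards [ht.eventually_lt_const hε] with v hv
    refine lt_of_le_of_lt ?_ hv
    rw [← hN]
    simpa using h (B v)
  let B' : hermiteSpan m →L[ℂ] Sch m := ⟨(hermiteSpan m).subtype ∘ₗ B, hcont⟩
  have hd : DenseRange (hermiteSpan m).subtypeL := by
    simpa [DenseRange] using dense_hermiteSpan hm
  refine ⟨B'.extend (hermiteSpan m).subtypeL, fun v ↦ ?_⟩
  exact ContinuousLinearMap.extend_eq B' hd isUniformEmbedding_subtype_val.isUniformInducing v

/-! ### Operators determined by the Hermite functions -/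

lemma continuousLinearMap_ext_hermiteFn (hm : 1 ≤ m) {A B : Sch m →L[ℂ] Sch m}
    (h : ∀ (k : ℕ) (H : sphericalHarmonics m k) (j : ℕ),
      A (hermiteFn m j k H) = B (hermiteFn m j k H)) : A = B := by
  refine ContinuousLinearMap.ext_on (s := (hermiteSpan m : Set (Sch m))) ?_ fun g hg ↦ ?_
  · rw [Submodule.span_eq]
    exact dense_hermiteSpan hm
  · refine hermiteSpan_induction (P := fun g ↦ A g = B g) h (by simp) ?_ ?_ ⟨g, hg⟩
    · intro v w hv hw; simp [hv, hw]
    · intro c v hv; simp [hv]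

lemma exponentialEigenvalue_pow_four (a : ℕ → ℕ) (j k : ℕ) :
    exponentialEigenvalue m a j k ^ 4 = 1 := by
  rw [exponentialEigenvalue, ← zpow_natCast, ← zpow_mul, mul_comm, zpow_mul]
  have : Complex.I ^ (((4 : ℕ) : ℤ)) = 1 := by rw [zpow_natCast]; exact Complex.I_pow_four
  rw [this, one_zpow]

lemma exponentialEigenvalue_succ (a : ℕ → ℕ) (j k : ℕ) :
    exponentialEigenvalue m a (j + 1) k = -exponentialEigenvalue m a j k := by
  unfold exponentialEigenvalue
  rw [show (seriesSum m a (m / 2 + k - 1) + (2 * (j + 1) + k : ℕ) : ℤ) =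
    (seriesSum m a (m / 2 + k - 1) + (2 * j + k : ℕ)) + (2 : ℕ) by push_cast; ring,
    zpow_add₀ Complex.I_ne_zero, zpow_natCast, Complex.I_sq]
  ring

/-- The operator exponential and its eigenvalues. -/
lemma exists_isOperatorExponential (hm : 1 ≤ m) (a : ℕ → ℕ) : ∃ T : Sch m →L[ℂ] Sch m,
    IsOperatorExponential m a T ∧ ∀ (k : ℕ) (H : sphericalHarmonics m k) (j : ℕ),
      T (hermiteFn m j k H) = exponentialEigenvalue m a j k • hermiteFn m j k H := by
  obtain ⟨F, N, U, V, hF, hN, hU, hV, hUV⟩ := exists_end_exponential hm a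
  -- The real part makes `c` a phase at all arguments. At the nodes the sum is an integer, so
  -- nothing changes there.
  let c : ℝ → ℝ → ℂ := fun s t ↦ Complex.exp (((Real.pi / 2 *
    ((∑' n, (a n : ℂ) * (seriesPoly m n).eval (t : ℂ)).re + (s - m / 2)) : ℝ) : ℂ) * Complex.I)
  have hc : ∀ (j k : ℕ), c (2 * j + k + m / 2) (((m : ℝ) / 2 + k - 1) ^ 2) =
      exponentialEigenvalue m a j k := fun j k ↦ by
    have ht : (((((m : ℝ) / 2 + k - 1) ^ 2 : ℝ)) : ℂ) = node m (m / 2 + k - 1) := by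
      rw [← casimirEigenvalue_eq_node hm]
      push_cast
      rfl
    simp only [c]
    rw [ht, (hasSum_series_node m a _).tsum_eq, Complex.intCast_re, add_sub_cancel_right,
      exponentialEigenvalue, ← exp_I_mul_pi_div_two_mul_intCast]
    congr 1
    push_cast
    ring
  obtain ⟨T, hT⟩ := exists_continuous_extension hm (B := U * V) (c := c)
    (fun s t ↦ Complex.norm_exp_ofReal_mul_I _) (fun k H j ↦ by
      rw [Module.End.mul_apply, hUV, hc])
  exact ⟨T, ⟨F, N, U, V, hF, hN, hU, hV, hT⟩, fun k H j ↦ by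
    rw [← coe_hermiteElt, hT, Module.End.mul_apply, hUV]
    rfl⟩

lemma IsOperatorExponential.unique (hm : 1 ≤ m) {a : ℕ → ℕ} {T T' : Sch m →L[ℂ] Sch m}
    (hT : IsOperatorExponential m a T) (hT' : IsOperatorExponential m a T') : T = T' := by
  obtain ⟨F, N, U, V, hF, hN, hU, hV, hUV⟩ := hT
  obtain ⟨F', N', U', V', hF', hN', hU', hV', hUV'⟩ := hT'
  obtain rfl := hF.unique hF'
  obtain rfl : N = N' := LinearMap.ext fun g ↦ Subtype.ext ((hN g).trans (hN' g).symm)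
  obtain rfl := hU.unique hU'
  obtain rfl := hV.unique hV'
  exact continuousLinearMap_ext_hermiteFn hm fun k H j ↦
    (hUV (hermiteElt H j)).trans (hUV' (hermiteElt H j)).symm

/-- Diagonal operators whose eigenvalues alternate in `j` satisfy the Helmholtz relations. -/
lemma helmholtzRelations_of_hermiteFn (hm : 1 ≤ m) {T : Sch m →L[ℂ] Sch m} {c : ℕ → ℕ → ℂ}
    (hT : ∀ (k : ℕ) (H : sphericalHarmonics m k) (j : ℕ),
      T (hermiteFn m j k H) = c j k • hermiteFn m j k H)
    (hc : ∀ j k, c (j + 1) k = -c j k) : HelmholtzRelations m T.toLinearMap := by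
  have h1 : T * laplaceOp m = -(normSqOp m * T) := by
    refine continuousLinearMap_ext_hermiteFn hm fun k H j ↦ ?_
    rw [neg_apply, mulOp_apply, mulOp_apply, hT, map_smul,
      laplaceOp_hermiteFn H.2, normSqOp_hermiteFn]
    -- At `j = 0` the index `j - 1` is truncated to `0`, but its coefficient `2j(…)` vanishes.
    rcases j with _ | j
    · simp only [zero_add, show c 1 k = -c 0 k from hc 0 k, map_sub, map_smul, hT, Nat.cast_zero, mul_zero, zero_mul, zero_smul,
        map_zero]
      module
    · simp only [map_sub, map_smul, hT, hc, Nat.add_sub_cancel]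
      module
  have h2 : T * normSqOp m = -(laplaceOp m * T) := by
    refine continuousLinearMap_ext_hermiteFn hm fun k H j ↦ ?_
    rw [neg_apply, mulOp_apply, mulOp_apply, hT, map_smul,
      laplaceOp_hermiteFn H.2, normSqOp_hermiteFn]
    rcases j with _ | j
    · simp only [zero_add, show c 1 k = -c 0 k from hc 0 k, map_sub, map_add, map_smul, hT, Nat.cast_zero, mul_zero, zero_mul, zero_smul,
        map_zero]
      module
    · simp only [map_sub, map_add, map_smul, hT, hc, Nat.add_sub_cancel]
      module
  exact ⟨fun g ↦ congrArg (fun A : Sch m →L[ℂ] Sch m ↦ A g) h1,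
    fun g ↦ congrArg (fun A : Sch m →L[ℂ] Sch m ↦ A g) h2⟩

lemma pow_four_eq_id_of_hermiteFn (hm : 1 ≤ m) {T : Sch m →L[ℂ] Sch m} {c : ℕ → ℕ → ℂ}
    (hT : ∀ (k : ℕ) (H : sphericalHarmonics m k) (j : ℕ),
      T (hermiteFn m j k H) = c j k • hermiteFn m j k H)
    (hc : ∀ j k, c j k ^ 4 = 1) : T.toLinearMap ^ 4 = LinearMap.id := by
  have h : T ^ 4 = 1 := by
    refine continuousLinearMap_ext_hermiteFn hm fun k H j ↦ ?_
    simp only [pow_succ', pow_zero, mul_one, mulOp_apply, hT, map_smul, smul_smul]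
    rw [show c j k * c j k * c j k * c j k = c j k ^ 4 by ring, hc, one_smul]
    rfl
  ext1 g
  have := congrArg (fun A : Sch m →L[ℂ] Sch m ↦ A g) h
  simpa only [pow_succ', pow_zero, mul_one] using! this

end HelmholtzFourier
end

noncomputable section
namespace HelmholtzFourier

variable {m : ℕ}

/-! ### Operators with the Helmholtz relations -/

/-- The eigenvalues of a diagonal operator that satisfies the second Helmholtz relation
alternate. -/
lemma eigenvalue_succ_of_helmholtz (hm : 1 ≤ m) {T : Sch m →ₗ[ℂ] Sch m}
    (hT : ∀ g, T (normSqOp m g) = -laplaceOp m (T g)) {k : ℕ} {H : sphericalHarmonics m k}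
    (hH : H ≠ 0) {c : ℕ → ℂ} (hc : ∀ j, T (hermiteFn m j k H) = c j • hermiteFn m j k H) (j : ℕ) :
    c (j + 1) = -c j := by
  -- The relation applied to `φ_j`: the `φ_j` terms cancel. By induction the right side vanishes, so
  -- only `φ_{j+1} ≠ 0` is needed and no linear independence.
  have key : ∀ j, (c (j + 1) + c j) • hermiteFn m (j + 1) k (H : MvPolynomial (Fin m) ℂ) =
      (-2 * (2 * j * (j + (m / 2 + k - 1))) * (c (j - 1) + c j) : ℂ) •
        hermiteFn m (j - 1) k (H : MvPolynomial (Fin m) ℂ) := fun j ↦ by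
    have h := hT (hermiteFn m j k H)
    rw [hc, map_smul, normSqOp_hermiteFn, laplaceOp_hermiteFn H.2] at h
    simp only [map_add, map_sub, map_smul, hc] at h
    linear_combination (norm := module) (-2 : ℂ) • h
  have hne : ∀ j, hermiteFn m j k (H : MvPolynomial (Fin m) ℂ) ≠ 0 := fun j ↦
    hermiteFn_ne_zero hm j k fun h ↦ hH (Subtype.ext h)
  have hz : ∀ j, c (j + 1) + c j = 0 := by
    intro j
    induction j with
    | zero =>
      have h := key 0
      simp only [Nat.cast_zero, mul_zero, zero_mul, zero_smul] at h
      exact (smul_eq_zero.1 h).resolve_right (hne _)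
    | succ j ih =>
      have h := key (j + 1)
      rw [Nat.add_sub_cancel, add_comm (c j), ih, mul_zero, zero_smul] at h
      exact (smul_eq_zero.1 h).resolve_right (hne _)
  exact eq_neg_of_add_eq_zero_left (hz j)

lemma exists_I_pow_of_pow_four_eq_one {z : ℂ} (hz : z ^ 4 = 1) : ∃ s : ℕ, z = Complex.I ^ s := by
  obtain ⟨s, -, hs⟩ := Complex.isPrimitiveRoot_I.eq_pow_of_pow_eq_one hz
  exact ⟨s, hs.symm⟩

lemma eq_of_eigenvalue_succ {c d : ℕ → ℂ} (hc : ∀ j, c (j + 1) = -c j)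
    (hd : ∀ j, d (j + 1) = -d j) (h : c 0 = d 0) (j : ℕ) : c j = d j := by
  induction j with
  | zero => exact h
  | succ j ih => rw [hc, hd, ih]

lemma I_zpow_eq_of_modEq {s t : ℤ} (h : s ≡ t [ZMOD 4]) : Complex.I ^ s = Complex.I ^ t := by
  obtain ⟨q, hq⟩ := h.symm.dvd
  rw [show s = t + (4 : ℕ) * q by push_cast; linarith, zpow_add₀ Complex.I_ne_zero, zpow_mul,
    zpow_natCast, Complex.I_pow_four, one_zpow, mul_one]

/-- Every sequence of exponents is realized by the series `∑ aₙ Eₙ` or `∑ aₙ Dₙ`, modulo `4`. -/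
lemma exists_seriesSum_modEq (hm : 2 ≤ m) (s : ℕ → ℤ) : ∃ a : ℕ → ℕ,
    (∀ n, a n ∈ ({0, 1, 2, 3} : Set ℕ)) ∧
      ∀ k, seriesSum m a (m / 2 + k - 1) ≡ s k [ZMOD 4] := by
  -- The map `n ↦ n + 1 - m/2` is a left inverse of `k ↦ m/2 + k - 1`, because `m ≥ 2` gives `m / 2
  -- ≥ 1`. Values at smaller `n` are irrelevant.
  refine ⟨triangularSol (fun n ↦ s (n + 1 - m / 2)) (seriesValue m), triangularSol_mem _ _,
    fun k ↦ ?_⟩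
  have h := triangularSol_sum_modEq (fun n ↦ s (n + 1 - m / 2)) (seriesValue m)
    (seriesValue_self m) (m / 2 + k - 1)
  rwa [show m / 2 + k - 1 + 1 - m / 2 = k by omega] at h

/-- The Hermite function depends linearly on `H`, so agreement on one basis of `ℋ_k` gives agreement
on all of `ℋ_k`, as the density argument requires. -/
lemma hermiteFn_eq_of_basis {ι : Type*} {k : ℕ} (b : Module.Basis ι ℂ (sphericalHarmonics m k))
    (j : ℕ) {A B : Sch m →ₗ[ℂ] Sch m}
    (h : ∀ l, A (hermiteFn m j k (b l : MvPolynomial (Fin m) ℂ)) = B (hermiteFn m j k (b l)))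
    (H : sphericalHarmonics m k) : A (hermiteFn m j k H) = B (hermiteFn m j k H) := by
  let L : MvPolynomial (Fin m) ℂ →ₗ[ℂ] Sch m := ((2 : ℂ) ^ j * (j ! : ℂ)) •
    (polyGauss m ∘ₗ
      LinearMap.mulLeft ℂ (Polynomial.aeval (radSq m) (laguerrePoly ((m : ℂ) / 2 + k - 1) j)))
  have hL : ∀ P, L P = hermiteFn m j k P := fun P ↦ by
    rw [hermiteFn_eq_radialFn, radialFn_apply]
    rfl
  have e : A ∘ₗ L ∘ₗ (sphericalHarmonics m k).subtype =
      B ∘ₗ L ∘ₗ (sphericalHarmonics m k).subtype :=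
    b.ext fun l ↦ by simpa [hL] using h l
  simpa [hL] using LinearMap.congr_fun e H

/-- The eigenvalues of an operator with properties (i)-(iii) agree with those of an operator
exponential. -/
lemma exists_exponentialEigenvalue_eq (hm : 2 ≤ m) {ι : ℕ → Type*}
    (b : ∀ k, Module.Basis (ι k) ℂ (sphericalHarmonics m k)) {T : Sch m →ₗ[ℂ] Sch m}
    (hT : HelmholtzRelations m T) (hT4 : T ^ 4 = LinearMap.id) {c : ℕ → ℕ → ℂ}
    (hc : ∀ (j k : ℕ) (l : ι k), T (hermiteFn m j k (b k l : MvPolynomial (Fin m) ℂ)) =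
      c j k • hermiteFn m j k (b k l : MvPolynomial (Fin m) ℂ)) :
    ∃ a : ℕ → ℕ, (∀ n, a n ∈ ({0, 1, 2, 3} : Set ℕ)) ∧
      ∀ (j k : ℕ), ι k → c j k = exponentialEigenvalue m a j k := by
  have hm1 : 1 ≤ m := by omega
  have h0 : ∀ k, ∃ s : ℤ, ι k → c 0 k = Complex.I ^ s := fun k ↦ by
    -- An empty index set imposes no condition, so nothing about the dimension of `ℋ_k` is needed.
    by_cases hι : Nonempty (ι k)
    · obtain ⟨l⟩ := hι
      have hne : hermiteFn m 0 k (b k l : MvPolynomial (Fin m) ℂ) ≠ 0 :=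
        hermiteFn_ne_zero hm1 0 k fun h ↦ (b k).ne_zero l (Subtype.ext h)
      have h := LinearMap.congr_fun hT4 (hermiteFn m 0 k (b k l : MvPolynomial (Fin m) ℂ))
      simp only [pow_succ', pow_zero, mul_one, Module.End.mul_apply, hc, map_smul, smul_smul,
        LinearMap.id_apply] at h
      obtain ⟨s, hs⟩ := exists_I_pow_of_pow_four_eq_one (z := c 0 k)
        (smul_left_injective ℂ hne (by simpa [pow_succ] using h))
      exact ⟨s, fun _ ↦ by rw [hs, zpow_natCast]⟩
    · exact ⟨0, fun l ↦ (hι ⟨l⟩).elim⟩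
  choose s hs using h0
  -- The factor from `h - m/2` already contributes `i^k` at `j = 0`.
  obtain ⟨a, ha, has⟩ := exists_seriesSum_modEq hm fun k ↦ s k - k
  refine ⟨a, ha, fun j k l ↦ eq_of_eigenvalue_succ (c := fun j ↦ c j k)
    (d := fun j ↦ exponentialEigenvalue m a j k)
    (eigenvalue_succ_of_helmholtz hm1 hT.2 ((b k).ne_zero l) fun j ↦ hc j k l)
    (fun j ↦ exponentialEigenvalue_succ a j k) ?_ j⟩
  rw [hs k l, exponentialEigenvalue]
  refine (I_zpow_eq_of_modEq ?_).symm
  have h := (has k).add_right (k : ℤ)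
  simpa using h

end HelmholtzFourier
end

theorem theorem2p6 (m : ℕ) (hm : 1 ≤ m) {ι : ℕ → Type*}
    (b : ∀ k, Module.Basis (ι k) ℂ (HelmholtzFourier.sphericalHarmonics m k)) :
    (∀ a : ℕ → ℕ, (∀ n, a n ∈ ({0, 1, 2, 3} : Set ℕ)) →
      ∃ T : HelmholtzFourier.Sch m →L[ℂ] HelmholtzFourier.Sch m,
        HelmholtzFourier.IsOperatorExponential m a T ∧
        (∀ T' : HelmholtzFourier.Sch m →L[ℂ] HelmholtzFourier.Sch m,
          HelmholtzFourier.IsOperatorExponential m a T' → T' = T) ∧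
        HelmholtzFourier.HelmholtzRelations m T.toLinearMap ∧
        HelmholtzFourier.DiagonalOnHermite m b T.toLinearMap ∧
        T.toLinearMap ^ 4 = LinearMap.id) ∧
    (2 ≤ m → ∀ T : HelmholtzFourier.Sch m →ₗ[ℂ] HelmholtzFourier.Sch m,
      HelmholtzFourier.HelmholtzRelations m T →
      HelmholtzFourier.DiagonalOnHermite m b T →
      T ^ 4 = LinearMap.id →
      ∃ a : ℕ → ℕ, (∀ n, a n ∈ ({0, 1, 2, 3} : Set ℕ)) ∧
        ∃ S : HelmholtzFourier.Sch m →L[ℂ] HelmholtzFourier.Sch m,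
          HelmholtzFourier.IsOperatorExponential m a S ∧
          (∀ (j k : ℕ) (l : ι k),
            T (HelmholtzFourier.hermiteFn m j k (b k l : MvPolynomial (Fin m) ℂ)) =
              S (HelmholtzFourier.hermiteFn m j k (b k l : MvPolynomial (Fin m) ℂ))) ∧
          (Continuous T → T = S.toLinearMap)) := by
  refine ⟨fun a _ ↦ ?_, fun hm2 T hT ⟨c, hc⟩ hT4 ↦ ?_⟩
  · obtain ⟨T, hT, hTe⟩ := HelmholtzFourier.exists_isOperatorExponential hm a
    exact ⟨T, hT, fun T' hT' ↦ hT'.unique hm hT,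
      HelmholtzFourier.helmholtzRelations_of_hermiteFn hm hTe
        (HelmholtzFourier.exponentialEigenvalue_succ a),
      ⟨HelmholtzFourier.exponentialEigenvalue m a, fun j k l ↦ hTe k (b k l) j⟩,
      HelmholtzFourier.pow_four_eq_id_of_hermiteFn hm hTe
        (HelmholtzFourier.exponentialEigenvalue_pow_four a)⟩
  · obtain ⟨a, ha, hca⟩ := HelmholtzFourier.exists_exponentialEigenvalue_eq hm2 b hT hT4 hc
    obtain ⟨S, hS, hSe⟩ := HelmholtzFourier.exists_isOperatorExponential hm a
    have hTS : ∀ (j k : ℕ) (l : ι k),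
        T (HelmholtzFourier.hermiteFn m j k (b k l : MvPolynomial (Fin m) ℂ)) =
          S (HelmholtzFourier.hermiteFn m j k (b k l : MvPolynomial (Fin m) ℂ)) := fun j k l ↦ by
      rw [hc, hSe k (b k l) j, hca j k l]
    refine ⟨a, ha, S, hS, hTS, fun hcont ↦ ?_⟩
    have h : (⟨T, hcont⟩ : HelmholtzFourier.Sch m →L[ℂ] HelmholtzFourier.Sch m) = S :=
      HelmholtzFourier.continuousLinearMap_ext_hermiteFn hm fun k H j ↦
        HelmholtzFourier.hermiteFn_eq_of_basis (b k) j (A := T) (B := S.toLinearMap)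
          (fun l ↦ hTS j k l) H
    rw [← h]
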